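/- Let $M=\mathbb{CP}_1\times\mathbb{CP}_1$ with its standard complex structure $J$ and complex orientation. For a Kähler metric $g$ on $M$ write $\omega_g=g(J\cdot,\cdot)$. We say that $g$, together with a smooth function $f>0$ on $M$, engenders a solution of the Einstein–Maxwell equations if $f$ is a real holomorphy potential for $g$ (that is, $\nabla_{\bar\mu}\nabla_{\bar\nu}f=0$), the metric $h=f^{-2}g$ has constant scalar curvature, and there is a unique $2$-form $F$ with self-dual part $F^+=\omega_g$ such that $$dF=0,\qquad d\star F=0,\qquad [r+F\circ F]_0=0,$$ where $r$ is the Ricci tensor of $h$, $(F\circ F)_{jk}=F_j{}^{\ell}F_{\ell k}$, and $[\ ]_0$ is the trace-free part, all with respect to $h$; and if, moreover, $h$ and this $F$ are $J$-invariant. **Theorem.** Let $[\omega]\in H^2(M,\mathbb R)$ be a Kähler class for which the area of one factor $\mathbb{CP}_1$ is more than four times the area of the other. Then there are two Kähler metrics $g_1,g_2$ on $M$ with $[\omega_{g_1}]=[\omega_{g_2}]=[\omega]$, and smooth functions $f_1,f_2>0$, such that $(g_1,f_1)$ and $(g_2,f_2)$ both engender solutions of the Einstein–Maxwell equations, with metrics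 $h_1=f_1^{-2}g_1$ and $h_2=f_2^{-2}g_2$, and: 1. $f_1=1$, and $h_1=g_1$ is a Riemannian product of two round $2$-spheres; in particular $h_1$ is locally symmetric. 2. For some $0<a<b$, $f_2=t$ is the pull-back of a function on the factor of larger area which takes the values $a$ and $b$ at the points $z=0$ and $z=\infty$ and values in $(a,b)$ elsewhere. With $\theta=\arg z$, away from these two points $$g_2=\frac{dt^2}{\Psi(t)}+\Psi(t)\,d\theta^2+g_\Sigma,\qquad \Psi(t)=\frac{(t-a)(t-b)}{a-b}\left[2-\frac{(t-a)(t-b)}{ab}\right],$$ where $g_\Sigma$ is the round metric of radius $R$ on the other factor, with $R^2=\dfrac{(b-a)ab}{(a+b)^2}$. The metric $h_2=t^{-2}g_2$ is not locally symmetric. 3. $g_1$ and $g_2$ lie in different orbits of $\mathrm{Aut}_0(M)=PSL(2,\mathbb C)\times PSL(2,\mathbb C)$, and no diffeomorphism of $M$ carries $h_2$ to a positive constant multiple of $h_1$; in particular $h_1$ and $h_2$ are not isometric. -/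

import Mathlib

noncomputable section

namespace EinsteinMaxwell

open scoped ContDiff Topology LinearAlgebra.Projectivization Matrix

/-! ## The complex surface `CP₁ × CP₁` and its affine charts -/

/-- The complex projective line. -/
abbrev CP1 : Type := ℙ ℂ (Fin 2 → ℂ)

/-- The complex surface `M = CP₁ × CP₁`; the factors are numbered by `Fin 2`. -/
abbrev M : Type := Fin 2 → CP1

/-- Index set of the real coordinates of a chart: `(p, 0)` is the real part and `(p, 1)` the
imaginary part of the affine coordinate of the factor `p`. -/
abbrev Ix : Type := Fin 2 × Fin 2

/-- The domain `ℝ⁴ = ℂ²` of every chart. -/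
abbrev V : Type := Ix → ℝ

/-- The names of the four charts: a choice, for each factor, of one of the two affine charts. -/
abbrev Chart : Type := Fin 2 → Fin 2

/-- The affine parametrizations of `CP₁`: `z ↦ [1 : z]` for `i = 0` and `z ↦ [z : 1]` for
`i = 1`. -/
def affine (i : Fin 2) (z : ℂ) : CP1 :=
  Projectivization.mk ℂ (Function.update (fun _ => z) i 1)
    (fun h => one_ne_zero (α := ℂ) (by simpa using congrFun h i))

/-- The affine coordinates on `CP₁`: `[v₀ : v₁] ↦ v₁ / v₀` for `i = 0` and `v₀ / v₁` for `i = 1`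
(used only where the denominator is not zero). -/
def affineCoord (i : Fin 2) : CP1 → ℂ :=
  Projectivization.lift (fun v => v.1 (1 - i) / v.1 i) (by
    rintro ⟨a, ha⟩ ⟨b, hb⟩ t h
    have ht : t ≠ 0 := by
      rintro rfl
      exact ha (by simpa using h)
    have h' : a = t • b := h
    subst h'
    simp [mul_div_mul_left _ _ ht])

/-- The complex affine coordinate of the factor `p`. -/
def zc (p : Fin 2) (x : V) : ℂ := ⟨x (p, 0), x (p, 1)⟩

/-- The inverse of the chart `c`, defined on all of `ℝ⁴`. -/
def par (c : Chart) (x : V) : M := fun p => affine (c p) (zc p x)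

/-- The chart `c` (used only on the image of `par c`). -/
def coord (c : Chart) (m : M) : V := fun k =>
  if k.2 = 0 then (affineCoord (c k.1) (m k.1)).re else (affineCoord (c k.1) (m k.1)).im

/-! ## Functions, maps and tensor fields -/

/-- The partial derivative in the coordinate direction `i`. -/
def pd (i : Ix) (u : V → ℝ) (x : V) : ℝ := fderiv ℝ u x (Pi.single i 1)

/-- The Jacobian matrix of a map between coordinate domains. -/
def jac (φ : V → V) (x : V) : Matrix Ix Ix ℝ := Matrix.of fun k i => pd i (fun y => φ y k) x

/-- Smooth real functions on `M`. -/
def SmoothFun (f : M → ℝ) : Prop := ∀ c, ContDiff ℝ ∞ (f ∘ par c)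

/-- Smooth maps from `M` to `M`. -/
def SmoothMap (Φ : M → M) : Prop :=
  ∀ c c' x, Φ (par c x) ∈ Set.range (par c') →
    (∀ᶠ y in 𝓝 x, Φ (par c y) ∈ Set.range (par c')) ∧
      ContDiffAt ℝ ∞ (coord c' ∘ Φ ∘ par c) x

/-- The components of a covariant 2-tensor field in the four charts. -/
abbrev Tensor2 : Type := Chart → V → Matrix Ix Ix ℝ

/-- The components of a 1-form in the four charts. -/
abbrev Tensor1 : Type := Chart → V → Ix → ℝ

/-- `S = Φ^* T`, for covariant 2-tensor fields. -/
def IsPullback (Φ : M → M) (T S : Tensor2) : Prop :=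
  ∀ c c' x x', Φ (par c x) = par c' x' →
    S c x = (jac (coord c' ∘ Φ ∘ par c) x)ᵀ * T c' x' * jac (coord c' ∘ Φ ∘ par c) x

/-- The components are smooth and transform as those of a covariant 2-tensor field on `M`. -/
def IsTensorField (T : Tensor2) : Prop :=
  (∀ c i j, ContDiff ℝ ∞ fun x => T c x i j) ∧ IsPullback id T T

/-- Smooth 1-forms on `M`. -/
def IsOneForm (α : Tensor1) : Prop :=
  (∀ c i, ContDiff ℝ ∞ fun x => α c x i) ∧
    ∀ c c' x x', par c x = par c' x' → α c x = (jac (coord c' ∘ par c) x)ᵀ *ᵥ α c' x'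

/-- Smooth 2-forms on `M`. -/
def IsTwoForm (F : Tensor2) : Prop := IsTensorField F ∧ ∀ c x, (F c x)ᵀ = -F c x

/-- Smooth Riemannian metrics on `M`. -/
def IsMetric (g : Tensor2) : Prop := IsTensorField g ∧ ∀ c x, (g c x).PosDef

/-- The 2-form is closed. -/
def IsClosedForm (F : Tensor2) : Prop :=
  ∀ c x i j k,
    pd i (fun y => F c y j k) x + pd j (fun y => F c y k i) x + pd k (fun y => F c y i j) x = 0

/-- Two 2-forms represent the same de Rham cohomology class: they differ by `dα` for a global
smooth 1-form `α`. -/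
def Cohomologous (F F' : Tensor2) : Prop :=
  ∃ α : Tensor1, IsOneForm α ∧
    ∀ c x i j, F c x i j - F' c x i j = pd i (fun y => α c y j) x - pd j (fun y => α c y i) x

/-! ## Curvature of a Riemannian metric, in a coordinate domain -/

/-- Christoffel symbols `Γ^k_{ij}`. -/
def christoffel (G : V → Matrix Ix Ix ℝ) (k i j : Ix) (x : V) : ℝ :=
  (1 / 2) * ∑ l, (G x)⁻¹ k l *
    (pd i (fun y => G y j l) x + pd j (fun y => G y i l) x - pd l (fun y => G y i j) x)

/-- The Riemann tensor `R^l_{kij}`, the `l`-component of `R(∂_i, ∂_j) ∂_k`. -/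
def riem (G : V → Matrix Ix Ix ℝ) (l k i j : Ix) (x : V) : ℝ :=
  pd i (christoffel G l j k) x - pd j (christoffel G l i k) x +
    ∑ m, (christoffel G l i m x * christoffel G m j k x -
      christoffel G l j m x * christoffel G m i k x)

/-- The Ricci tensor. -/
def ricci (G : V → Matrix Ix Ix ℝ) (x : V) : Matrix Ix Ix ℝ :=
  Matrix.of fun j k => ∑ i, riem G i k i j x

/-- The trace of a covariant 2-tensor with respect to the metric. -/
def trG (G T : Matrix Ix Ix ℝ) : ℝ := ∑ j, ∑ k, G⁻¹ j k * T j k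

/-- The trace-free part of a covariant 2-tensor with respect to the metric. -/
def traceFree (G T : Matrix Ix Ix ℝ) : Matrix Ix Ix ℝ := T - (trG G T / 4) • G

/-- The scalar curvature. -/
def scal (G : V → Matrix Ix Ix ℝ) (x : V) : ℝ := trG (G x) (ricci G x)

/-- The covariant derivative `∇_m R^l_{kij}` of the Riemann tensor. -/
def nablaRiem (G : V → Matrix Ix Ix ℝ) (m l k i j : Ix) (x : V) : ℝ :=
  pd m (riem G l k i j) x +
    ∑ n, (christoffel G l m n x * riem G n k i j x - christoffel G n m k x * riem G l n i j x -
      christoffel G n m i x * riem G l k n j x - christoffel G n m j x * riem G l k i n x)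

/-- The covariant Hessian of a function. -/
def hess (G : V → Matrix Ix Ix ℝ) (u : V → ℝ) (x : V) : Matrix Ix Ix ℝ :=
  Matrix.of fun i j => pd i (pd j u) x - ∑ k, christoffel G k i j x * pd k u x

/-- The metric is locally symmetric: `∇R = 0`. -/
def LocallySymmetric (g : Tensor2) : Prop := ∀ c x m l k i j, nablaRiem (g c) m l k i j x = 0

/-- The metric has constant scalar curvature. -/
def ConstantScalar (g : Tensor2) : Prop := ∃ s : ℝ, ∀ c x, scal (g c) x = s

/-! ## Hodge star and the Einstein-Maxwell equations -/

/-- The Levi-Civita symbol for the complex orientation `(Re z₀, Im z₀, Re z₁, Im z₁)`. -/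
def eps (i j k l : Ix) : ℝ :=
  Matrix.det (Matrix.of fun r s : Fin 4 =>
    if ![i, j, k, l] r = ![((0, 0) : Ix), (0, 1), (1, 0), (1, 1)] s then (1 : ℝ) else 0)

/-- The Hodge star on 2-forms. -/
def hodgeStar (g F : Tensor2) : Tensor2 := fun c x => Matrix.of fun i j =>
  (1 / 2) * Real.sqrt (g c x).det *
    ∑ k, ∑ l, ((g c x)⁻¹ * F c x * ((g c x)⁻¹)ᵀ) k l * eps k l i j

/-- The self-dual part `F⁺ = (F + ⋆F) / 2`. -/
def selfDualPart (g F : Tensor2) : Tensor2 := fun c x => (1 / 2 : ℝ) • (F c x + hodgeStar g F c x)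

/-- The composition `(F ∘ F)_{jk} = F_j^l F_{lk}`. -/
def composeForm (g F : Tensor2) : Tensor2 := fun c x => F c x * (g c x)⁻¹ * F c x

/-- The Einstein-Maxwell equations `dF = 0`, `d⋆F = 0`, `[r + F ∘ F]₀ = 0` on `M`. -/
structure IsEinsteinMaxwell (h F : Tensor2) : Prop where
  metric : IsMetric h
  form : IsTwoForm F
  closed : IsClosedForm F
  coclosed : IsClosedForm (hodgeStar h F)
  energy : ∀ c x, traceFree (h c x) (ricci (h c) x + composeForm h F c x) = 0

/-! ## Kähler geometry -/

/-- The matrix of the complex structure: `J ∂_{Re z_p} = ∂_{Im z_p}`, `J ∂_{Im z_p} = -∂_{Re z_p}`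
(the same in all charts, since these are holomorphic). -/
def Jmat : Matrix Ix Ix ℝ := Matrix.of fun k i =>
  if k.1 = i.1 then (if k.2 = 1 ∧ i.2 = 0 then 1 else if k.2 = 0 ∧ i.2 = 1 then -1 else 0) else 0

/-- The tensor is `J`-invariant: `T = T(J·, J·)`. -/
def JInvariant (T : Tensor2) : Prop := ∀ c x, Jmatᵀ * T c x * Jmat = T c x

/-- The associated 2-form `ω = g(J·, ·)`. -/
def kahlerForm (g : Tensor2) : Tensor2 := fun c x => Jmatᵀ * g c x

/-- Kähler metrics on the complex surface `CP₁ × CP₁`. -/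
structure IsKahler (g : Tensor2) : Prop where
  metric : IsMetric g
  hermitian : JInvariant g
  closed : IsClosedForm (kahlerForm g)

/-- The point of a chart at which the affine coordinate of the factor `p` is `z`, and the other
affine coordinate is `0`. -/
def slice (p : Fin 2) (z : ℂ) : V := fun k =>
  if k.1 = p then (if k.2 = 0 then z.re else z.im) else 0

/-- The integral of a closed 2-form over the homology class of the factor `p`: over the curve
`CP₁` on which the other coordinate is `0` (the chart omits only one point of it). For a Kähler
form it is the area of this factor. -/
def period (F : Tensor2) (p : Fin 2) : ℝ := ∫ z : ℂ, F 0 (slice p z) (p, 0) (p, 1)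

/-- The component `T(∂/∂z̄_p, ∂/∂z̄_q)` of the complex-bilinear extension of a real tensor, where
`∂/∂z̄_p = (∂_{Re z_p} + i ∂_{Im z_p}) / 2`. -/
def barBar (T : Matrix Ix Ix ℝ) (p q : Fin 2) : ℂ :=
  (1 / 4) * ((T (p, 0) (q, 0) : ℂ) - (T (p, 1) (q, 1) : ℂ) +
    Complex.I * ((T (p, 0) (q, 1) : ℂ) + (T (p, 1) (q, 0) : ℂ)))

/-- A smooth real function is a holomorphy potential: `∇_μ̄ ∇_ν̄ f = 0`. -/
def IsHolomorphyPotential (g : Tensor2) (f : M → ℝ) : Prop :=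
  SmoothFun f ∧ ∀ c x p q, barBar (hess (g c) (f ∘ par c) x) p q = 0

/-- The conformally related metric `f⁻² g`. -/
def conformal (f : M → ℝ) (g : Tensor2) : Tensor2 := fun c x => ((f (par c x)) ^ 2)⁻¹ • g c x

/-- The Kähler metric `g` and the positive real holomorphy potential `f` engender a solution of
the Einstein-Maxwell equations: `h = f⁻² g` has constant scalar curvature, and there is exactly
one 2-form `F` with `F⁺ = ω` such that `(h, F)` is a solution; moreover `h` and this `F` are
`J`-invariant (the solution is strongly Hermitian). -/
structure Engenders (g : Tensor2) (f : M → ℝ) : Prop where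
  kahler : IsKahler g
  potential : IsHolomorphyPotential g f
  pos : ∀ m, 0 < f m
  constScal : ConstantScalar (conformal f g)
  solution : ∃ F : Tensor2,
    IsEinsteinMaxwell (conformal f g) F ∧
    selfDualPart (conformal f g) F = kahlerForm g ∧
    JInvariant (conformal f g) ∧ JInvariant F ∧
    ∀ F' : Tensor2, IsEinsteinMaxwell (conformal f g) F' →
      selfDualPart (conformal f g) F' = kahlerForm g → F' = F

/-! ## The two families of metrics -/

/-- The round metric of radius `R`, in either affine coordinate `z` of the factor `p`, is
`4 R² |dz|² / (1 + |z|²)²`; this is its pull-back to the product. -/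
def roundFactor (p : Fin 2) (R : ℝ) : Tensor2 := fun _ x =>
  Matrix.diagonal fun k => if k.1 = p then 4 * R ^ 2 / (1 + ‖zc p x‖ ^ 2) ^ 2 else 0

/-- The Riemannian product of round spheres of radii `R 0` and `R 1`. -/
def roundProduct (R : Fin 2 → ℝ) : Tensor2 := roundFactor 0 (R 0) + roundFactor 1 (R 1)

/-- The quartic momentum profile. -/
def Psi (a b t : ℝ) : ℝ :=
  (t - a) * (t - b) / (a - b) * (2 - (t - a) * (t - b) / (a * b))

/-- The 1-form `dθ`, up to sign, where `θ = arg z` is the angle in the factor `p` (the two affine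
coordinates of a factor give opposite angles). -/
def dTheta (p : Fin 2) (x : V) : Ix → ℝ := fun k =>
  if k.1 = p then (if k.2 = 0 then -(zc p x).im else (zc p x).re) / ‖zc p x‖ ^ 2 else 0

/-- `g` is the Riemannian product of the metric `dt² / Ψ(t) + Ψ(t) dθ²` on the factor `p`, where
`t` increases from `a` at the pole `z = 0` to `b` at the pole `z = ∞`, and `Ψ` is the quartic
profile, with the round metric of radius `R` on the factor `q`. -/
structure IsMomentumProduct (p q : Fin 2) (a b R : ℝ) (g : Tensor2) (t : M → ℝ) : Prop where
  fromFactor : ∀ m m' : M, m p = m' p → t m = t m'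
  southPole : ∀ m : M, m p = affine 0 0 → t m = a
  northPole : ∀ m : M, m p = affine 1 0 → t m = b
  range : ∀ m : M, m p ≠ affine 0 0 → m p ≠ affine 1 0 → t m ∈ Set.Ioo a b
  formula : ∀ c x, zc p x ≠ 0 → ∀ k l,
    g c x k l =
      pd k (t ∘ par c) x * pd l (t ∘ par c) x / Psi a b (t (par c x)) +
        Psi a b (t (par c x)) * dTheta p x k * dTheta p x l + roundFactor q R c x k l

/-! ## Comparing metrics -/

/-- The group `Aut₀(CP₁ × CP₁) = PSL(2, ℂ) × PSL(2, ℂ)`. -/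
abbrev Aut0 : Type := Fin 2 → Matrix.ProjectiveSpecialLinearGroup (Fin 2) ℂ

/-- The action of `Aut₀` on `M`, factor by factor. -/
def Aut0.act (A : Aut0) (m : M) : M := fun p => A p • m p

/-- Two metrics lie in the same orbit of `Aut₀`. -/
def SameOrbit (g g' : Tensor2) : Prop := ∃ A : Aut0, IsPullback A.act g' g

/-- Two metrics are homothetic: some diffeomorphism of `M` carries one to a positive constant
multiple of the other (isometric, if the constant is `1`). -/
def Homothetic (h h' : Tensor2) : Prop :=
  ∃ Φ : M ≃ M, SmoothMap Φ ∧ SmoothMap Φ.symm ∧ ∃ k : ℝ, 0 < k ∧ IsPullback Φ h' (k • h)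

end EinsteinMaxwell

end

open EinsteinMaxwell

/-!
A Kähler class on `CP₁ × CP₁` is determined by the areas of the two factors, so the theorem splits
into curvature computations for two explicit families of metrics and a proof that equal areas mean
equal cohomology classes.

*The metrics.* Both are of the form `∑ e_r(|z_r|²) |dz_r|²` with densities satisfying
`e(1/s) = s² e(s)`, so that one formula serves in all four charts (`IsDensity`, `radial`). For the
second one the momentum profile is turned into a density by separation of variables:
`s T'(s) = Ψ(T(s)) / 2` has a solution `T` which is smooth on the line and increases from
`T(0) = a` to `b` at infinity (`exists_isProfile`), and `t = T(|z|²)`. The symmetry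
`Ψ(a + b - t) = Ψ(t)` gives `T(1/s) = a + b - T(s)`, which makes `t` and the metric smooth at the
other pole.

*The equations.* For a metric which is a multiple of a flat metric on each factor the curvature
can be computed in closed form. If the Ricci endomorphism of `h = f⁻² g` has eigenvalues on the two
factors with a constant sum and with difference `4 μ f⁴`, then `F = (1 + μ) ω_p + (1 - μ) ω_q`
solves the equations, where `ω_p`, `ω_q` are the area forms of the factors for `g`; it is the only
solution with `F⁺ = ω`, since the trace-free equation determines the anti-self-dual part pointwise
(`engenders_radial`). The given value of `R²` makes both conditions hold for the quartic profile.

*The metrics are different.* The traces of the powers of the Ricci endomorphism are constant for a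
product of round spheres, and constancy is preserved by homotheties (`trace_ricciEnd_pow_const`).
The first trace is not constant for `g₂`, and the second is not constant for `h₂`
(`not_sameOrbit_momentum`, `not_homothetic_momentum`). Nor is `h₂` locally symmetric, since then the
eigenvalues would be constant (`not_locallySymmetric_momentum`).

*The cohomology classes.* Let `D` be the difference of two closed `J`-invariant 2-forms with equal
periods. Averaging over the rotations of both factors does not change the class of `D`, by the
Cartan formula (`cohomologous_average`), nor its periods (`period_average`). Once `D` is invariant,
each rotation has a moment map `h_p`, normalized to vanish at `z_p = 0`; it is
`∫₀^|z| r D(r) dr` on the curve `z_q = 0`, so it tends to a multiple of the period at the opposite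
pole (`tendsto_moment`). If the periods are zero, the two normalizations agree and `∑ h_p dθ_p` is a
global smooth 1-form (`isOneForm_primitive`), with exterior derivative `D`
(`eq_exterior_derivative`).

The radii and the interval `[a, b]` are then found from the areas: `4πR²` for a round sphere,
`2π(b - a)` for the factor with the quartic profile (`exists_interval`).
-/

noncomputable section

namespace EinsteinMaxwell

open scoped ContDiff Topology LinearAlgebra.Projectivization Matrix

/-! ### Partial derivatives -/

section
variable {u v : V → ℝ} {x : V} {i j : Ix}

lemma pd_congr (h : u =ᶠ[𝓝 x] v) : pd i u x = pd i v x := by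
  simp only [pd, h.fderiv_eq]

@[simp] lemma pd_const (c : ℝ) : pd i (fun _ => c) x = 0 := by simp [pd]

@[simp] lemma pd_coord : pd i (fun y => y j) x = if j = i then 1 else 0 := by
  have h : HasFDerivAt (fun y : V => y j) (ContinuousLinearMap.proj (R := ℝ) j) x :=
    (ContinuousLinearMap.proj (R := ℝ) (φ := fun _ : Ix => ℝ) j).hasFDerivAt
  simp only [pd, h.fderiv]
  simp [Pi.single_apply]

lemma pd_add (hu : DifferentiableAt ℝ u x) (hv : DifferentiableAt ℝ v x) :
    pd i (fun y => u y + v y) x = pd i u x + pd i v x := by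
  simp only [pd, fderiv_fun_add hu hv]; rfl

lemma pd_sub (hu : DifferentiableAt ℝ u x) (hv : DifferentiableAt ℝ v x) :
    pd i (fun y => u y - v y) x = pd i u x - pd i v x := by
  simp only [pd, fderiv_fun_sub hu hv]; rfl

lemma pd_neg : pd i (fun y => -u y) x = -pd i u x := by
  simp only [pd, fderiv_fun_neg]; rfl

lemma pd_mul (hu : DifferentiableAt ℝ u x) (hv : DifferentiableAt ℝ v x) :
    pd i (fun y => u y * v y) x = pd i u x * v x + u x * pd i v x := by
  simp only [pd, fderiv_fun_mul hu hv]
  simp [mul_comm, add_comm]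

lemma pd_const_mul (c : ℝ) (hu : DifferentiableAt ℝ u x) :
    pd i (fun y => c * u y) x = c * pd i u x := by
  rw [pd_mul (by fun_prop) hu]; simp

lemma pd_sum {ι : Type*} {s : Finset ι} {f : ι → V → ℝ}
    (h : ∀ a ∈ s, DifferentiableAt ℝ (f a) x) :
    pd i (fun y => ∑ a ∈ s, f a y) x = ∑ a ∈ s, pd i (f a) x := by
  simp only [pd, fderiv_fun_sum h, sum_apply]

lemma pd_comp {h : ℝ → ℝ} (hh : DifferentiableAt ℝ h (u x)) (hu : DifferentiableAt ℝ u x) :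
    pd i (fun y => h (u y)) x = deriv h (u x) * pd i u x := by
  have := (hh.hasDerivAt.comp_hasFDerivAt x hu.hasFDerivAt).fderiv
  have e : (fun y => h (u y)) = h ∘ u := rfl
  simp only [pd, e, this]; simp

/-- The directional derivative in terms of partial derivatives. -/
lemma fderiv_apply_eq_sum (w : V) : fderiv ℝ u x w = ∑ k, w k * pd k u x := by
  conv_lhs => rw [pi_eq_sum_univ' w]
  simp [map_sum, pd]

/-- The chain rule in coordinates. -/
lemma pd_comp_map {φ : V → V} (hu : DifferentiableAt ℝ u (φ x)) (hφ : DifferentiableAt ℝ φ x) :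
    pd i (fun y => u (φ y)) x = ∑ k, pd i (fun y => φ y k) x * pd k u (φ x) := by
  have e : (fun y => u (φ y)) = u ∘ φ := rfl
  have h1 : pd i (fun y => u (φ y)) x = fderiv ℝ u (φ x) (fderiv ℝ φ x (Pi.single i 1)) := by
    simp only [pd, e, fderiv_comp x hu hφ]; rfl
  rw [h1, fderiv_apply_eq_sum]
  refine Finset.sum_congr rfl fun k _ => ?_
  congr 1
  have hk := hasFDerivAt_pi'.1 hφ.hasFDerivAt k
  simp only [pd, hk.fderiv]; rfl

lemma contDiffAt_pd (hu : ContDiffAt ℝ ∞ u x) : ContDiffAt ℝ ∞ (pd i u) x := by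
  have : ContDiffAt ℝ ∞ (fderiv ℝ u) x := hu.fderiv_right (by simp)
  exact this.clm_apply contDiffAt_const

lemma contDiff_pd (hu : ContDiff ℝ ∞ u) : ContDiff ℝ ∞ (pd i u) :=
  contDiff_iff_contDiffAt.2 fun _ => contDiffAt_pd hu.contDiffAt

lemma _root_.ContDiffAt.diffAt {E F : Type*} [NormedAddCommGroup E] [NormedSpace ℝ E]
    [NormedAddCommGroup F] [NormedSpace ℝ F] {f : E → F} {x : E} (hf : ContDiffAt ℝ ∞ f x) :
    DifferentiableAt ℝ f x :=
  hf.differentiableAt (by simp)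

lemma _root_.ContDiff.diffAt {E F : Type*} [NormedAddCommGroup E] [NormedSpace ℝ E]
    [NormedAddCommGroup F] [NormedSpace ℝ F] {f : E → F} {x : E} (hf : ContDiff ℝ ∞ f) :
    DifferentiableAt ℝ f x :=
  hf.contDiffAt.diffAt

/-- Partial derivatives commute. -/
lemma pd_comm (hu : ContDiffAt ℝ ∞ u x) : pd i (pd j u) x = pd j (pd i u) x := by
  have hs : IsSymmSndFDerivAt ℝ u x := hu.isSymmSndFDerivAt (by
    rw [minSmoothness_of_isRCLikeNormedField]; exact WithTop.coe_le_coe.2 (le_top : (2 : ℕ∞) ≤ ⊤))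
  have hd : DifferentiableAt ℝ (fderiv ℝ u) x :=
    (hu.fderiv_right (m := ∞) (by simp)).differentiableAt (by simp)
  have key : ∀ a b : Ix, pd a (pd b u) x
      = fderiv ℝ (fderiv ℝ u) x (Pi.single a 1) (Pi.single b 1) := by
    intro a b
    have e : pd b u = fun y => fderiv ℝ u y (Pi.single b 1) := rfl
    simp only [pd.eq_def a, e]
    rw [fderiv_clm_apply hd (by fun_prop)]
    simp
  rw [key, key, hs.eq]

/-- A function all of whose partial derivatives vanish is constant. -/
lemma eq_of_pd_eq_zero (hu : Differentiable ℝ u) (h : ∀ i x, pd i u x = 0) (x y : V) :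
    u x = u y := by
  refine is_const_of_fderiv_eq_zero hu (fun z => ?_) x y
  ext w
  simp [fderiv_apply_eq_sum, h]

/-! ### Integrals depending on a parameter -/

section parametric
variable {E : Type} [NormedAddCommGroup E] [NormedSpace ℝ E] [FiniteDimensional ℝ E]
  {G : Type} [NormedAddCommGroup G] [NormedSpace ℝ G]

lemma hasFDerivAt_intervalIntegral {f : E → ℝ → G} (hf : ContDiff ℝ 1 (Function.uncurry f))
    (a b : ℝ) (x : E) :
    HasFDerivAt (fun x => ∫ s in a..b, f x s) (∫ s in a..b, fderiv ℝ (fun y => f y s) x) x := by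
  have hfx : ∀ s y, HasFDerivAt (fun y => f y s) (fderiv ℝ (fun y => f y s) y) y := by
    intro s y
    have : ContDiff ℝ 1 (fun y => f y s) := hf.comp (contDiff_id.prodMk contDiff_const)
    exact (this.differentiable (by simp) y).hasFDerivAt
  have hcont : Continuous (fun z : E × ℝ => fderiv ℝ (fun y => f y z.2) z.1) := by
    have h2 : ContDiff ℝ 0 (fun z : E × ℝ => fderiv ℝ (fun y => f y z.2) z.1) := by
      refine ContDiff.fderiv (n := 0) (m := 1) (f := fun (z : E × ℝ) y => f y z.2)
        (g := fun z => z.1)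
        (hf.comp (contDiff_snd.prodMk (contDiff_snd.comp contDiff_fst))) contDiff_fst (by norm_num)
    exact h2.continuous
  obtain ⟨C, hC⟩ := ((isCompact_closedBall x 1).prod
    (isCompact_uIcc (a := a) (b := b))).exists_bound_of_continuousOn hcont.continuousOn
  have hfc : ∀ y, Continuous (f y) := fun y =>
    hf.continuous.comp (Continuous.prodMk_right y)
  refine (intervalIntegral.hasFDerivAt_integral_of_dominated_of_fderiv_le (𝕜 := ℝ)
    (F := fun x s => f x s) (F' := fun y s => fderiv ℝ (fun y => f y s) y)
    (bound := fun _ => C)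
    (Metric.closedBall_mem_nhds x one_pos) ?_ ?_ ?_ ?_ ?_ ?_)
  · exact Filter.Eventually.of_forall fun y => (hfc y).aestronglyMeasurable
  · exact (hfc x).intervalIntegrable _ _
  · exact (hcont.comp (Continuous.prodMk_right x)).aestronglyMeasurable
  · refine MeasureTheory.ae_of_all _ fun s hs y hy => hC (y, s) ⟨hy, Set.uIoc_subset_uIcc hs⟩
  · exact intervalIntegrable_const
  · exact MeasureTheory.ae_of_all _ fun s _ y _ => hfx s y

lemma contDiff_intervalIntegral_nat (n : ℕ) : ∀ {G : Type} [NormedAddCommGroup G]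
    [NormedSpace ℝ G] {f : E → ℝ → G}, ContDiff ℝ ∞ (Function.uncurry f) → ∀ a b : ℝ,
    ContDiff ℝ n (fun x => ∫ s in a..b, f x s) := by
  induction n with
  | zero =>
    intro G _ _ f hf a b
    refine contDiff_zero.2 ?_
    exact continuous_iff_continuousAt.2 fun x =>
      (hasFDerivAt_intervalIntegral (hf.of_le (by simp)) a b x).continuousAt
  | succ n ih =>
    intro G _ _ f hf a b
    have h1 := hasFDerivAt_intervalIntegral (hf.of_le (by simp)) a b
    rw [show ((n + 1 : ℕ) : WithTop ℕ∞) = (n : WithTop ℕ∞) + 1 by simp, contDiff_succ_iff_hasFDerivAt]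
    refine ⟨_, ?_, h1⟩
    apply ih
    have h2 : ContDiff ℝ ∞ (fun z : E × ℝ => fderiv ℝ (fun y => f y z.2) z.1) := by
      refine ContDiff.fderiv (m := ∞) (n := ∞) (f := fun (z : E × ℝ) y => f y z.2)
        (g := fun z => z.1)
        (hf.comp (contDiff_snd.prodMk (contDiff_snd.comp contDiff_fst))) contDiff_fst (by norm_num)
    exact h2

/-- The integral over an interval of a smooth function depending smoothly on a parameter is
smooth in the parameter. -/
lemma contDiff_intervalIntegral {f : E → ℝ → G} (hf : ContDiff ℝ ∞ (Function.uncurry f))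
    (a b : ℝ) : ContDiff ℝ ∞ (fun x => ∫ s in a..b, f x s) :=
  contDiff_infty.2 fun n => contDiff_intervalIntegral_nat n hf a b

end parametric

/-- Differentiation under the integral sign. -/
lemma pd_intervalIntegral {f : V → ℝ → ℝ} (hf : ContDiff ℝ ∞ (Function.uncurry f)) (a b : ℝ) :
    pd i (fun y => ∫ s in a..b, f y s) x = ∫ s in a..b, pd i (fun y => f y s) x := by
  have h := hasFDerivAt_intervalIntegral (hf.of_le (by simp)) a b x
  simp only [pd, h.fderiv]
  have hcont : Continuous (fun s : ℝ => fderiv ℝ (fun y => f y s) x) := by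
    have h2 : ContDiff ℝ ∞ (fun s : ℝ => fderiv ℝ (fun y => f y s) x) := by
      refine ContDiff.fderiv (m := ∞) (n := ∞) (f := fun s y => f y s) (g := fun z => x)
        (hf.comp (contDiff_snd.prodMk contDiff_fst)) contDiff_const (by simp)
    exact h2.continuous
  rw [ContinuousLinearMap.intervalIntegral_apply (hcont.intervalIntegrable _ _)]

end

/-! ### Affine charts and their transition maps -/

lemma sum_Ix {α : Type*} [AddCommMonoid α] {p q : Fin 2} (hpq : p ≠ q) (f : Ix → α) :
    ∑ k, f k = f (p, 0) + f (p, 1) + (f (q, 0) + f (q, 1)) := by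
  fin_cases p <;> fin_cases q <;> simp at hpq <;>
    simp [Fintype.sum_prod_type, Fin.sum_univ_two, add_comm]

lemma eq_or_eq_of_ne {p q : Fin 2} (hpq : p ≠ q) (r : Fin 2) : r = p ∨ r = q := by omega

lemma affine_eq_affine_iff {i j : Fin 2} {z w : ℂ} :
    affine i z = affine j w ↔ (i = j ∧ z = w) ∨ (i ≠ j ∧ z * w = 1) := by
  unfold affine
  rw [Projectivization.mk_eq_mk_iff']
  constructor
  · rintro ⟨a, ha⟩
    have h0 := congrFun ha 0
    have h1 := congrFun ha 1
    fin_cases i <;> fin_cases j <;> simp [Function.update] at h0 h1 ⊢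
    · rw [h0, one_mul] at h1; exact h1.symm
    · rw [← h1]; simpa [← h1] using h0
    · rw [← h0]; simpa [← h0] using h1
    · rw [h1, one_mul] at h0; exact h0.symm
  · rintro (⟨rfl, rfl⟩ | ⟨h, hz⟩)
    · exact ⟨1, by simp⟩
    · refine ⟨z, ?_⟩
      funext k
      fin_cases i <;> fin_cases j <;> fin_cases k <;> simp_all [Function.update]

lemma affineCoord_affine (i j : Fin 2) (z : ℂ) :
    affineCoord i (affine j z) = if j = i then z else z⁻¹ := by
  unfold affineCoord affine
  rw [Projectivization.lift_mk]
  fin_cases i <;> fin_cases j <;> simp [Function.update]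

lemma exists_affine_zero (m : CP1) : (∃ z, m = affine 0 z) ∨ m = affine 1 0 := by
  induction m using Projectivization.ind with
  | h v hv =>
    by_cases h : v 0 = 0
    · right
      have h1 : v 1 ≠ 0 := fun h1 => hv (by funext k; fin_cases k <;> simpa)
      unfold affine
      rw [Projectivization.mk_eq_mk_iff']
      exact ⟨v 1, by funext k; fin_cases k <;> simp [Function.update, h]⟩
    · left
      refine ⟨v 1 / v 0, ?_⟩
      unfold affine
      rw [Projectivization.mk_eq_mk_iff']
      refine ⟨v 0, ?_⟩
      funext k; fin_cases k <;> simp [Function.update]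
      field_simp

/-- The real components of a complex number. -/
def cpt (a : Fin 2) (w : ℂ) : ℝ := if a = 0 then w.re else w.im

@[simp] lemma cpt_zero (w : ℂ) : cpt 0 w = w.re := rfl
@[simp] lemma cpt_one (w : ℂ) : cpt 1 w = w.im := rfl

lemma cpt_zc (p a : Fin 2) (x : V) : cpt a (zc p x) = x (p, a) := by
  fin_cases a <;> rfl

@[simp] lemma zc_re (p : Fin 2) (x : V) : (zc p x).re = x (p, 0) := rfl
@[simp] lemma zc_im (p : Fin 2) (x : V) : (zc p x).im = x (p, 1) := rfl

/-- The point of a chart with given complex affine coordinates. -/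
def ofZ (z : Fin 2 → ℂ) : V := fun k => cpt k.2 (z k.1)

@[simp] lemma zc_ofZ (z : Fin 2 → ℂ) (p : Fin 2) : zc p (ofZ z) = z p := rfl

lemma ofZ_zc (x : V) : ofZ (fun p => zc p x) = x := by
  funext ⟨p, a⟩; exact cpt_zc p a x

lemma ext_zc {x y : V} (h : ∀ p, zc p x = zc p y) : x = y := by
  rw [← ofZ_zc x, ← ofZ_zc y]; simp only [h]

lemma exists_par (m : M) : ∃ c x, m = par c x := by
  have h : ∀ p, ∃ i z, m p = affine i z := fun p => by
    rcases exists_affine_zero (m p) with ⟨z, h⟩ | h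
    exacts [⟨0, z, h⟩, ⟨1, 0, h⟩]
  choose c z h using h
  exact ⟨c, ofZ z, funext h⟩

lemma par_eq_par_iff {c c' : Chart} {x x' : V} :
    par c x = par c' x' ↔ ∀ p, (c p = c' p ∧ zc p x = zc p x') ∨
      (c p ≠ c' p ∧ zc p x * zc p x' = 1) := by
  simp only [funext_iff, par, affine_eq_affine_iff]

lemma coord_par (c c' : Chart) (x : V) :
    coord c' (par c x) = ofZ fun p => if c p = c' p then zc p x else (zc p x)⁻¹ := by
  funext ⟨p, a⟩
  simp only [coord, par, affineCoord_affine, ofZ, cpt]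

@[simp] lemma coord_par_self (c : Chart) (x : V) : coord c (par c x) = x := by
  rw [coord_par]; simp [ofZ_zc]

lemma coord_par_of_eq {c c' : Chart} {x x' : V} (h : par c x = par c' x') :
    coord c' (par c x) = x' := by rw [h, coord_par_self]

lemma zc_of_par_eq {c c' : Chart} {x x' : V} (h : par c x = par c' x') (p : Fin 2) :
    zc p x' = if c p = c' p then zc p x else (zc p x)⁻¹ := by
  rw [← coord_par_of_eq h, coord_par, zc_ofZ]

lemma zc_ne_zero_of_par_eq {c c' : Chart} {x x' : V} (h : par c x = par c' x') {p : Fin 2}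
    (hp : c p ≠ c' p) : zc p x ≠ 0 := by
  rcases par_eq_par_iff.1 h p with h | h
  · exact absurd h.1 hp
  · exact left_ne_zero_of_mul (h.2.trans_ne one_ne_zero)

lemma par_eq_ofZ {c c' : Chart} {x : V} (h : ∀ p, c p ≠ c' p → zc p x ≠ 0) :
    par c x = par c' (ofZ fun p => if c p = c' p then zc p x else (zc p x)⁻¹) := by
  rw [par_eq_par_iff]
  intro p
  by_cases hp : c p = c' p
  · left; simp [hp]
  · right; simp [hp, mul_inv_cancel₀ (h p hp)]

/-- The complex coordinate of a factor as a real-linear map. -/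
def zcL (p : Fin 2) : V →L[ℝ] ℂ :=
  Complex.ofRealCLM.comp (ContinuousLinearMap.proj (p, 0)) +
    (Complex.I) • Complex.ofRealCLM.comp (ContinuousLinearMap.proj (p, 1))

lemma zcL_apply (p : Fin 2) (x : V) : zcL p x = zc p x := by
  apply Complex.ext <;> simp [zcL]

lemma contDiff_zc (p : Fin 2) : ContDiff ℝ ∞ (zc p) := by
  have : zc p = zcL p := funext fun x => (zcL_apply p x).symm
  rw [this]; exact (zcL p).contDiff

/-- The matrix of the multiplication by a complex number. -/
def mulMat (d : ℂ) (a b : Fin 2) : ℝ :=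
  if a = 0 then (if b = 0 then d.re else -d.im) else (if b = 0 then d.im else d.re)

/-- The partial derivatives of a holomorphic function of one complex coordinate. -/
lemma pd_holomorphic {h : ℂ → ℂ} {d : ℂ} {p : Fin 2} {x : V} (hh : HasDerivAt h d (zc p x))
    (a : Fin 2) (k : Ix) :
    pd k (fun y => cpt a (h (zc p y))) x = if p = k.1 then mulMat d a k.2 else 0 := by
  have h1 : HasFDerivAt (fun y => h (zc p y))
      (((ContinuousLinearMap.toSpanSingleton ℂ d : ℂ →L[ℂ] ℂ).restrictScalars ℝ).comp (zcL p)) x := by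
    have h2 : HasFDerivAt (zc p) (zcL p) x := by
      have : zc p = zcL p := funext fun x => (zcL_apply p x).symm
      rw [this]; exact (zcL p).hasFDerivAt
    exact (hh.hasFDerivAt.restrictScalars ℝ).comp x h2
  have hre : HasFDerivAt (fun y => (h (zc p y)).re) _ x := (Complex.reCLM.hasFDerivAt).comp x h1
  have him : HasFDerivAt (fun y => (h (zc p y)).im) _ x := (Complex.imCLM.hasFDerivAt).comp x h1
  obtain ⟨q, b⟩ := k
  have hz : zc p (Pi.single (q, b) 1 : V) = if p = q then (if b = 0 then 1 else Complex.I) else 0 := by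
    apply Complex.ext <;> fin_cases p <;> fin_cases q <;> fin_cases b <;> simp [zc]
  fin_cases a
  · simp only [pd, Fin.zero_eta, cpt_zero, hre.fderiv]
    simp only [ContinuousLinearMap.comp_apply, zcL_apply, hz]
    by_cases hpq : p = q <;> fin_cases b <;> simp [hpq, mulMat]
  · simp only [pd, Fin.mk_one, cpt_one, him.fderiv]
    simp only [ContinuousLinearMap.comp_apply, zcL_apply, hz]
    by_cases hpq : p = q <;> fin_cases b <;> simp [hpq, mulMat]

/-- The block-diagonal matrix of a complex-linear map preserving the two factors. -/
def blk (d : Fin 2 → ℂ) : Matrix Ix Ix ℝ :=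
  Matrix.of fun k l => if k.1 = l.1 then mulMat (d k.1) k.2 l.2 else 0

lemma jac_holomorphic {φ : V → V} {h : Fin 2 → ℂ → ℂ} {d : Fin 2 → ℂ} {x : V}
    (hφ : φ =ᶠ[𝓝 x] fun y => ofZ fun p => h p (zc p y))
    (hh : ∀ p, HasDerivAt (h p) (d p) (zc p x)) : jac φ x = blk d := by
  ext ⟨p, a⟩ k
  have e : (fun y => φ y (p, a)) =ᶠ[𝓝 x] fun y => cpt a (h p (zc p y)) := by
    filter_upwards [hφ] with y hy
    rw [hy]; rfl
  simp only [jac, Matrix.of_apply, blk, pd_congr e, pd_holomorphic (hh p)]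

/-- The complex derivatives of the transition map from the chart `c` to the chart `c'`. -/
def dz (c c' : Chart) (x : V) (p : Fin 2) : ℂ := if c p = c' p then 1 else -((zc p x) ^ 2)⁻¹

lemma jac_transition {c c' : Chart} {x : V} (h : ∀ p, c p ≠ c' p → zc p x ≠ 0) :
    jac (coord c' ∘ par c) x = blk (dz c c' x) := by
  refine jac_holomorphic (h := fun p w => if c p = c' p then w else w⁻¹)
    (Filter.Eventually.of_forall fun y => coord_par c c' y) fun p => ?_
  by_cases hp : c p = c' p
  · simp only [hp, if_true, dz]; exact hasDerivAt_id _
  · simp only [hp, if_false, dz]; exact hasDerivAt_inv (h p hp)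

lemma jac_transition_of_eq {c c' : Chart} {x x' : V} (h : par c x = par c' x') :
    jac (coord c' ∘ par c) x = blk (dz c c' x) :=
  jac_transition fun _ hp => zc_ne_zero_of_par_eq h hp

/-- The transformation law of a 2-tensor field, in components. -/
lemma isPullback_id_iff {T S : Tensor2} : IsPullback id T S ↔
    ∀ c c' x x', par c x = par c' x' →
      S c x = (blk (dz c c' x))ᵀ * T c' x' * blk (dz c c' x) := by
  refine forall₄_congr fun c c' x x' => forall_congr' fun h => ?_
  have e : coord c' ∘ id ∘ par c = coord c' ∘ par c := rfl
  rw [e, jac_transition_of_eq h]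

lemma blk_mul_apply (d e : Fin 2 → ℂ) (A : Matrix Ix Ix ℝ) (p q a b : Fin 2) :
    ((blk d)ᵀ * A * blk e) (p, a) (q, b) =
      ∑ a', ∑ b', mulMat (d p) a' a * A (p, a') (q, b') * mulMat (e q) b' b := by
  simp only [Matrix.mul_apply, Matrix.transpose_apply, blk, Matrix.of_apply, Fintype.sum_prod_type,
    Finset.sum_mul]
  fin_cases p <;> fin_cases q <;> simp [Fin.sum_univ_two] <;> ring

lemma Jmat_eq_blk : Jmat = blk fun _ => Complex.I := by
  ext ⟨p, a⟩ ⟨q, b⟩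
  fin_cases a <;> fin_cases b <;> simp [Jmat, blk, mulMat]

lemma mulMat_mul (d e : ℂ) (a b : Fin 2) :
    ∑ k, mulMat d a k * mulMat e k b = mulMat (d * e) a b := by
  fin_cases a <;> fin_cases b <;> simp [mulMat, Fin.sum_univ_two] <;> ring

lemma blk_mul_blk (d e : Fin 2 → ℂ) : blk d * blk e = blk fun p => d p * e p := by
  ext ⟨p, a⟩ ⟨q, b⟩
  simp only [Matrix.mul_apply, blk, Matrix.of_apply, Fintype.sum_prod_type]
  fin_cases p <;> fin_cases q <;> simp [← mulMat_mul, Fin.sum_univ_two]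

lemma blk_comm (d e : Fin 2 → ℂ) : blk d * blk e = blk e * blk d := by
  rw [blk_mul_blk, blk_mul_blk]; simp only [mul_comm]

/-- The block-scalar matrix with the entries `u 0` and `u 1`. -/
def bdiag (u : Fin 2 → ℝ) : Matrix Ix Ix ℝ := Matrix.diagonal fun k => u k.1

/-- The block-scalar combination `u 0 • J + u 1 • J` of the area forms of the factors, with the
sign for which `kahlerForm` of the metric `bdiag u` is `bform u`. -/
def bform (u : Fin 2 → ℝ) : Matrix Ix Ix ℝ := Jmatᵀ * bdiag u

lemma bdiag_pullback (d : Fin 2 → ℂ) (u : Fin 2 → ℝ) :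
    (blk d)ᵀ * bdiag u * blk d = bdiag fun p => ‖d p‖ ^ 2 * u p := by
  ext ⟨p, a⟩ ⟨q, b⟩
  simp only [blk_mul_apply, bdiag, Fin.sum_univ_two, ← Complex.normSq_eq_norm_sq,
    Complex.normSq_apply]
  by_cases h : p = q
  · subst h
    fin_cases a <;> fin_cases b <;> simp [mulMat] <;> ring
  · simp [h]

lemma blk_transpose_Jmat (d : Fin 2 → ℂ) (A : Matrix Ix Ix ℝ) :
    (blk d)ᵀ * (Jmatᵀ * A) * blk d = Jmatᵀ * ((blk d)ᵀ * A * blk d) := by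
  have : (blk d)ᵀ * Jmatᵀ = Jmatᵀ * (blk d)ᵀ := by
    rw [← Matrix.transpose_mul, ← Matrix.transpose_mul, Jmat_eq_blk, blk_comm]
  simp only [← Matrix.mul_assoc, this]

lemma bform_pullback (d : Fin 2 → ℂ) (u : Fin 2 → ℝ) :
    (blk d)ᵀ * bform u * blk d = bform fun p => ‖d p‖ ^ 2 * u p := by
  rw [bform, blk_transpose_Jmat, bdiag_pullback, bform]

lemma bform_apply (u : Fin 2 → ℝ) (p q a b : Fin 2) : bform u (p, a) (q, b) =
    if p = q then (if a = 0 ∧ b = 1 then u p else if a = 1 ∧ b = 0 then -u p else 0) else 0 := by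
  simp only [bform, bdiag, Matrix.mul_diagonal, Matrix.transpose_apply, Jmat, Matrix.of_apply]
  by_cases h : p = q
  · subst h
    fin_cases a <;> fin_cases b <;> simp
  · simp [h, Ne.symm h]

lemma norm_dz_sq {c c' : Chart} {x : V} (p : Fin 2) :
    ‖dz c c' x p‖ ^ 2 = if c p = c' p then 1 else (‖zc p x‖ ^ 4)⁻¹ := by
  unfold dz
  split_ifs
  · simp
  · simp [← inv_pow, ← pow_mul]

/-! ### Naturality of the Ricci tensor under local diffeomorphisms -/

/-- The entries of a matrix-valued function are smooth at a point. -/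
def SmoothMatAt (A : V → Matrix Ix Ix ℝ) (x : V) : Prop :=
  ∀ k l, ContDiffAt ℝ ∞ (fun y => A y k l) x

/-- The entrywise partial derivative of a matrix-valued function. -/
def pdm (i : Ix) (A : V → Matrix Ix Ix ℝ) (x : V) : Matrix Ix Ix ℝ :=
  Matrix.of fun k l => pd i (fun y => A y k l) x

section
variable {A B : V → Matrix Ix Ix ℝ} {x : V}

lemma SmoothMatAt.mul (hA : SmoothMatAt A x) (hB : SmoothMatAt B x) :
    SmoothMatAt (fun y => A y * B y) x := fun k l => by
  simp only [Matrix.mul_apply]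
  exact ContDiffAt.sum fun m _ => (hA k m).mul (hB m l)

lemma SmoothMatAt.transpose (hA : SmoothMatAt A x) : SmoothMatAt (fun y => (A y)ᵀ) x :=
  fun k l => hA l k

lemma SmoothMatAt.pdm (hA : SmoothMatAt A x) (i : Ix) : SmoothMatAt (pdm i A) x :=
  fun k l => contDiffAt_pd (hA k l)

lemma SmoothMatAt.det (hA : SmoothMatAt A x) : ContDiffAt ℝ ∞ (fun y => (A y).det) x := by
  simp only [Matrix.det_apply]
  refine ContDiffAt.sum fun σ _ => ContDiffAt.const_smul _ ?_
  exact contDiffAt_prod fun i _ => hA (σ i) i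

lemma SmoothMatAt.inv (hA : SmoothMatAt A x) (h0 : (A x).det ≠ 0) :
    SmoothMatAt (fun y => (A y)⁻¹) x := fun k l => by
  simp only [Matrix.inv_def, Matrix.smul_apply, smul_eq_mul, Ring.inverse_eq_inv']
  refine (hA.det.inv h0).mul ?_
  simp only [Matrix.adjugate_apply]
  refine SmoothMatAt.det (A := fun y => (A y).updateRow l (Pi.single k 1)) fun a b => ?_
  by_cases h : a = l
  · subst h; simpa [Matrix.updateRow_self] using contDiffAt_const
  · simpa [Matrix.updateRow_ne h] using hA a b

lemma pdm_congr (h : A =ᶠ[𝓝 x] B) (i : Ix) : pdm i A x = pdm i B x := by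
  ext k l
  exact pd_congr (h.mono fun y hy => by simp only [hy])

lemma pdm_mul (hA : SmoothMatAt A x) (hB : SmoothMatAt B x) (i : Ix) :
    pdm i (fun y => A y * B y) x = pdm i A x * B x + A x * pdm i B x := by
  ext k l
  simp only [pdm, Matrix.of_apply, Matrix.mul_apply, Matrix.add_apply]
  rw [pd_sum fun m _ => ((hA k m).diffAt.fun_mul (hB m l).diffAt), ← Finset.sum_add_distrib]
  exact Finset.sum_congr rfl fun m _ => pd_mul (hA k m).diffAt (hB m l).diffAt

lemma pdm_add (hA : SmoothMatAt A x) (hB : SmoothMatAt B x) (i : Ix) :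
    pdm i (fun y => A y + B y) x = pdm i A x + pdm i B x := by
  ext k l
  exact pd_add (hA k l).diffAt (hB k l).diffAt

lemma pdm_transpose (i : Ix) : pdm i (fun y => (A y)ᵀ) x = (pdm i A x)ᵀ := rfl

lemma pdm_comm (hA : SmoothMatAt A x) (i j : Ix) : pdm i (pdm j A) x = pdm j (pdm i A) x := by
  ext k l
  exact pd_comm (hA k l)

end

/-- The matrix of the Levi-Civita connection form in the direction `i`. -/
def conn (G : V → Matrix Ix Ix ℝ) (i : Ix) (x : V) : Matrix Ix Ix ℝ :=
  Matrix.of fun l k => christoffel G l i k x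

/-- The curvature of a connection given by its matrices `Γ i`. -/
def curv (Γ : Ix → V → Matrix Ix Ix ℝ) (i j : Ix) (x : V) : Matrix Ix Ix ℝ :=
  pdm i (Γ j) x - pdm j (Γ i) x + (Γ i x * Γ j x - Γ j x * Γ i x)

lemma riem_eq_curv (G : V → Matrix Ix Ix ℝ) (l k i j : Ix) (x : V) :
    riem G l k i j x = curv (conn G) i j x l k := by
  simp only [riem, curv, conn, pdm, Matrix.add_apply, Matrix.sub_apply, Matrix.mul_apply,
    Matrix.of_apply, Finset.sum_sub_distrib]

section
variable {G : V → Matrix Ix Ix ℝ} {x : V}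

lemma smoothMatAt_conn (hG : SmoothMatAt G x) (h0 : (G x).det ≠ 0) (i : Ix) :
    SmoothMatAt (conn G i) x := fun l k => by
  simp only [conn, Matrix.of_apply, christoffel]
  refine contDiffAt_const.mul (ContDiffAt.sum fun m _ => ?_)
  refine (hG.inv h0 l m).mul ?_
  exact ((contDiffAt_pd (hG k m)).add (contDiffAt_pd (hG i m))).sub (contDiffAt_pd (hG i k))

lemma metric_mul_conn (h0 : (G x).det ≠ 0) (i m k : Ix) : (G x * conn G i x) m k =
    (1 / 2) * (pdm i G x k m + pdm k G x i m - pdm m G x i k) := by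
  have e : conn G i x = (G x)⁻¹ * Matrix.of fun m k =>
      (1 / 2) * (pdm i G x k m + pdm k G x i m - pdm m G x i k) := by
    ext l k
    simp only [conn, christoffel, Matrix.of_apply, Matrix.mul_apply, Finset.mul_sum, pdm]
    exact Finset.sum_congr rfl fun m _ => by ring
  rw [e, Matrix.mul_nonsing_inv_cancel_left _ _ (isUnit_iff_ne_zero.2 h0), Matrix.of_apply]

lemma pdm_symm (hs : ∀ y, (G y)ᵀ = G y) (i k l : Ix) : pdm i G x k l = pdm i G x l k := by
  have : (fun y => G y k l) = fun y => G y l k := funext fun y => congrFun₂ (hs y) l k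
  simp only [pdm, Matrix.of_apply, this]

/-- The Levi-Civita connection preserves the metric. -/
lemma pdm_metric (hs : ∀ y, (G y)ᵀ = G y) (h0 : (G x).det ≠ 0) (i : Ix) :
    pdm i G x = (conn G i x)ᵀ * G x + G x * conn G i x := by
  have e : (conn G i x)ᵀ * G x = (G x * conn G i x)ᵀ := by rw [Matrix.transpose_mul, hs]
  ext k m
  rw [e, Matrix.add_apply, Matrix.transpose_apply, metric_mul_conn h0, metric_mul_conn h0,
    pdm_symm hs i m k, pdm_symm hs k i m, pdm_symm hs m i k]
  ring

lemma christoffel_symm (hs : ∀ y, (G y)ᵀ = G y) (l i k : Ix) :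
    christoffel G l i k x = christoffel G l k i x := by
  unfold christoffel
  congr 1
  refine Finset.sum_congr rfl fun m _ => ?_
  have : (fun y => G y i k) = fun y => G y k i := funext fun y => congrFun₂ (hs y) k i
  rw [this]; ring

/-- The Levi-Civita connection is the only torsion-free connection preserving the metric. -/
lemma eq_conn {Γ : Ix → Matrix Ix Ix ℝ} (h0 : (G x).det ≠ 0)
    (hs : ∀ y, (G y)ᵀ = G y) (ht : ∀ i l k, Γ i l k = Γ k l i)
    (hm : ∀ i, pdm i G x = (Γ i)ᵀ * G x + G x * Γ i) (i : Ix) : Γ i = conn G i x := by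
  have hL : ∀ i m k, (G x * Γ i) m k = (G x * Γ k) m i := fun i m k => by
    simp only [Matrix.mul_apply, ht i]
  have hm' : ∀ i m k, pdm i G x m k = (G x * Γ i) k m + (G x * Γ i) m k := fun i m k => by
    have e : (Γ i)ᵀ * G x = (G x * Γ i)ᵀ := by rw [Matrix.transpose_mul, hs]
    rw [hm, e]; rfl
  have e : G x * Γ i = G x * conn G i x := by
    ext m k
    rw [metric_mul_conn h0, hm', hm', hm', hL k m i, hL k i m, hL i k m]
    ring
  have hu := isUnit_iff_ne_zero.2 h0
  calc Γ i = (G x)⁻¹ * (G x * Γ i) := (Matrix.nonsing_inv_mul_cancel_left _ _ hu).symm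
    _ = conn G i x := by rw [e, Matrix.nonsing_inv_mul_cancel_left _ _ hu]

end

section
variable {φ : V → V} {x : V} {Γ : Ix → V → Matrix Ix Ix ℝ}

/-- The matrices of the pull-back of a connection by `φ`, in the pulled-back frame. -/
def pullConn (φ : V → V) (Γ : Ix → V → Matrix Ix Ix ℝ) (i : Ix) (y : V) : Matrix Ix Ix ℝ :=
  ∑ a, jac φ y a i • Γ a (φ y)

lemma contDiffAt_apply (hφ : ContDiffAt ℝ ∞ φ x) (k : Ix) : ContDiffAt ℝ ∞ (fun y => φ y k) x :=
  contDiffAt_pi.1 hφ k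

lemma smoothMatAt_jac (hφ : ContDiffAt ℝ ∞ φ x) : SmoothMatAt (jac φ) x :=
  fun k _ => contDiffAt_pd (contDiffAt_apply hφ k)

lemma pdm_jac_symm (hφ : ContDiffAt ℝ ∞ φ x) (i l k : Ix) :
    pdm i (jac φ) x l k = pdm k (jac φ) x l i := pd_comm (contDiffAt_apply hφ l)

lemma SmoothMatAt.comp {A : V → Matrix Ix Ix ℝ} (hA : SmoothMatAt A (φ x))
    (hφ : ContDiffAt ℝ ∞ φ x) : SmoothMatAt (fun y => A (φ y)) x :=
  fun k l => (hA k l).comp x hφ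

lemma pdm_comp {A : V → Matrix Ix Ix ℝ} (hA : SmoothMatAt A (φ x)) (hφ : ContDiffAt ℝ ∞ φ x)
    (i : Ix) : pdm i (fun y => A (φ y)) x = ∑ a, jac φ x a i • pdm a A (φ x) := by
  ext k l
  simp only [pdm, Matrix.of_apply, Matrix.sum_apply, Matrix.smul_apply, smul_eq_mul]
  rw [pd_comp_map (hA k l).diffAt hφ.diffAt]
  rfl

lemma smoothMatAt_pullConn (hφ : ContDiffAt ℝ ∞ φ x) (hΓ : ∀ a, SmoothMatAt (Γ a) (φ x)) (i : Ix) :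
    SmoothMatAt (pullConn φ Γ i) x := fun k l => by
  simp only [pullConn, Matrix.sum_apply, Matrix.smul_apply, smul_eq_mul]
  exact ContDiffAt.sum fun a _ => (smoothMatAt_jac hφ a i).mul ((hΓ a).comp hφ k l)

/-- The curvature of the pull-back is the pull-back of the curvature. -/
lemma curv_pullConn (hφ : ContDiffAt ℝ ∞ φ x) (hΓ : ∀ a, SmoothMatAt (Γ a) (φ x)) (i j : Ix) :
    curv (pullConn φ Γ) i j x =
      ∑ a, ∑ b, (jac φ x a i * jac φ x b j) • curv Γ a b (φ x) := by
  have hd : ∀ i j, pdm i (pullConn φ Γ j) x = (∑ a, pdm i (jac φ) x a j • Γ a (φ x)) +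
      ∑ b, ∑ a, (jac φ x a i * jac φ x b j) • pdm a (Γ b) (φ x) := by
    intro i j
    ext k l
    have e : (fun y => pullConn φ Γ j y k l) = fun y => ∑ a, jac φ y a j * Γ a (φ y) k l := by
      funext y
      simp only [pullConn, Matrix.sum_apply, Matrix.smul_apply, smul_eq_mul]
    simp only [Matrix.add_apply, Matrix.sum_apply, Matrix.smul_apply, smul_eq_mul]
    rw [pdm, Matrix.of_apply, e, pd_sum fun a _ =>
      ((smoothMatAt_jac hφ a j).diffAt.fun_mul ((hΓ a).comp hφ k l).diffAt), ← Finset.sum_add_distrib]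
    refine Finset.sum_congr rfl fun a _ => ?_
    rw [pd_mul (smoothMatAt_jac hφ a j).diffAt ((hΓ a).comp hφ k l).diffAt]
    congr 1
    have := congrFun₂ (pdm_comp (hΓ a) hφ i) k l
    simp only [Matrix.sum_apply, Matrix.smul_apply, smul_eq_mul] at this
    rw [show pd i (fun y => Γ a (φ y) k l) x = _ from this, Finset.mul_sum]
    exact Finset.sum_congr rfl fun b _ => by ring
  have hmul : ∀ i j, pullConn φ Γ i x * pullConn φ Γ j x =
      ∑ a, ∑ b, (jac φ x a i * jac φ x b j) • (Γ a (φ x) * Γ b (φ x)) := by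
    intro i j
    simp only [pullConn, Finset.sum_mul, Finset.mul_sum, smul_mul_assoc, mul_smul_comm,
      Finset.smul_sum, smul_smul]
    rw [Finset.sum_comm]
    exact Finset.sum_congr rfl fun a _ => Finset.sum_congr rfl fun b _ => by rw [mul_comm]
  rw [curv, hd, hd, hmul, hmul]
  have e1 : ∑ a, pdm i (jac φ) x a j • Γ a (φ x) = ∑ a, pdm j (jac φ) x a i • Γ a (φ x) :=
    Finset.sum_congr rfl fun a _ => by rw [pdm_jac_symm hφ]
  rw [e1]
  simp only [curv, smul_add, smul_sub, Finset.sum_add_distrib, Finset.sum_sub_distrib]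
  have e2 : ∑ b, ∑ a, (jac φ x a i * jac φ x b j) • pdm a (Γ b) (φ x) =
      ∑ a, ∑ b, (jac φ x a i * jac φ x b j) • pdm a (Γ b) (φ x) := Finset.sum_comm
  have e3 : ∑ b, ∑ a, (jac φ x a j * jac φ x b i) • pdm a (Γ b) (φ x) =
      ∑ a, ∑ b, (jac φ x a i * jac φ x b j) • pdm b (Γ a) (φ x) :=
    Finset.sum_congr rfl fun a _ => Finset.sum_congr rfl fun b _ => by rw [mul_comm]
  have e4 : ∑ a, ∑ b, (jac φ x a j * jac φ x b i) • (Γ a (φ x) * Γ b (φ x)) =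
      ∑ a, ∑ b, (jac φ x a i * jac φ x b j) • (Γ b (φ x) * Γ a (φ x)) := by
    rw [Finset.sum_comm]
    exact Finset.sum_congr rfl fun a _ => Finset.sum_congr rfl fun b _ => by rw [mul_comm]
  rw [e2, e3, e4]
  abel

/-- Gauge invariance of the curvature. -/
lemma curv_gauge {D : V → Matrix Ix Ix ℝ} {Γ' : Ix → V → Matrix Ix Ix ℝ} (hD : SmoothMatAt D x)
    (hΓ : ∀ i, SmoothMatAt (Γ i) x) (hΓ' : ∀ i, SmoothMatAt (Γ' i) x)
    (h : ∀ᶠ y in 𝓝 x, ∀ i, D y * Γ i y = pdm i D y + Γ' i y * D y) (i j : Ix) :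
    D x * curv Γ i j x = curv Γ' i j x * D x := by
  have hx := h.self_of_nhds
  have hd : ∀ i j, pdm j D x * Γ i x + D x * pdm j (Γ i) x =
      pdm j (pdm i D) x + (pdm j (Γ' i) x * D x + Γ' i x * pdm j D x) := by
    intro i j
    rw [← pdm_mul hD (hΓ i), ← pdm_mul (hΓ' i) hD,
      ← pdm_add (hD.pdm i) ((hΓ' i).mul hD)]
    exact pdm_congr (h.mono fun y hy => hy i) j
  have hp : ∀ i, pdm i D x = D x * Γ i x - Γ' i x * D x := fun i => by rw [hx i]; abel
  have h1 := hd j i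
  have h2 := hd i j
  rw [pdm_comm hD j i] at h2
  rw [hp i] at h1
  rw [hp j] at h2
  have h3 := congrArg₂ (fun a b => a - b) h1 h2
  simp only [curv]
  rw [← sub_eq_zero] at h3 ⊢
  rw [← h3]
  noncomm_ring

end

section
variable {φ : V → V} {x : V} {G G' : V → Matrix Ix Ix ℝ}

/-- The transformation law of the Levi-Civita connection. -/
lemma jac_mul_conn (hφ : ContDiffAt ℝ ∞ φ x) (hG' : SmoothMatAt G' (φ x))
    (hs : ∀ y, (G y)ᵀ = G y) (hs' : ∀ y, (G' y)ᵀ = G' y) (h0 : (G x).det ≠ 0)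
    (h0' : ∀ y, (G' y).det ≠ 0)
    (h : ∀ᶠ y in 𝓝 x, G y = (jac φ y)ᵀ * G' (φ y) * jac φ y) (i : Ix) :
    jac φ x * conn G i x = pdm i (jac φ) x + pullConn φ (conn G') i x * jac φ x := by
  have hD := smoothMatAt_jac hφ
  have hGD := hG'.comp hφ
  have hx := h.self_of_nhds
  have hu : IsUnit (jac φ x).det := by
    rw [isUnit_iff_ne_zero]
    intro h1
    apply h0
    rw [hx, Matrix.det_mul, h1, mul_zero]
  have hB : pdm i (fun y => G' (φ y)) x =
      (pullConn φ (conn G') i x)ᵀ * G' (φ x) + G' (φ x) * pullConn φ (conn G') i x := by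
    rw [pdm_comp hG' hφ]
    simp only [pdm_metric hs' (h0' _), pullConn, Matrix.transpose_sum, Matrix.transpose_smul,
      Finset.sum_mul, Finset.mul_sum, smul_add, Finset.sum_add_distrib, smul_mul_assoc,
      mul_smul_comm]
  have key := eq_conn (G := G) (x := x)
    (Γ := fun i => (jac φ x)⁻¹ * (pdm i (jac φ) x + pullConn φ (conn G') i x * jac φ x)) h0 hs ?_ ?_ i
  · rw [← key, Matrix.mul_nonsing_inv_cancel_left _ _ hu]
  · intro i l k
    simp only [Matrix.mul_apply, Matrix.add_apply]
    refine Finset.sum_congr rfl fun m _ => ?_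
    congr 1
    rw [pdm_jac_symm hφ]
    congr 1
    simp only [pullConn, Matrix.sum_apply, Matrix.smul_apply, smul_eq_mul, Finset.sum_mul, conn,
      Matrix.of_apply]
    rw [Finset.sum_comm]
    refine Finset.sum_congr rfl fun a _ => Finset.sum_congr rfl fun b _ => ?_
    rw [christoffel_symm hs']; ring
  · intro i
    have hB : pdm i (fun y => G' (φ y)) x =
        (pullConn φ (conn G') i x)ᵀ * G' (φ x) + G' (φ x) * pullConn φ (conn G') i x := by
      rw [pdm_comp hG' hφ]
      simp only [pdm_metric hs' (h0' _), pullConn, Matrix.transpose_sum, Matrix.transpose_smul,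
        Finset.sum_mul, Finset.mul_sum, smul_add, Finset.sum_add_distrib, smul_mul_assoc,
        mul_smul_comm]
    rw [pdm_congr h i, pdm_mul (hD.transpose.mul hGD) hD, pdm_mul hD.transpose hGD,
      pdm_transpose, hB, hx]
    generalize pullConn φ (conn G') i x = B
    generalize pdm i (jac φ) x = D'
    have e : ∀ X, (jac φ x)ᵀ * G' (φ x) * jac φ x * ((jac φ x)⁻¹ * X) =
        (jac φ x)ᵀ * G' (φ x) * X := fun X => by
      rw [Matrix.mul_assoc _ (jac φ x), Matrix.mul_nonsing_inv_cancel_left _ _ hu]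
    have e' : ∀ X, ((jac φ x)⁻¹ * X)ᵀ * ((jac φ x)ᵀ * G' (φ x) * jac φ x) =
        Xᵀ * (G' (φ x) * jac φ x) := fun X => by
      rw [Matrix.mul_assoc, ← Matrix.mul_assoc _ (jac φ x)ᵀ, ← Matrix.transpose_mul,
        Matrix.mul_nonsing_inv_cancel_left _ _ hu]
    rw [e, e', Matrix.transpose_add, Matrix.transpose_mul]
    noncomm_ring

lemma sum_inv_mul_sum_smul {P : Matrix Ix Ix ℝ} (hu : IsUnit P.det) (X : Ix → Matrix Ix Ix ℝ)
    (k : Ix) : ∑ i, (P⁻¹ * ∑ a, P a i • X a) i k = ∑ a, X a a k := by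
  have hinv : ∀ a m, ∑ i, P a i * P⁻¹ i m = if a = m then 1 else 0 := by
    intro a m
    have := congrFun₂ (Matrix.mul_nonsing_inv _ hu) a m
    rwa [Matrix.mul_apply, Matrix.one_apply] at this
  simp only [Matrix.mul_apply, Matrix.sum_apply, Matrix.smul_apply, smul_eq_mul, Finset.mul_sum]
  rw [Finset.sum_congr rfl fun i _ => Finset.sum_comm, Finset.sum_comm]
  refine Finset.sum_congr rfl fun a _ => ?_
  rw [Finset.sum_comm]
  calc ∑ m, ∑ i, P⁻¹ i m * (P a i * X a m k) = ∑ m, (∑ i, P a i * P⁻¹ i m) * X a m k :=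
        Finset.sum_congr rfl fun m _ => by
          rw [Finset.sum_mul]; exact Finset.sum_congr rfl fun i _ => by ring
    _ = X a a k := by simp [hinv]

/-- Naturality of the Ricci tensor. -/
lemma ricci_pullback (hφ' : ∀ᶠ y in 𝓝 x, ContDiffAt ℝ ∞ φ y) (hG : ∀ y, SmoothMatAt G y)
    (hG' : ∀ y, SmoothMatAt G' y)
    (hs : ∀ y, (G y)ᵀ = G y) (hs' : ∀ y, (G' y)ᵀ = G' y) (h0 : ∀ y, (G y).det ≠ 0)
    (h0' : ∀ y, (G' y).det ≠ 0)
    (h : ∀ᶠ y in 𝓝 x, G y = (jac φ y)ᵀ * G' (φ y) * jac φ y) :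
    ricci G x = (jac φ x)ᵀ * ricci G' (φ x) * jac φ x := by
  have hφ := hφ'.self_of_nhds
  have hc : ∀ᶠ y in 𝓝 x, ∀ i, jac φ y * conn G i y =
      pdm i (jac φ) y + pullConn φ (conn G') i y * jac φ y := by
    filter_upwards [hφ', h.eventually_nhds] with y hy hy2 i
    exact jac_mul_conn hy (hG' _) hs hs' (h0 y) h0' hy2 i
  have hx := h.self_of_nhds
  have hu : IsUnit (jac φ x).det := by
    rw [isUnit_iff_ne_zero]
    intro h1
    apply h0 x
    rw [hx, Matrix.det_mul, h1, mul_zero]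
  have hcurv : ∀ i j, curv (conn G) i j x =
      (jac φ x)⁻¹ * ((∑ a, ∑ b, (jac φ x a i * jac φ x b j) • curv (conn G') a b (φ x)) *
        jac φ x) := by
    intro i j
    rw [← curv_pullConn hφ (fun a => smoothMatAt_conn (hG' _) (h0' _) a),
      ← curv_gauge (smoothMatAt_jac hφ) (fun i => smoothMatAt_conn (hG x) (h0 x) i)
        (fun i => smoothMatAt_pullConn hφ (fun a => smoothMatAt_conn (hG' _) (h0' _) a) i) hc,
      Matrix.nonsing_inv_mul_cancel_left _ _ hu]
  ext j k
  simp only [ricci, Matrix.of_apply, riem_eq_curv, hcurv]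
  have hX : ∀ i, (∑ a, ∑ b, (jac φ x a i * jac φ x b j) • curv (conn G') a b (φ x)) * jac φ x =
      ∑ a, jac φ x a i • ∑ b, jac φ x b j • (curv (conn G') a b (φ x) * jac φ x) := fun i => by
    simp only [Finset.sum_mul, smul_mul_assoc, Finset.smul_sum, smul_smul]
  simp only [hX]
  rw [sum_inv_mul_sum_smul hu]
  simp only [Matrix.mul_apply, Matrix.transpose_apply, Matrix.of_apply, Finset.sum_mul,
    Finset.mul_sum, Matrix.sum_apply, Matrix.smul_apply, smul_eq_mul]
  rw [Finset.sum_congr rfl fun a _ => Finset.sum_comm, Finset.sum_comm]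
  refine Finset.sum_congr rfl fun n _ => ?_
  rw [Finset.sum_comm]
  exact Finset.sum_congr rfl fun b _ => Finset.sum_congr rfl fun a _ => by ring

end

lemma IsMetric.smooth {g : Tensor2} (hg : IsMetric g) (c : Chart) (x : V) :
    SmoothMatAt (g c) x := fun k l => (hg.1.1 c k l).contDiffAt

lemma IsMetric.symm {g : Tensor2} (hg : IsMetric g) (c : Chart) (x : V) : (g c x)ᵀ = g c x := by
  have := (hg.2 c x).isHermitian
  rwa [Matrix.IsHermitian, Matrix.conjTranspose_eq_transpose_of_trivial] at this

lemma IsMetric.det_pos {g : Tensor2} (hg : IsMetric g) (c : Chart) (x : V) : 0 < (g c x).det :=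
  (hg.2 c x).det_pos

lemma christoffel_smul {G : V → Matrix Ix Ix ℝ} (hG : ∀ x, SmoothMatAt G x)
    (h0 : ∀ x, (G x).det ≠ 0) {r : ℝ} (hr : r ≠ 0) (k i j : Ix) (x : V) :
    christoffel (r • G) k i j x = christoffel G k i j x := by
  have hi : (r • G x)⁻¹ = r⁻¹ • (G x)⁻¹ :=
    Matrix.inv_smul' (G x) (Units.mk0 r hr) (isUnit_iff_ne_zero.2 (h0 x))
  have hp : ∀ a b c, pd a (fun y => r * G y b c) x = r * pd a (fun y => G y b c) x :=
    fun a b c => pd_const_mul r (hG x b c).diffAt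
  simp only [christoffel, Pi.smul_apply, Matrix.smul_apply, smul_eq_mul, hi, hp]
  congr 1
  refine Finset.sum_congr rfl fun l _ => ?_
  field_simp

lemma ricci_smul {G : V → Matrix Ix Ix ℝ} (hG : ∀ x, SmoothMatAt G x)
    (h0 : ∀ x, (G x).det ≠ 0) {r : ℝ} (hr : r ≠ 0) (x : V) : ricci (r • G) x = ricci G x := by
  have : ∀ k i j, christoffel (r • G) k i j = christoffel G k i j := fun k i j =>
    funext fun x => christoffel_smul hG h0 hr k i j x
  simp only [ricci, riem, this]

/-- The Ricci tensor as an endomorphism of the tangent space. -/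
def ricciEnd (G : V → Matrix Ix Ix ℝ) (x : V) : Matrix Ix Ix ℝ := (G x)⁻¹ * ricci G x

/-- The Ricci endomorphisms of homothetic metrics are conjugate up to the scaling factor. -/
lemma ricciEnd_of_isPullback {Φ : M → M} {S T : Tensor2} {r : ℝ} (hr : 0 < r)
    (hΦ : SmoothMap Φ) (hS : IsMetric S) (hT : IsMetric T) (h : IsPullback Φ T (r • S))
    {c c' : Chart} {x x' : V} (hx : Φ (par c x) = par c' x') :
    ∃ D : (Matrix Ix Ix ℝ)ˣ, ricciEnd (S c) x = r • ((D⁻¹ : (Matrix Ix Ix ℝ)ˣ) *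
      ricciEnd (T c') x' * D) := by
  set φ : V → V := coord c' ∘ Φ ∘ par c with hφ
  have hφx : φ x = x' := by simp [hφ, hx]
  have hrange : ∀ᶠ y in 𝓝 x, Φ (par c y) ∈ Set.range (par c') :=
    (hΦ c c' x ⟨x', hx.symm⟩).1
  have hs : ∀ᶠ y in 𝓝 x, ContDiffAt ℝ ∞ φ y := hrange.mono fun y hy => (hΦ c c' y hy).2
  have hpull : ∀ᶠ y in 𝓝 x, (r • S c) y = (jac φ y)ᵀ * T c' (φ y) * jac φ y := by
    filter_upwards [hrange] with y ⟨y', hy⟩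
    have e : φ y = y' := by simp [hφ, ← hy]
    rw [e]
    exact h c c' y y' hy.symm
  have hG : ∀ y, SmoothMatAt (r • S c) y := fun y k l =>
    contDiffAt_const.mul (hS.smooth c y k l)
  have hdet : ∀ y, ((r • S c) y).det ≠ 0 := fun y => by
    rw [Pi.smul_apply, Matrix.det_smul]
    exact mul_ne_zero (pow_ne_zero _ hr.ne') (hS.det_pos c y).ne'
  have hric := ricci_pullback hs hG (fun y => hT.smooth c' y)
    (fun y => by rw [Pi.smul_apply, Matrix.transpose_smul, hS.symm]) (hT.symm c') hdet
    (fun y => (hT.det_pos c' y).ne') hpull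
  rw [ricci_smul (hS.smooth c) (fun y => (hS.det_pos c y).ne') hr.ne', hφx] at hric
  have hx0 := hpull.self_of_nhds
  rw [hφx] at hx0
  have hu : IsUnit (jac φ x).det := by
    rw [isUnit_iff_ne_zero]
    intro h1
    apply hdet x
    rw [hx0, Matrix.det_mul, h1, mul_zero]
  have huT : IsUnit (jac φ x)ᵀ.det := by rwa [Matrix.det_transpose]
  have hi : (S c x)⁻¹ = r • ((r • S c) x)⁻¹ := by
    rw [Pi.smul_apply, show (r • S c x)⁻¹ = r⁻¹ • (S c x)⁻¹ from
      Matrix.inv_smul' (S c x) (Units.mk0 r hr.ne') (isUnit_iff_ne_zero.2 (hS.det_pos c x).ne'),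
      smul_smul, mul_inv_cancel₀ hr.ne', one_smul]
  refine ⟨Matrix.nonsingInvUnit _ hu, ?_⟩
  rw [ricciEnd, hric, hi, hx0, Matrix.mul_inv_rev, Matrix.mul_inv_rev, smul_mul_assoc]
  congr 1
  change _ = (jac φ x)⁻¹ * ricciEnd (T c') x' * jac φ x
  rw [ricciEnd]
  calc (jac φ x)⁻¹ * ((T c' x')⁻¹ * (jac φ x)ᵀ⁻¹) * ((jac φ x)ᵀ * ricci (T c') x' * jac φ x)
      = (jac φ x)⁻¹ * (T c' x')⁻¹ * ((jac φ x)ᵀ⁻¹ * ((jac φ x)ᵀ * (ricci (T c') x' * jac φ x))) := by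
        simp only [Matrix.mul_assoc]
    _ = _ := by
        rw [Matrix.nonsing_inv_mul_cancel_left _ _ huT]
        simp only [Matrix.mul_assoc]

/-- Constancy of the trace of a power of the Ricci endomorphism is a homothety invariant. -/
lemma trace_ricciEnd_pow_const {Φ : M → M} {S T : Tensor2} {r : ℝ} (hr : 0 < r)
    (hΦ : SmoothMap Φ) (hsurj : Function.Surjective Φ) (hS : IsMetric S) (hT : IsMetric T)
    (h : IsPullback Φ T (r • S)) (n : ℕ) {s : ℝ}
    (hs : ∀ c x, (ricciEnd (S c) x ^ n).trace = s) (c' : Chart) (x' : V) :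
    (ricciEnd (T c') x' ^ n).trace = (r ^ n)⁻¹ * s := by
  obtain ⟨m, hm⟩ := hsurj (par c' x')
  obtain ⟨c, x, rfl⟩ := exists_par m
  obtain ⟨D, hD⟩ := ricciEnd_of_isPullback hr hΦ hS hT h hm
  rw [← hs c x, hD, smul_pow, Units.conj_pow', Matrix.trace_smul, Matrix.trace_mul_comm,
    ← Matrix.mul_assoc, Units.mul_inv, one_mul, smul_eq_mul, ← mul_assoc,
    inv_mul_cancel₀ (pow_ne_zero _ hr.ne'), one_mul]

/-! ### Möbius transformations -/

lemma mk_mem_range_affine {v : Fin 2 → ℂ} (hv : v ≠ 0) (j : Fin 2) :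
    Projectivization.mk ℂ v hv ∈ Set.range (affine j) ↔ v j ≠ 0 := by
  unfold affine
  simp only [Set.mem_range, Projectivization.mk_eq_mk_iff']
  constructor
  · rintro ⟨z, a, ha⟩ h
    have hj := congrFun ha j
    have : a = 0 ∨ v = 0 := by
      left; by_contra h0; simp [h] at hj
    rcases this with rfl | h0
    · simp at hj
    · exact hv h0
  · intro h
    refine ⟨v (1 - j) / v j, (v j)⁻¹, ?_⟩
    funext k
    fin_cases j <;> fin_cases k <;> simp_all [Function.update] <;> field_simp

/-- The homogeneous coordinates of the image of a point under a Möbius transformation. -/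
def moebiusVec (A : Matrix.SpecialLinearGroup (Fin 2) ℂ) (i : Fin 2) (z : ℂ) : Fin 2 → ℂ :=
  (A : Matrix (Fin 2) (Fin 2) ℂ) *ᵥ Function.update (fun _ => z) i 1

lemma exists_smul_affine (A : Matrix.SpecialLinearGroup (Fin 2) ℂ) (i : Fin 2) (z : ℂ) :
    ∃ hv, A • affine i z = Projectivization.mk ℂ (moebiusVec A i z) hv :=
  ⟨_, rfl⟩

lemma contDiff_moebiusVec (A : Matrix.SpecialLinearGroup (Fin 2) ℂ) (i j p : Fin 2) :
    ContDiff ℝ ∞ fun y => moebiusVec A i (zc p y) j := by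
  simp only [moebiusVec, Matrix.mulVec, dotProduct]
  refine ContDiff.sum fun k _ => contDiff_const.mul ?_
  by_cases h : k = i
  · subst h; simpa using contDiff_const
  · simpa [Function.update_of_ne h] using contDiff_zc p

lemma smoothMap_act (A : Aut0) : SmoothMap A.act := by
  have hA : ∀ p, ∃ B : Matrix.SpecialLinearGroup (Fin 2) ℂ, ∀ m : CP1, A p • m = B • m := by
    intro p
    obtain ⟨B, hB⟩ := QuotientGroup.mk_surjective (A p)
    exact ⟨B, fun m => by rw [← hB]; rfl⟩
  choose B hB using hA
  have hact : ∀ c x p, ∃ hv, A.act (par c x) p =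
      Projectivization.mk ℂ (moebiusVec (B p) (c p) (zc p x)) hv := fun c x p => by
    simp only [Aut0.act, par, hB]
    exact exists_smul_affine _ _ _
  have hrange : ∀ c c' x, A.act (par c x) ∈ Set.range (par c') ↔
      ∀ p, moebiusVec (B p) (c p) (zc p x) (c' p) ≠ 0 := by
    intro c c' x
    have h1 : A.act (par c x) ∈ Set.range (par c') ↔
        ∀ p, A.act (par c x) p ∈ Set.range (affine (c' p)) := by
      constructor
      · rintro ⟨y, hy⟩ p
        exact ⟨zc p y, congrFun hy p⟩
      · intro h
        choose z hz using h
        exact ⟨ofZ z, funext hz⟩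
    rw [h1]
    refine forall_congr' fun p => ?_
    obtain ⟨hv, h⟩ := hact c x p
    rw [h, mk_mem_range_affine]
  intro c c' x hx
  rw [hrange] at hx
  refine ⟨?_, ?_⟩
  · simp only [hrange, Filter.eventually_all]
    exact fun p => (contDiff_moebiusVec (B p) (c p) (c' p) p).continuous.continuousAt.eventually_ne
      (hx p)
  · have hq : ∀ p, ContDiffAt ℝ ∞ (fun y => moebiusVec (B p) (c p) (zc p y) (1 - c' p) /
        moebiusVec (B p) (c p) (zc p y) (c' p)) x := fun p => by
      simp only [div_eq_mul_inv]
      exact (contDiff_moebiusVec _ _ _ _).contDiffAt.mul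
        ((contDiff_moebiusVec _ _ _ _).contDiffAt.inv (hx p))
    have hcoord : ∀ p y, affineCoord (c' p) (A.act (par c y) p) =
        moebiusVec (B p) (c p) (zc p y) (1 - c' p) / moebiusVec (B p) (c p) (zc p y) (c' p) := by
      intro p y
      obtain ⟨hv, h⟩ := hact c y p
      rw [h]
      rfl
    rw [contDiffAt_pi]
    rintro ⟨p, a⟩
    simp only [Function.comp_apply, coord, hcoord]
    split_ifs
    · exact Complex.reCLM.contDiff.contDiffAt.comp x (hq p)
    · exact Complex.imCLM.contDiff.contDiffAt.comp x (hq p)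

lemma act_surjective (A : Aut0) : Function.Surjective A.act := fun m =>
  ⟨fun p => (A p)⁻¹ • m p, funext fun _ => smul_inv_smul _ _⟩

/-! ### Metrics which are conformally flat on each factor -/

lemma bdiag_inv {u : Fin 2 → ℝ} (hu : ∀ p, u p ≠ 0) : (bdiag u)⁻¹ = bdiag fun p => (u p)⁻¹ := by
  refine Matrix.inv_eq_right_inv ?_
  simp only [bdiag, Matrix.diagonal_mul_diagonal]
  ext k l
  simp [Matrix.diagonal_apply, Matrix.one_apply, hu]

lemma bdiag_apply (u : Fin 2 → ℝ) (k l : Ix) : bdiag u k l = if k = l then u k.1 else 0 :=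
  Matrix.diagonal_apply ..

/-- The metric `∑ exp (2 φ_p) |dz_p|²`. -/
def expMetric (φ : Fin 2 → V → ℝ) (x : V) : Matrix Ix Ix ℝ :=
  bdiag fun p => Real.exp (2 * φ p x)

section
variable {φ : Fin 2 → V → ℝ} (hφ : ∀ r, ContDiff ℝ ∞ (φ r))
include hφ

lemma pd_exp_two_mul (r : Fin 2) (i : Ix) (x : V) :
    pd i (fun y => Real.exp (2 * φ r y)) x = 2 * Real.exp (2 * φ r x) * pd i (φ r) x := by
  have := pd_comp (i := i) (h := fun s => Real.exp (2 * s)) (u := φ r) (x := x) (by fun_prop)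
    (hφ r).diffAt
  rw [this]
  have e : deriv (fun s => Real.exp (2 * s)) (φ r x) = 2 * Real.exp (2 * φ r x) := by
    have := (((hasDerivAt_id (φ r x)).const_mul 2).exp).deriv
    simp only [id, mul_one] at this
    rw [this, mul_comm]
  rw [e]

lemma christoffel_expMetric (k i j : Ix) (x : V) : christoffel (expMetric φ) k i j x =
    (if k = j then pd i (φ k.1) x else 0) + (if k = i then pd j (φ k.1) x else 0) -
      if i = j then Real.exp (2 * (φ i.1 x - φ k.1 x)) * pd k (φ i.1) x else 0 := by
  have h0 : ∀ p, Real.exp (2 * φ p x) ≠ 0 := fun p => (Real.exp_pos _).ne'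
  have hd : ∀ m k l, pd m (fun y => expMetric φ y k l) x =
      if k = l then 2 * Real.exp (2 * φ k.1 x) * pd m (φ k.1) x else 0 := by
    intro m k l
    simp only [expMetric, bdiag_apply]
    split_ifs
    · exact pd_exp_two_mul hφ _ _ _
    · simp
  have hexp : Real.exp (2 * (φ i.1 x - φ k.1 x)) = (Real.exp (2 * φ k.1 x))⁻¹ *
      Real.exp (2 * φ i.1 x) := by
    rw [← Real.exp_neg, ← Real.exp_add]; ring_nf
  simp only [christoffel, hd]
  rw [expMetric, bdiag_inv h0]
  simp only [bdiag_apply, ite_mul, zero_mul, Finset.sum_ite_eq, Finset.mem_univ, if_true, hexp]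
  have t : ∀ l m : Ix, (Real.exp (2 * φ k.1 x))⁻¹ *
      (if l = k then 2 * Real.exp (2 * φ l.1 x) * pd m (φ l.1) x else 0) =
      2 * if k = l then pd m (φ k.1) x else 0 := by
    intro l m
    by_cases h : l = k
    · subst h
      have := h0 l.1
      simp only [if_true]; field_simp
    · simp [h, Ne.symm h]
  have t' : (Real.exp (2 * φ k.1 x))⁻¹ *
      (if i = j then 2 * Real.exp (2 * φ i.1 x) * pd k (φ i.1) x else 0) =
      2 * if i = j then (Real.exp (2 * φ k.1 x))⁻¹ * Real.exp (2 * φ i.1 x) * pd k (φ i.1) x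
        else 0 := by
    split_ifs <;> ring
  rw [mul_sub, mul_add, t, t, t']
  ring

lemma pd_christoffel_expMetric (m k i j : Ix) (x : V) :
    pd m (christoffel (expMetric φ) k i j) x =
      (if k = j then pd m (pd i (φ k.1)) x else 0) + (if k = i then pd m (pd j (φ k.1)) x else 0) -
      if i = j then Real.exp (2 * (φ i.1 x - φ k.1 x)) *
        (2 * (pd m (φ i.1) x - pd m (φ k.1) x) * pd k (φ i.1) x + pd m (pd k (φ i.1)) x) else 0 := by
  have e : christoffel (expMetric φ) k i j = fun x =>
    (if k = j then pd i (φ k.1) x else 0) + (if k = i then pd j (φ k.1) x else 0) -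
      if i = j then Real.exp (2 * (φ i.1 x - φ k.1 x)) * pd k (φ i.1) x else 0 :=
    funext fun x => christoffel_expMetric hφ k i j x
  have d1 : ∀ a r, DifferentiableAt ℝ (pd a (φ r)) x := fun a r => (contDiff_pd (hφ r)).diffAt
  have dφ : ∀ r, DifferentiableAt ℝ (φ r) x := fun r => (hφ r).diffAt
  have dexp : DifferentiableAt ℝ (fun x => Real.exp (2 * (φ i.1 x - φ k.1 x))) x :=
    (((dφ _).sub (dφ _)).const_mul 2).exp
  have hite : ∀ (P : Prop) [Decidable P] (u : V → ℝ),
      pd m (fun y => if P then u y else 0) x = if P then pd m u x else 0 := by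
    intro P _ u; split_ifs <;> simp
  have dite : ∀ (P : Prop) [Decidable P] (u : V → ℝ), DifferentiableAt ℝ u x →
      DifferentiableAt ℝ (fun y => if P then u y else 0) x := by
    intro P _ u hu; split_ifs <;> simp [hu]
  have hexp : pd m (fun x => Real.exp (2 * (φ i.1 x - φ k.1 x))) x =
      Real.exp (2 * (φ i.1 x - φ k.1 x)) * (2 * (pd m (φ i.1) x - pd m (φ k.1) x)) := by
    have h := pd_comp (i := m) (h := Real.exp) (u := fun x => 2 * (φ i.1 x - φ k.1 x)) (x := x)
      (by fun_prop) (((dφ _).sub (dφ _)).const_mul 2)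
    rw [h, Real.deriv_exp, pd_const_mul _ ((dφ _).fun_sub (dφ _)), pd_sub (dφ _) (dφ _)]
  rw [e, pd_sub (DifferentiableAt.fun_add (dite _ _ (d1 _ _)) (dite _ _ (d1 _ _)))
    (dite _ _ (dexp.fun_mul (d1 _ _))), pd_add (dite _ _ (d1 _ _)) (dite _ _ (d1 _ _)),
    hite, hite, hite, pd_mul dexp (d1 _ _), hexp]
  congr 1
  split_ifs <;> ring

end

/-- The squared modulus of the affine coordinate of the factor `p`. -/
def nsq (p : Fin 2) (x : V) : ℝ := x (p, 0) ^ 2 + x (p, 1) ^ 2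

lemma nsq_nonneg (p : Fin 2) (x : V) : 0 ≤ nsq p x := by unfold nsq; positivity

lemma norm_zc_sq (p : Fin 2) (x : V) : ‖zc p x‖ ^ 2 = nsq p x := by
  rw [← Complex.normSq_eq_norm_sq, Complex.normSq_apply, zc_re, zc_im, nsq]; ring

lemma nsq_eq_zero_iff {p : Fin 2} {x : V} : nsq p x = 0 ↔ zc p x = 0 := by
  rw [← norm_zc_sq]; simp

lemma contDiff_nsq (p : Fin 2) : ContDiff ℝ ∞ (nsq p) := by
  unfold nsq; fun_prop

lemma pd_nsq (p : Fin 2) (k : Ix) (x : V) : pd k (nsq p) x = if k.1 = p then 2 * x k else 0 := by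
  obtain ⟨q, b⟩ := k
  have h : ∀ a, pd (q, b) (fun y : V => y (p, a) ^ 2) x =
      2 * x (p, a) * if (p, a) = (q, b) then 1 else 0 := by
    intro a
    have h1 := pd_comp (i := (q, b)) (h := fun s => s ^ 2) (u := fun y : V => y (p, a)) (x := x)
      (by fun_prop) (by fun_prop)
    rw [h1, pd_coord]; simp
  have e : nsq p = fun y => y (p, 0) ^ 2 + y (p, 1) ^ 2 := rfl
  rw [e, pd_add (by fun_prop) (by fun_prop), h, h]
  by_cases hpq : p = q
  · subst hpq; fin_cases b <;> simp
  · simp [hpq, Ne.symm hpq]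

section
variable {A : ℝ → ℝ} (hA : ∀ s, 0 ≤ s → ContDiffAt ℝ ∞ A s) (p : Fin 2)
include hA

lemma contDiff_radial : ContDiff ℝ ∞ fun y => A (nsq p y) :=
  contDiff_iff_contDiffAt.2 fun x => (hA _ (nsq_nonneg p x)).comp x (contDiff_nsq p).contDiffAt

lemma contDiffAt_deriv_radial (s : ℝ) (hs : 0 ≤ s) : ContDiffAt ℝ ∞ (deriv A) s := by
  have h : ContDiffAt ℝ ∞ (fderiv ℝ A) s := (hA s hs).fderiv_right (by simp)
  exact h.clm_apply contDiffAt_const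

lemma pd_radial (k : Ix) (x : V) :
    pd k (fun y => A (nsq p y)) x = if k.1 = p then 2 * x k * deriv A (nsq p x) else 0 := by
  rw [pd_comp (hA _ (nsq_nonneg p x)).diffAt (contDiff_nsq p).diffAt, pd_nsq]
  split_ifs <;> ring

lemma pd_pd_radial (m k : Ix) (x : V) :
    pd m (pd k (fun y => A (nsq p y))) x = if k.1 = p ∧ m.1 = p then
      (if k = m then 2 * deriv A (nsq p x) else 0) + 4 * x k * x m * deriv (deriv A) (nsq p x)
      else 0 := by
  have e : pd k (fun y => A (nsq p y)) =
      fun x => if k.1 = p then 2 * (x k * deriv A (nsq p x)) else 0 :=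
    funext fun x => by rw [pd_radial hA]; split_ifs <;> ring
  have hA' := contDiffAt_deriv_radial hA
  rw [e]
  by_cases hk : k.1 = p
  · have d1 : DifferentiableAt ℝ (fun y => deriv A (nsq p y)) x := (contDiff_radial hA' p).diffAt
    have d2 : DifferentiableAt ℝ (fun y : V => y k) x := by fun_prop
    simp only [hk, if_true, true_and]
    rw [pd_const_mul _ (d2.fun_mul d1), pd_mul d2 d1, pd_radial hA', pd_coord]
    by_cases hm : m.1 = p
    · simp only [hm, if_true]; split_ifs <;> ring
    · have : k ≠ m := fun h => hm (h ▸ hk)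
      simp [hm, this]
  · simp [hk]

end

/-! ### Warped products with radial coefficients -/

section
variable {p q : Fin 2} {A B C : ℝ → ℝ}

/-- The exponents of the metric `e^{2A(|z_p|²)} |dz_p|² + e^{2(B(|z_q|²) + C(|z_p|²))} |dz_q|²`. -/
def warp (p q : Fin 2) (A B C : ℝ → ℝ) (r : Fin 2) (x : V) : ℝ :=
  if r = p then A (nsq p x) else B (nsq q x) + C (nsq p x)

variable (hpq : p ≠ q) (hA : ∀ s, 0 ≤ s → ContDiffAt ℝ ∞ A s)
  (hB : ∀ s, 0 ≤ s → ContDiffAt ℝ ∞ B s) (hC : ∀ s, 0 ≤ s → ContDiffAt ℝ ∞ C s)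

include hA hB hC in
lemma contDiff_warp (r : Fin 2) : ContDiff ℝ ∞ (warp p q A B C r) := by
  unfold warp
  split_ifs
  · exact contDiff_radial hA p
  · exact (contDiff_radial hB q).add (contDiff_radial hC p)

lemma warp_left : warp p q A B C p = fun x => A (nsq p x) := by
  funext x; simp [warp]

include hpq

lemma warp_right : warp p q A B C q = fun x => B (nsq q x) + C (nsq p x) := by
  funext x; simp [warp, hpq.symm]

include hA hB hC

lemma pd_warp (k : Ix) (x : V) :
    pd k (warp p q A B C p) x = (if k.1 = p then 2 * x k * deriv A (nsq p x) else 0) ∧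
    pd k (warp p q A B C q) x = (if k.1 = q then 2 * x k * deriv B (nsq q x) else 0) +
      (if k.1 = p then 2 * x k * deriv C (nsq p x) else 0) := by
  rw [warp_left, warp_right hpq, pd_radial hA, pd_add (contDiff_radial hB q).diffAt
    (contDiff_radial hC p).diffAt, pd_radial hB, pd_radial hC]
  exact ⟨rfl, rfl⟩

lemma pd_pd_warp (m k : Ix) (x : V) :
    pd m (pd k (warp p q A B C p)) x = (if k.1 = p ∧ m.1 = p then
      (if k = m then 2 * deriv A (nsq p x) else 0) + 4 * x k * x m * deriv (deriv A) (nsq p x)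
      else 0) ∧
    pd m (pd k (warp p q A B C q)) x = (if k.1 = q ∧ m.1 = q then
      (if k = m then 2 * deriv B (nsq q x) else 0) + 4 * x k * x m * deriv (deriv B) (nsq q x)
      else 0) + (if k.1 = p ∧ m.1 = p then
      (if k = m then 2 * deriv C (nsq p x) else 0) + 4 * x k * x m * deriv (deriv C) (nsq p x)
      else 0) := by
  have e : pd k (warp p q A B C q) = fun x => pd k (fun y => B (nsq q y)) x +
      pd k (fun y => C (nsq p y)) x := by
    funext x
    rw [warp_right hpq, pd_add (contDiff_radial hB q).diffAt (contDiff_radial hC p).diffAt]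
  rw [e, warp_left, pd_pd_radial hA, pd_add (contDiff_pd (contDiff_radial hB q)).diffAt
    (contDiff_pd (contDiff_radial hC p)).diffAt, pd_pd_radial hB, pd_pd_radial hC]
  exact ⟨rfl, rfl⟩

/-- The Ricci tensor of a warped product of radial metrics, when `e^C` is such that its Hessian is
a multiple of the metric of the factor `p`. -/
lemma ricci_warp (x : V)
    (hW : deriv (deriv C) (nsq p x) + deriv C (nsq p x) ^ 2 =
      2 * deriv A (nsq p x) * deriv C (nsq p x)) :
    ricci (expMetric (warp p q A B C)) x = bdiag fun r =>
      if r = p then -4 * (deriv A (nsq p x) + nsq p x * deriv (deriv A) (nsq p x)) -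
        4 * deriv C (nsq p x) - 8 * nsq p x * deriv A (nsq p x) * deriv C (nsq p x)
      else -4 * (deriv B (nsq q x) + nsq q x * deriv (deriv B) (nsq q x)) -
        Real.exp (2 * (warp p q A B C q x - warp p q A B C p x)) *
        (4 * deriv C (nsq p x) + 4 * nsq p x * deriv (deriv C) (nsq p x) +
          8 * nsq p x * deriv C (nsq p x) ^ 2) := by
  have hs := contDiff_warp (p := p) (q := q) hA hB hC
  have hqp := hpq.symm
  have d1p := fun k => (pd_warp hpq hA hB hC k x).1
  have d1q := fun k => (pd_warp hpq hA hB hC k x).2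
  have d2p := fun m k => (pd_pd_warp hpq hA hB hC m k x).1
  have d2q := fun m k => (pd_pd_warp hpq hA hB hC m k x).2
  ext ⟨r, a⟩ ⟨s, b⟩
  simp only [ricci, Matrix.of_apply, riem, pd_christoffel_expMetric hs, christoffel_expMetric hs,
    bdiag_apply, sum_Ix hpq]
  have hC2 : deriv (deriv C) (nsq p x) = 2 * deriv A (nsq p x) * deriv C (nsq p x) -
    deriv C (nsq p x) ^ 2 := by linarith
  rcases eq_or_eq_of_ne hpq r with rfl | rfl <;> rcases eq_or_eq_of_ne hpq s with rfl | rfl <;>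
    fin_cases a <;> fin_cases b <;>
    simp [d1p, d1q, d2p, d2q, hpq, hqp, hC2] <;> (try unfold nsq) <;> ring

end

/-- The Hessian of a radial function `τ(|z_p|²)` with respect to a product of radial metrics, when
it is a multiple of the metric of the factor `p`. -/
lemma hess_warp {p q : Fin 2} {A B τ : ℝ → ℝ} (hpq : p ≠ q)
    (hA : ∀ s, 0 ≤ s → ContDiffAt ℝ ∞ A s) (hB : ∀ s, 0 ≤ s → ContDiffAt ℝ ∞ B s)
    (hτ : ∀ s, 0 ≤ s → ContDiffAt ℝ ∞ τ s) (x : V)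
    (hW : deriv (deriv τ) (nsq p x) = 2 * deriv A (nsq p x) * deriv τ (nsq p x)) :
    hess (expMetric (warp p q A B fun _ => 0)) (fun y => τ (nsq p y)) x = bdiag fun r =>
      if r = p then 2 * deriv τ (nsq p x) + 4 * nsq p x * deriv A (nsq p x) * deriv τ (nsq p x)
      else 0 := by
  have hC : ∀ s : ℝ, 0 ≤ s → ContDiffAt ℝ ∞ (fun _ : ℝ => (0 : ℝ)) s :=
    fun s _ => contDiffAt_const
  have hs := contDiff_warp (p := p) (q := q) hA hB hC
  have hqp := hpq.symm
  have d1p := fun k => (pd_warp hpq hA hB hC k x).1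
  have d1q := fun k => (pd_warp hpq hA hB hC k x).2
  ext ⟨r, a⟩ ⟨s, b⟩
  simp only [hess, Matrix.of_apply, christoffel_expMetric hs,
    bdiag_apply, sum_Ix hpq, pd_radial hτ, pd_pd_radial hτ]
  rcases eq_or_eq_of_ne hpq r with rfl | rfl <;> rcases eq_or_eq_of_ne hpq s with rfl | rfl <;>
    fin_cases a <;> fin_cases b <;>
    simp [d1p, d1q, hpq, hqp, hW] <;> (try unfold nsq) <;> ring

/-! ### Products of round spheres are locally symmetric -/

lemma ite_mul_ite_eq_zero {P Q : Prop} [Decidable P] [Decidable Q] {a b : ℝ} (h : ¬ (P ∧ Q)) :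
    (if P then a else 0) * (if Q then b else 0) = 0 := by
  by_cases hP : P
  · have : ¬ Q := fun hQ => h ⟨hP, hQ⟩
    simp [this]
  · simp [hP]

section
variable {A : Fin 2 → ℝ → ℝ} (hA : ∀ r s, 0 ≤ s → ContDiffAt ℝ ∞ (A r) s)
include hA

/-- The Christoffel symbols of a product of radial metrics. -/
lemma christoffel_product (k i j : Ix) (x : V) :
    christoffel (expMetric fun r x => A r (nsq r x)) k i j x =
      if k.1 = i.1 ∧ k.1 = j.1 then 2 * deriv (A k.1) (nsq k.1 x) *
        ((if k = j then x i else 0) + (if k = i then x j else 0) - if i = j then x k else 0)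
      else 0 := by
  rw [christoffel_expMetric fun r => contDiff_radial (hA r) r]
  simp only [pd_radial (hA _)]
  obtain ⟨r, a⟩ := k
  obtain ⟨s, b⟩ := i
  obtain ⟨t, c⟩ := j
  by_cases h1 : r = s
  · subst h1
    by_cases h2 : r = t
    · subst h2
      simp only [sub_self, mul_zero, Real.exp_zero, if_true, and_self]
      split_ifs <;> ring
    · simp [h2, Ne.symm h2]
  · by_cases h2 : r = t
    · subst h2
      simp [h1, Ne.symm h1]
    · simp [h1, h2]

lemma pd_christoffel_product (m k i j : Ix) (x : V) :
    pd m (christoffel (expMetric fun r x => A r (nsq r x)) k i j) x =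
      if k.1 = i.1 ∧ k.1 = j.1 ∧ k.1 = m.1 then
        4 * x m * deriv (deriv (A k.1)) (nsq k.1 x) *
        ((if k = j then x i else 0) + (if k = i then x j else 0) - if i = j then x k else 0) +
        2 * deriv (A k.1) (nsq k.1 x) *
        ((if k = j ∧ i = m then 1 else 0) + (if k = i ∧ j = m then 1 else 0) -
          if i = j ∧ k = m then 1 else 0)
      else 0 := by
  have e : christoffel (expMetric fun r x => A r (nsq r x)) k i j = fun x =>
      if k.1 = i.1 ∧ k.1 = j.1 then 2 * deriv (A k.1) (nsq k.1 x) *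
        ((if k = j then x i else 0) + (if k = i then x j else 0) - if i = j then x k else 0)
      else 0 := funext fun x => christoffel_product hA k i j x
  have hA' := contDiffAt_deriv_radial (hA k.1)
  have hcoord : ∀ (P : Prop) [Decidable P] (a : Ix),
      DifferentiableAt ℝ (fun y : V => if P then y a else 0) x ∧
      pd m (fun y : V => if P then y a else 0) x = if P ∧ a = m then 1 else 0 := by
    intro P _ a
    by_cases h : P
    · simp only [h, if_true, true_and]
      exact ⟨by fun_prop, pd_coord⟩
    · simp [h]
  have d1 : DifferentiableAt ℝ (fun x => 2 * deriv (A k.1) (nsq k.1 x)) x :=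
    ((contDiff_radial hA' k.1).diffAt).const_mul 2
  rw [e]
  by_cases h : k.1 = i.1 ∧ k.1 = j.1
  · simp only [if_pos h]
    rw [pd_mul d1 (((hcoord _ _).1.fun_add (hcoord _ _).1).fun_sub
      (hcoord _ _).1), pd_sub ((hcoord _ _).1.fun_add (hcoord _ _).1) (hcoord _ _).1,
      pd_add (hcoord _ _).1 (hcoord _ _).1, (hcoord _ _).2, (hcoord _ _).2, (hcoord _ _).2]
    have h3 : pd m (fun y => 2 * deriv (A k.1) (nsq k.1 y)) x =
        if m.1 = k.1 then 4 * x m * deriv (deriv (A k.1)) (nsq k.1 x) else 0 := by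
      rw [pd_const_mul _ (contDiff_radial hA' k.1).diffAt, pd_radial hA']
      split_ifs <;> ring
    rw [h3]
    by_cases hm : k.1 = m.1
    · have h' : k.1 = i.1 ∧ k.1 = j.1 ∧ k.1 = m.1 := ⟨h.1, h.2, hm⟩
      simp only [if_pos h', if_pos hm.symm]
    · have e1 : k ≠ m := fun h => hm (h ▸ rfl)
      have e2 : i ≠ m := fun h' => hm (h.1.trans (h' ▸ rfl))
      have e3 : j ≠ m := fun h' => hm (h.2.trans (h' ▸ rfl))
      have h' : ¬ (k.1 = i.1 ∧ k.1 = j.1 ∧ k.1 = m.1) := fun h' => hm h'.2.2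
      simp only [if_neg h', if_neg (Ne.symm hm)]
      simp [e1, e2, e3]
  · have h' : ¬ (k.1 = i.1 ∧ k.1 = j.1 ∧ k.1 = m.1) := fun h' => h ⟨h'.1, h'.2.1⟩
    simp [h, h']

set_option maxHeartbeats 1000000 in
/-- The curvature of a product of radial metrics. -/
lemma riem_product (l k i j : Ix) (x : V) :
    riem (expMetric fun r x => A r (nsq r x)) l k i j x =
      if l.1 = k.1 ∧ l.1 = i.1 ∧ l.1 = j.1 then
        -4 * (deriv (A l.1) (nsq l.1 x) + nsq l.1 x * deriv (deriv (A l.1)) (nsq l.1 x)) *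
        ((if l = i ∧ k = j then 1 else 0) - if l = j ∧ k = i then 1 else 0)
      else 0 := by
  simp only [riem, pd_christoffel_product hA, christoffel_product hA]
  obtain ⟨r, a⟩ := l
  obtain ⟨s, b⟩ := k
  obtain ⟨t, c⟩ := i
  obtain ⟨u, d⟩ := j
  by_cases h : r = s ∧ r = t ∧ r = u
  · obtain ⟨rfl, rfl, rfl⟩ := h
    have hr : r ≠ 1 - r := by omega
    have hr' : 1 - r ≠ r := by omega
    rw [sum_Ix hr]
    fin_cases a <;> fin_cases b <;> fin_cases c <;> fin_cases d <;> simp [hr, hr'] <;>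
      unfold nsq <;> ring
  · rw [if_neg h, if_neg (by tauto), if_neg (by tauto), Finset.sum_eq_zero]
    · simp
    · rintro ⟨v, e⟩ -
      rw [ite_mul_ite_eq_zero (by dsimp only; omega), ite_mul_ite_eq_zero (by dsimp only; omega),
        sub_zero]

set_option maxHeartbeats 1000000 in
/-- The covariant derivative of the curvature of a product of radial metrics of constant
curvature. -/
lemma nablaRiem_product {K : Fin 2 → ℝ}
    (hK : ∀ r s, 0 ≤ s → -4 * (deriv (A r) s + s * deriv (deriv (A r)) s) =
      K r * Real.exp (2 * A r s)) (m l k i j : Ix) (x : V) :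
    nablaRiem (expMetric fun r x => A r (nsq r x)) m l k i j x = 0 := by
  have hR : ∀ l k i j, riem (expMetric fun r x => A r (nsq r x)) l k i j = fun x =>
      if l.1 = k.1 ∧ l.1 = i.1 ∧ l.1 = j.1 then
        ((if l = i ∧ k = j then 1 else 0) - if l = j ∧ k = i then 1 else 0) * K l.1 *
          Real.exp (2 * A l.1 (nsq l.1 x))
      else 0 := by
    intro l k i j
    funext x
    rw [riem_product hA, hK _ _ (nsq_nonneg _ x)]
    split_ifs <;> ring
  have hpd : ∀ l k i j, pd m (riem (expMetric fun r x => A r (nsq r x)) l k i j) x =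
      if l.1 = k.1 ∧ l.1 = i.1 ∧ l.1 = j.1 ∧ l.1 = m.1 then
        ((if l = i ∧ k = j then 1 else 0) - if l = j ∧ k = i then 1 else 0) * K l.1 *
          Real.exp (2 * A l.1 (nsq l.1 x)) * (4 * x m * deriv (A l.1) (nsq l.1 x))
      else 0 := by
    intro l k i j
    rw [hR]
    have hφ := fun r => contDiff_radial (hA r) r
    have d : DifferentiableAt ℝ (fun x => Real.exp (2 * A l.1 (nsq l.1 x))) x :=
      (((hφ l.1).diffAt).const_mul 2).exp
    by_cases h : l.1 = k.1 ∧ l.1 = i.1 ∧ l.1 = j.1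
    · simp only [if_pos h]
      rw [pd_const_mul _ d, pd_exp_two_mul (φ := fun r x => A r (nsq r x)) hφ,
        pd_radial (hA _)]
      by_cases hm : l.1 = m.1
      · have h' : l.1 = k.1 ∧ l.1 = i.1 ∧ l.1 = j.1 ∧ l.1 = m.1 := ⟨h.1, h.2.1, h.2.2, hm⟩
        simp only [if_pos h', if_pos hm.symm]; ring
      · have h' : ¬ (l.1 = k.1 ∧ l.1 = i.1 ∧ l.1 = j.1 ∧ l.1 = m.1) := fun h' => hm h'.2.2.2
        simp only [if_neg h', if_neg (Ne.symm hm)]; simp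
    · have h' : ¬ (l.1 = k.1 ∧ l.1 = i.1 ∧ l.1 = j.1 ∧ l.1 = m.1) :=
        fun h' => h ⟨h'.1, h'.2.1, h'.2.2.1⟩
      simp only [h, h', if_false, pd_const]
  simp only [nablaRiem, hpd, christoffel_product hA]
  simp only [hR]
  obtain ⟨r, a⟩ := l
  obtain ⟨s, b⟩ := k
  obtain ⟨t, c⟩ := i
  obtain ⟨u, d⟩ := j
  obtain ⟨v, e⟩ := m
  by_cases h : r = s ∧ r = t ∧ r = u ∧ r = v
  · obtain ⟨rfl, rfl, rfl, rfl⟩ := h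
    have hr : r ≠ 1 - r := by omega
    have hr' : 1 - r ≠ r := by omega
    rw [sum_Ix hr]
    fin_cases a <;> fin_cases b <;> fin_cases c <;> fin_cases d <;> fin_cases e <;>
      simp [hr, hr'] <;> ring
  · rw [if_neg h, Finset.sum_eq_zero]
    · simp
    · rintro ⟨w, f⟩ -
      dsimp only
      rw [ite_mul_ite_eq_zero, ite_mul_ite_eq_zero, ite_mul_ite_eq_zero, ite_mul_ite_eq_zero]
      · simp
      all_goals omega

end

/-! ### The momentum coordinate of the quartic profile -/

section
open Filter Set

/-- A function with positive derivative given by a smooth positive function, mapping an open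
interval onto the real line, has a smooth inverse. -/
lemma exists_smooth_inverse {S S' : ℝ → ℝ} {c d : ℝ} (hcd : c < d)
    (hS : ∀ t ∈ Ioo c d, HasDerivAt S (S' t) t) (hpos : ∀ t ∈ Ioo c d, 0 < S' t)
    (hsmooth : ∀ t ∈ Ioo c d, ContDiffAt ℝ ∞ S' t)
    (hbot : Tendsto S (𝓝[>] c) atBot) (htop : Tendsto S (𝓝[<] d) atTop) :
    ∃ T : ℝ → ℝ, ContDiff ℝ ∞ T ∧ (∀ s, T s ∈ Ioo c d) ∧ (∀ s, S (T s) = s) ∧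
      (∀ t ∈ Ioo c d, T (S t) = t) ∧ ∀ s, HasDerivAt T (S' (T s))⁻¹ s := by
  have hcont : ContinuousOn S (Ioo c d) := fun t ht => (hS t ht).continuousAt.continuousWithinAt
  have hmono : StrictMonoOn S (Ioo c d) := by
    refine strictMonoOn_of_deriv_pos (convex_Ioo c d) hcont fun t ht => ?_
    rw [interior_Ioo] at ht
    rw [(hS t ht).deriv]
    exact hpos t ht
  have hsurj : ∀ s, ∃ t ∈ Ioo c d, S t = s := by
    intro s
    obtain ⟨t₁, h₁, h₁'⟩ := ((hbot.eventually (eventually_le_atBot s)).and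
      (Ioo_mem_nhdsGT hcd)).exists
    obtain ⟨t₂, h₂, h₂'⟩ := ((htop.eventually (eventually_ge_atTop s)).and
      (Ioo_mem_nhdsLT hcd)).exists
    exact isPreconnected_Ioo.intermediate_value h₁' h₂' hcont ⟨h₁, h₂⟩
  let f : Ioo c d → ℝ := fun t => S t
  have hf : StrictMono f := fun x y hxy => hmono x.2 y.2 hxy
  have hfs : Function.Surjective f := fun s => by
    obtain ⟨t, ht, h⟩ := hsurj s
    exact ⟨⟨t, ht⟩, h⟩
  let e := hf.orderIsoOfSurjective f hfs
  let T : ℝ → ℝ := fun s => (e.symm s).1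
  have hST : ∀ s, S (T s) = s := fun s => e.apply_symm_apply s
  have hmem : ∀ s, T s ∈ Ioo c d := fun s => (e.symm s).2
  have hTcont : Continuous T := continuous_subtype_val.comp e.symm.continuous
  have hder : ∀ s, HasDerivAt T (S' (T s))⁻¹ s := fun s =>
    HasDerivAt.of_local_left_inverse hTcont.continuousAt (hS _ (hmem s)) (hpos _ (hmem s)).ne'
      (Eventually.of_forall hST)
  refine ⟨T, ?_, hmem, hST, fun t ht => hmono.injOn (hmem _) ht (hST _), hder⟩
  have hderiv : deriv T = fun s => (S' (T s))⁻¹ := funext fun s => (hder s).deriv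
  rw [contDiff_infty]
  intro n
  induction n with
  | zero => exact contDiff_zero.2 hTcont
  | succ n ih =>
    rw [show ((n + 1 : ℕ) : WithTop ℕ∞) = (n : WithTop ℕ∞) + 1 by simp, contDiff_succ_iff_deriv]
    refine ⟨fun s => (hder s).differentiableAt, by simp, ?_⟩
    rw [hderiv]
    refine contDiff_iff_contDiffAt.2 fun s => ?_
    have h1 : ContDiffAt ℝ n S' (T s) := (hsmooth _ (hmem s)).of_le (by exact_mod_cast le_top)
    exact (h1.comp s ih.contDiffAt).inv (hpos _ (hmem s)).ne'

/-- The momentum coordinate of the metric with the quartic profile, as a function of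
`s = |z|²`: a solution of `s dT/ds = Ψ(T) / 2`, regular at the pole `s = 0`, and symmetric under
the exchange of the two poles. -/
structure IsProfile (a b : ℝ) (T : ℝ → ℝ) : Prop where
  smooth : ContDiff ℝ ∞ T
  deriv_pos : ∀ s, 0 < deriv T s
  ode : ∀ s, s * deriv T s = Psi a b (T s) / 2
  zero : T 0 = a
  lt : ∀ s, T s < b
  inv : ∀ s, 0 < s → T s⁻¹ = a + b - T s

/-- Separation of variables: the profile is the inverse function of
`S(t) = (t - a) / (b - t) * ((r₊ - t) / (t - r₋)) ^ κ`, where `r₋ < 0 < a < b < r₊` are the other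
two roots of the quartic. -/
lemma exists_isProfile {a b : ℝ} (ha : 0 < a) (hab : a < b) : ∃ T, IsProfile a b T := by
  have hb : 0 < b := ha.trans hab
  obtain ⟨δ, hδ, hδ2⟩ : ∃ δ : ℝ, 0 < δ ∧ δ ^ 2 = (a + b) ^ 2 + 4 * a * b :=
    ⟨Real.sqrt ((a + b) ^ 2 + 4 * a * b), Real.sqrt_pos.2 (by positivity),
      Real.sq_sqrt (by positivity)⟩
  have hδ' : a + b < δ := by nlinarith [mul_pos ha hb]
  set c : ℝ := (a + b - δ) / 2 with hc
  set d : ℝ := (a + b + δ) / 2 with hd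
  have hca : c < a := by rw [hc]; linarith
  have hbd : b < d := by rw [hd]; linarith
  set κ : ℝ := (b - a) / δ with hκ
  have hκ0 : 0 < κ := div_pos (by linarith) hδ
  let e : ℝ → ℝ := fun t => Real.exp (κ * (Real.log (d - t) - Real.log (t - c)))
  let S : ℝ → ℝ := fun t => (t - a) / (b - t) * e t
  let S' : ℝ → ℝ := fun t => e t * (b - a) * (2 * a * b) /
    ((b - t) ^ 2 * ((d - t) * (t - c)))
  have hfac : ∀ t, (d - t) * (t - c) = 2 * (a * b) + (t - a) * (b - t) := fun t => by
    rw [hc, hd]; linear_combination (1 / 4) * hδ2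
  have hSder : ∀ t ∈ Ioo c b, HasDerivAt S (S' t) t := by
    intro t ht
    have h1 : d - t ≠ 0 := by linarith [ht.2]
    have h2 : t - c ≠ 0 := by linarith [ht.1]
    have h3 : b - t ≠ 0 := by linarith [ht.2]
    have de : HasDerivAt e (e t * (κ * (-1 / (d - t) - 1 / (t - c)))) t :=
      (((((hasDerivAt_id t).const_sub d).log h1).sub
        (((hasDerivAt_id t).sub_const c).log h2)).const_mul κ).exp
    have dq : HasDerivAt (fun t => (t - a) / (b - t))
        ((1 * (b - t) - (t - a) * (-1)) / (b - t) ^ 2) t :=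
      ((hasDerivAt_id t).sub_const a).div ((hasDerivAt_id t).const_sub b) h3
    refine (dq.mul de).congr_deriv ?_
    symm
    have hκδ : κ * (d - c) = b - a := by
      rw [hκ, hc, hd]; field_simp; ring
    have h4 : -1 / (d - t) - 1 / (t - c) = - (d - c) / ((d - t) * (t - c)) := by
      field_simp; ring
    have h5 : κ * (-(d - c) / ((d - t) * (t - c))) = -(b - a) / ((d - t) * (t - c)) := by
      rw [← hκδ]; ring
    have hf := hfac t
    change e t * (b - a) * (2 * a * b) / ((b - t) ^ 2 * ((d - t) * (t - c))) =
      (1 * (b - t) - (t - a) * (-1)) / (b - t) ^ 2 * e t +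
        (t - a) / (b - t) * (e t * (κ * (-1 / (d - t) - 1 / (t - c))))
    rw [h4, h5]
    field_simp
    linear_combination (e t * (b - a)) * (-hf)
  have hSpos : ∀ t ∈ Ioo c b, 0 < S' t := by
    intro t ht
    have h1 : 0 < d - t := by linarith [ht.2]
    have h2 : 0 < t - c := by linarith [ht.1]
    have h3 : 0 < b - t := by linarith [ht.2]
    have h4 : 0 < b - a := by linarith
    have h5 : 0 < e t := Real.exp_pos _
    positivity
  have hSsmooth : ∀ t ∈ Ioo c b, ContDiffAt ℝ ∞ S' t := by
    intro t ht
    have h1 : d - t ≠ 0 := by linarith [ht.2]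
    have h2 : t - c ≠ 0 := by linarith [ht.1]
    have h3 : b - t ≠ 0 := by linarith [ht.2]
    have he : ContDiffAt ℝ ∞ e t := by
      refine ContDiffAt.exp (contDiffAt_const.mul (ContDiffAt.sub ?_ ?_))
      · exact ContDiffAt.log (by fun_prop) h1
      · exact ContDiffAt.log (by fun_prop) h2
    refine ContDiffAt.div ((he.mul contDiffAt_const).mul contDiffAt_const) (by fun_prop) ?_
    positivity
  have hce : ∀ t, t ≠ d → t ≠ c → ContinuousAt e t := by
    intro t h1 h2
    refine Real.continuous_exp.continuousAt.comp (continuousAt_const.mul (ContinuousAt.sub ?_ ?_))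
    · exact ContinuousAt.log (by fun_prop) (sub_ne_zero.2 (Ne.symm h1))
    · exact ContinuousAt.log (by fun_prop) (sub_ne_zero.2 h2)
  have htop : Tendsto S (𝓝[<] b) atTop := by
    have h1 : Tendsto (fun t => (b - t)⁻¹) (𝓝[<] b) atTop := by
      refine tendsto_inv_nhdsGT_zero.comp (tendsto_nhdsWithin_iff.2 ⟨?_, ?_⟩)
      · have : ContinuousAt (fun t => b - t) b := by fun_prop
        simpa using this.tendsto.mono_left nhdsWithin_le_nhds
      · filter_upwards [self_mem_nhdsWithin] with t ht
        exact sub_pos.2 (by simpa using ht)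
    have h2 : Tendsto (fun t => (t - a) * e t) (𝓝[<] b) (𝓝 ((b - a) * e b)) := by
      have : ContinuousAt (fun t => (t - a) * e t) b :=
        ContinuousAt.mul (by fun_prop) (hce b hbd.ne (hca.trans hab).ne')
      exact this.tendsto.mono_left nhdsWithin_le_nhds
    refine (h1.atTop_mul_pos (mul_pos (by linarith) (Real.exp_pos _)) h2).congr fun t => ?_
    simp only [S]; ring
  have hbot : Tendsto S (𝓝[>] c) atBot := by
    have h1 : Tendsto (fun t => Real.log (t - c)) (𝓝[>] c) atBot := by
      refine Real.tendsto_log_nhdsGT_zero.comp (tendsto_nhdsWithin_iff.2 ⟨?_, ?_⟩)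
      · have : ContinuousAt (fun t => t - c) c := by fun_prop
        simpa using this.tendsto.mono_left nhdsWithin_le_nhds
      · filter_upwards [self_mem_nhdsWithin] with t ht
        exact sub_pos.2 (by simpa using ht)
    have h2 : Tendsto (fun t => Real.log (d - t)) (𝓝[>] c) (𝓝 (Real.log (d - c))) := by
      have : ContinuousAt (fun t => Real.log (d - t)) c :=
        ContinuousAt.log (by fun_prop) (by linarith)
      exact this.tendsto.mono_left nhdsWithin_le_nhds
    have h3 : Tendsto (fun t => Real.log (d - t) - Real.log (t - c)) (𝓝[>] c) atTop := by
      simpa [sub_eq_add_neg] using h2.add_atTop (tendsto_neg_atBot_atTop.comp h1)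
    have h4 : Tendsto e (𝓝[>] c) atTop :=
      Real.tendsto_exp_atTop.comp (h3.const_mul_atTop hκ0)
    have h5 : Tendsto (fun t => (t - a) / (b - t)) (𝓝[>] c) (𝓝 ((c - a) / (b - c))) := by
      have : ContinuousAt (fun t => (t - a) / (b - t)) c :=
        ContinuousAt.div (by fun_prop) (by fun_prop) (by linarith)
      exact this.tendsto.mono_left nhdsWithin_le_nhds
    exact h5.neg_mul_atTop (div_neg_of_neg_of_pos (by linarith) (by linarith)) h4
  obtain ⟨T, hT, hmem, hST, hTS, hder⟩ :=
    exists_smooth_inverse (hca.trans hab) hSder hSpos hSsmooth hbot htop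
  have hT0 : T 0 = a := by
    have : S a = 0 := by simp [S]
    rw [← this, hTS a ⟨hca, hab⟩]
  have hdpos : ∀ s, 0 < deriv T s := fun s => by
    rw [(hder s).deriv]; exact inv_pos.2 (hSpos _ (hmem s))
  have hmono : StrictMono T := strictMono_of_deriv_pos hdpos
  refine ⟨T, hT, hdpos, fun s => ?_, hT0, fun s => (hmem s).2, fun s hs => ?_⟩
  · have ht := hmem s
    have h1 : d - T s ≠ 0 := by linarith [ht.2]
    have h2 : T s - c ≠ 0 := by linarith [ht.1]
    have h3 : b - T s ≠ 0 := by linarith [ht.2]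
    have h4 : b - a ≠ 0 := by linarith
    have h4' : a - b ≠ 0 := by linarith
    have h5 : e (T s) ≠ 0 := (Real.exp_pos _).ne'
    have hf := hfac (T s)
    rw [(hder s).deriv, inv_eq_one_div, mul_one_div, div_eq_iff (hSpos _ ht).ne']
    conv_lhs => rw [← hST s]
    simp only [S, S', Psi]
    rw [hf]
    have h6 : 2 * (a * b) + (T s - a) * (b - T s) ≠ 0 := by rw [← hf]; exact mul_ne_zero h1 h2
    have h7 : 2 - (T s - a) * (T s - b) / (a * b) =
        (2 * (a * b) + (T s - a) * (b - T s)) / (a * b) := by field_simp; ring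
    rw [h7]
    generalize 2 * (a * b) + (T s - a) * (b - T s) = X at h6
    field_simp
    ring
  · have ht := hmem s
    have hta : a < T s := by rw [← hT0]; exact hmono hs
    have h1 : d - T s ≠ 0 := by linarith [ht.2]
    have h2 : T s - c ≠ 0 := by linarith [ht.1]
    have h3 : b - T s ≠ 0 := by linarith [ht.2]
    have h4 : T s - a ≠ 0 := by linarith
    have hS : S (a + b - T s) = s⁻¹ := by
      have h5 : e (a + b - T s) = (e (T s))⁻¹ := by
        simp only [e]
        rw [← Real.exp_neg]
        have e1 : d - (a + b - T s) = T s - c := by rw [hc, hd]; ring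
        have e2 : a + b - T s - c = d - T s := by rw [hc, hd]; ring
        rw [e1, e2]; ring_nf
      conv_rhs => rw [← hST s]
      simp only [S, h5]
      have e3 : a + b - T s - a = b - T s := by ring
      have e4 : b - (a + b - T s) = T s - a := by ring
      rw [e3, e4, mul_inv, inv_div]
    rw [← hS, hTS]
    exact ⟨by linarith [ht.2], by linarith⟩

namespace IsProfile
variable {a b : ℝ} {T : ℝ → ℝ} (hT : IsProfile a b T)
include hT

lemma strictMono : StrictMono T := strictMono_of_deriv_pos hT.deriv_pos

lemma le {s : ℝ} (hs : 0 ≤ s) : a ≤ T s := by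
  rw [← hT.zero]; exact hT.strictMono.monotone hs

lemma hasDerivAt (s : ℝ) : HasDerivAt T (deriv T s) s :=
  (hT.smooth.differentiable (by simp) s).hasDerivAt

lemma tendsto : Tendsto T atTop (𝓝 b) := by
  have h1 : Tendsto (fun s => a + b - T s⁻¹) atTop (𝓝 (a + b - T 0)) :=
    ((hT.smooth.continuous.tendsto 0).comp tendsto_inv_atTop_zero).const_sub _
  rw [hT.zero, add_sub_cancel_left] at h1
  refine h1.congr' ?_
  filter_upwards [eventually_gt_atTop 0] with s hs
  rw [hT.inv s hs]; ring

/-- The derivatives of the profile at reciprocal points. -/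
lemma deriv_inv {s : ℝ} (hs : 0 < s) : deriv T s⁻¹ = s ^ 2 * deriv T s := by
  have h1 : HasDerivAt (fun s => T s⁻¹) (deriv T s⁻¹ * (-(s ^ 2)⁻¹)) s :=
    (hT.hasDerivAt _).comp s (hasDerivAt_inv hs.ne')
  have h2 : HasDerivAt (fun s => T s⁻¹) (-deriv T s) s := by
    refine ((hT.hasDerivAt s).const_sub (a + b)).congr_of_eventuallyEq ?_
    filter_upwards [eventually_gt_nhds hs] with u hu
    exact hT.inv u hu
  have h3 : deriv T s⁻¹ * (s ^ 2)⁻¹ = deriv T s := by linarith [h1.unique h2]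
  rw [← h3]
  field_simp

end IsProfile
end

/-! ### The Hodge star on 2-forms -/

lemma eps_swap_right (i j k l : Ix) : eps i j l k = -eps i j k l := by
  have e : (Matrix.of fun r s : Fin 4 =>
      if ![i, j, l, k] r = ![((0, 0) : Ix), (0, 1), (1, 0), (1, 1)] s then (1 : ℝ) else 0) =
      (Matrix.of fun r s : Fin 4 =>
      if ![i, j, k, l] r = ![((0, 0) : Ix), (0, 1), (1, 0), (1, 1)] s then (1 : ℝ)
        else 0).submatrix (Equiv.swap (2 : Fin 4) 3) id := by
    ext r s
    fin_cases r <;> rfl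
  rw [eps, e, Matrix.det_permute, eps]
  simp

lemma eps_swap_left (i j k l : Ix) : eps j i k l = -eps i j k l := by
  have e : (Matrix.of fun r s : Fin 4 =>
      if ![j, i, k, l] r = ![((0, 0) : Ix), (0, 1), (1, 0), (1, 1)] s then (1 : ℝ) else 0) =
      (Matrix.of fun r s : Fin 4 =>
      if ![i, j, k, l] r = ![((0, 0) : Ix), (0, 1), (1, 0), (1, 1)] s then (1 : ℝ)
        else 0).submatrix (Equiv.swap (0 : Fin 4) 1) id := by
    ext r s
    fin_cases r <;> rfl
  rw [eps, e, Matrix.det_permute, eps]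
  simp

lemma eps_eq_zero {i j k l : Ix} (h : i = k ∨ i = l ∨ j = k ∨ j = l ∨ i = j) :
    eps i j k l = 0 := by
  unfold eps
  rcases h with rfl | rfl | rfl | rfl | rfl
  · exact Matrix.det_zero_of_row_eq (i := 0) (j := 2) (by decide) rfl
  · exact Matrix.det_zero_of_row_eq (i := 0) (j := 3) (by decide) rfl
  · exact Matrix.det_zero_of_row_eq (i := 1) (j := 2) (by decide) rfl
  · exact Matrix.det_zero_of_row_eq (i := 1) (j := 3) (by decide) rfl
  · exact Matrix.det_zero_of_row_eq (i := 0) (j := 1) (by decide) rfl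

lemma eps_values : eps (1, 0) (1, 1) (0, 0) (0, 1) = 1 ∧ eps (0, 0) (0, 1) (1, 0) (1, 1) = 1 ∧
    eps (0, 1) (1, 1) (0, 0) (1, 0) = -1 ∧ eps (0, 1) (1, 0) (0, 0) (1, 1) = 1 ∧
    eps (0, 0) (1, 1) (0, 1) (1, 0) = 1 ∧ eps (0, 0) (1, 0) (0, 1) (1, 1) = -1 := by
  refine ⟨?_, ?_, ?_, ?_, ?_, ?_⟩ <;>
    simp [eps, Matrix.det_succ_row_zero, Fin.sum_univ_succ, Fin.succAbove]

/-- The contraction of an antisymmetric tensor with the Levi-Civita symbol. -/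
lemma sum_eps {X : Matrix Ix Ix ℝ} (hX : Xᵀ = -X) {a b : Ix} {k l : Ix} {r : ℝ}
    (hab : a ≠ b) (hr : eps a b k l = r)
    (h : ∀ i j, i ≠ j → ¬ (i = a ∧ j = b) → ¬ (i = b ∧ j = a) → i = k ∨ i = l ∨ j = k ∨ j = l) :
    ∑ i, ∑ j, X i j * eps i j k l = 2 * r * X a b := by
  have hX' : X b a = -X a b := congrFun₂ hX a b
  have e : ∀ i j, X i j * eps i j k l = (if i = a ∧ j = b then r * X a b else 0) +
      if i = b ∧ j = a then r * X a b else 0 := by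
    intro i j
    by_cases h1 : i = a ∧ j = b
    · obtain ⟨rfl, rfl⟩ := h1
      simp [hab, hr, mul_comm]
    · by_cases h2 : i = b ∧ j = a
      · obtain ⟨rfl, rfl⟩ := h2
        simp [hab, eps_swap_left j i, hr, hX', mul_comm]
      · have : eps i j k l = 0 := by
          apply eps_eq_zero
          by_cases hij : i = j
          · simp [hij]
          · rcases h i j hij h1 h2 with h | h | h | h <;> simp [h]
        simp [h1, h2, this]
  simp only [e, Finset.sum_add_distrib, ite_and, Finset.sum_ite_irrel,
    Finset.sum_ite_eq', Finset.mem_univ, if_true, Finset.sum_const_zero]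
  ring

/-- The Hodge star of a Euclidean metric. -/
def starMat (G F : Matrix Ix Ix ℝ) : Matrix Ix Ix ℝ := Matrix.of fun i j =>
  (1 / 2) * Real.sqrt G.det * ∑ k, ∑ l, (G⁻¹ * F * (G⁻¹)ᵀ) k l * eps k l i j

lemma hodgeStar_apply (g F : Tensor2) (c : Chart) (x : V) :
    hodgeStar g F c x = starMat (g c x) (F c x) := rfl

lemma starMat_transpose (G F : Matrix Ix Ix ℝ) : (starMat G F)ᵀ = -starMat G F := by
  ext i j
  simp only [starMat, Matrix.transpose_apply, Matrix.neg_apply, Matrix.of_apply,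
    eps_swap_right _ _ i j, mul_neg, Finset.sum_neg_distrib]

lemma det_bdiag {p q : Fin 2} (hpq : p ≠ q) (w : Fin 2 → ℝ) : (bdiag w).det = (w p * w q) ^ 2 := by
  rw [bdiag, Matrix.det_diagonal, Fintype.prod_prod_type]
  fin_cases p <;> fin_cases q <;> simp at hpq <;> simp [Fin.prod_univ_two] <;> ring

lemma starMat_bdiag {w : Fin 2 → ℝ} (hw : ∀ r, 0 < w r) {F : Matrix Ix Ix ℝ} (hF : Fᵀ = -F)
    {p q : Fin 2} (hpq : p ≠ q) :
    starMat (bdiag w) F (p, 0) (p, 1) = w p / w q * F (q, 0) (q, 1) ∧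
    starMat (bdiag w) F (p, 0) (q, 0) = -F (p, 1) (q, 1) ∧
    starMat (bdiag w) F (p, 0) (q, 1) = F (p, 1) (q, 0) ∧
    starMat (bdiag w) F (p, 1) (q, 0) = F (p, 0) (q, 1) ∧
    starMat (bdiag w) F (p, 1) (q, 1) = -F (p, 0) (q, 0) := by
  obtain ⟨v1, v2, v3, v4, v5, v6⟩ := eps_values
  have hX : ((bdiag w)⁻¹ * F * ((bdiag w)⁻¹)ᵀ)ᵀ = -((bdiag w)⁻¹ * F * ((bdiag w)⁻¹)ᵀ) := by
    simp only [Matrix.transpose_mul, Matrix.transpose_transpose, hF, Matrix.mul_neg,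
      Matrix.neg_mul, Matrix.mul_assoc]
  have hXa : ∀ k l, ((bdiag w)⁻¹ * F * ((bdiag w)⁻¹)ᵀ) k l = (w k.1)⁻¹ * F k l * (w l.1)⁻¹ := by
    intro k l
    rw [bdiag_inv fun r => (hw r).ne', bdiag, Matrix.diagonal_transpose, Matrix.mul_diagonal,
      Matrix.diagonal_mul]
  have hd : Real.sqrt (bdiag w).det = w p * w q := by
    rw [det_bdiag hpq, Real.sqrt_sq (mul_pos (hw p) (hw q)).le]
  have hp := (hw p).ne'
  have hq := (hw q).ne'
  have hFs : ∀ i j, F j i = -F i j := fun i j => congrFun₂ hF i j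
  have v3' : eps (0, 1) (1, 1) (1, 0) (0, 0) = 1 := by rw [eps_swap_right, v3, neg_neg]
  have v4' : eps (0, 1) (1, 0) (1, 1) (0, 0) = -1 := by rw [eps_swap_right, v4]
  have v5' : eps (0, 0) (1, 1) (1, 0) (0, 1) = -1 := by rw [eps_swap_right, v5]
  have v6' : eps (0, 0) (1, 0) (1, 1) (0, 1) = 1 := by rw [eps_swap_right, v6, neg_neg]
  simp only [starMat, Matrix.of_apply, hd]
  have hcases : (p = 0 ∧ q = 1) ∨ (p = 1 ∧ q = 0) := by omega
  rcases hcases with ⟨rfl, rfl⟩ | ⟨rfl, rfl⟩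
  · rw [sum_eps hX (by decide) v1 (by decide), sum_eps hX (by decide) v3 (by decide),
      sum_eps hX (by decide) v4 (by decide), sum_eps hX (by decide) v5 (by decide),
      sum_eps hX (by decide) v6 (by decide)]
    simp only [hXa]
    refine ⟨?_, ?_, ?_, ?_, ?_⟩ <;> field_simp
  · rw [sum_eps hX (by decide) v2 (by decide), sum_eps hX (by decide) v3' (by decide),
      sum_eps hX (by decide) v5' (by decide), sum_eps hX (by decide) v4' (by decide),
      sum_eps hX (by decide) v6' (by decide)]
    simp only [hXa]
    rw [hFs (0, 1) (1, 1), hFs (0, 0) (1, 1), hFs (0, 1) (1, 0), hFs (0, 0) (1, 0)]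
    refine ⟨?_, ?_, ?_, ?_, ?_⟩ <;> field_simp

/-! ### The algebra of the Einstein-Maxwell equations -/

lemma antisymm_ext {A B : Matrix Ix Ix ℝ} (hA : Aᵀ = -A) (hB : Bᵀ = -B) {p q : Fin 2}
    (hpq : p ≠ q) (h1 : A (p, 0) (p, 1) = B (p, 0) (p, 1)) (h2 : A (q, 0) (q, 1) = B (q, 0) (q, 1))
    (h3 : ∀ a b, A (p, a) (q, b) = B (p, a) (q, b)) : A = B := by
  have hA' : ∀ i j, A i j = -A j i := fun i j => congrFun₂ hA j i
  have hB' : ∀ i j, B i j = -B j i := fun i j => congrFun₂ hB j i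
  have hA0 : ∀ i, A i i = 0 := fun i => by linarith [hA' i i]
  have hB0 : ∀ i, B i i = 0 := fun i => by linarith [hB' i i]
  have h1' : A (p, 1) (p, 0) = B (p, 1) (p, 0) := by rw [hA', hB', h1]
  have h2' : A (q, 1) (q, 0) = B (q, 1) (q, 0) := by rw [hA', hB', h2]
  ext ⟨r, a⟩ ⟨s, b⟩
  rcases eq_or_eq_of_ne hpq r with rfl | rfl <;> rcases eq_or_eq_of_ne hpq s with rfl | rfl
  · fin_cases a <;> fin_cases b <;> simp [hA0, hB0, h1, h1']
  · exact h3 a b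
  · rw [hA', hB', h3]
  · fin_cases a <;> fin_cases b <;> simp [hA0, hB0, h2, h2']

lemma bform_transpose (u : Fin 2 → ℝ) : (bform u)ᵀ = -bform u := by
  ext ⟨p, a⟩ ⟨q, b⟩
  simp only [Matrix.transpose_apply, Matrix.neg_apply, bform_apply]
  by_cases h : p = q
  · subst h; fin_cases a <;> fin_cases b <;> simp
  · simp [h, Ne.symm h]

lemma starMat_bform {w : Fin 2 → ℝ} (hw : ∀ r, 0 < w r) {p q : Fin 2} (hpq : p ≠ q) {φ : ℝ}
    {α β : Fin 2 → ℝ} (h1 : α p = β q) (h2 : α q = β p) :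
    starMat (bdiag w) (bform fun r => α r * (φ * w r)) = bform fun r => β r * (φ * w r) := by
  have hp := (hw p).ne'
  have hq := (hw q).ne'
  obtain ⟨e1, e2, e3, e4, e5⟩ :=
    starMat_bdiag hw (bform_transpose fun r => α r * (φ * w r)) hpq
  obtain ⟨e1', -, -, -, -⟩ :=
    starMat_bdiag hw (bform_transpose fun r => α r * (φ * w r)) hpq.symm
  refine antisymm_ext (starMat_transpose _ _) (bform_transpose _) hpq ?_ ?_ ?_
  · rw [e1]; simp only [bform_apply]; simp only [h2]; simp; field_simp
  · rw [e1']; simp only [bform_apply]; simp only [h1]; simp; field_simp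
  · intro a b
    fin_cases a <;> fin_cases b <;> simp [e2, e3, e4, e5, bform_apply, hpq]

lemma bform_compose {w : Fin 2 → ℝ} (hw : ∀ r, 0 < w r) (φ : ℝ) (α : Fin 2 → ℝ) :
    (bform fun r => α r * (φ * w r)) * (bdiag w)⁻¹ * (bform fun r => α r * (φ * w r)) =
      bdiag fun r => -(α r * φ) ^ 2 * w r := by
  have h0 := (hw 0).ne'
  have h1 := (hw 1).ne'
  rw [bdiag_inv fun r => (hw r).ne']
  ext ⟨r, a⟩ ⟨s, b⟩
  simp only [Matrix.mul_apply, bform_apply, bdiag_apply, Fintype.sum_prod_type, Fin.sum_univ_two]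
  fin_cases r <;> fin_cases s <;> fin_cases a <;> fin_cases b <;> simp <;> field_simp

lemma trG_bdiag {w : Fin 2 → ℝ} (hw : ∀ r, 0 < w r) {p q : Fin 2} (hpq : p ≠ q) (ρ : Fin 2 → ℝ) :
    trG (bdiag w) (bdiag fun r => ρ r * w r) = 2 * (ρ p + ρ q) := by
  have hp := (hw p).ne'
  have hq := (hw q).ne'
  simp only [trG, bdiag_inv fun r => (hw r).ne', bdiag_apply, ite_mul, zero_mul,
    Finset.sum_ite_eq, Finset.mem_univ, if_true, mul_ite, mul_zero]
  rw [sum_Ix hpq]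
  field_simp
  ring

/-- The trace-free energy equation holds for constant multiples of the area forms whose squares
compensate the difference of the two eigenvalues of the Ricci tensor. -/
lemma energy_bform {w : Fin 2 → ℝ} (hw : ∀ r, 0 < w r) {p q : Fin 2} (hpq : p ≠ q) {φ : ℝ}
    {α ρ : Fin 2 → ℝ} (h : ρ p - (α p * φ) ^ 2 = ρ q - (α q * φ) ^ 2) :
    traceFree (bdiag w) ((bdiag fun r => ρ r * w r) +
      (bform fun r => α r * (φ * w r)) * (bdiag w)⁻¹ * (bform fun r => α r * (φ * w r))) = 0 := by
  have e : (bdiag fun r => ρ r * w r) + (bdiag fun r => -(α r * φ) ^ 2 * w r) =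
      bdiag fun r => (ρ p - (α p * φ) ^ 2) * w r := by
    ext k l
    simp only [Matrix.add_apply, bdiag_apply]
    split_ifs
    · rcases eq_or_eq_of_ne hpq k.1 with hk | hk <;> rw [hk]
      · ring
      · rw [h]; ring
    · simp
  rw [bform_compose hw, e, traceFree, trG_bdiag hw hpq]
  ext k l
  simp only [Matrix.sub_apply, Matrix.smul_apply, bdiag_apply, smul_eq_mul, Matrix.zero_apply]
  split_ifs <;> ring

/-- Uniqueness of the solution with given non-degenerate self-dual part: the anti-self-dual part
is determined by the trace-free Ricci tensor. -/
lemma eq_bform_of_energy {w : Fin 2 → ℝ} (hw : ∀ r, 0 < w r) {p q : Fin 2} (hpq : p ≠ q) {φ : ℝ}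
    (hφ : 0 < φ) {α ρ : Fin 2 → ℝ} (hα : α p + α q = 2)
    (h : ρ p - (α p * φ) ^ 2 = ρ q - (α q * φ) ^ 2) {F : Matrix Ix Ix ℝ} (hF : Fᵀ = -F)
    (hsd : (1 / 2 : ℝ) • (F + starMat (bdiag w) F) = bform fun r => φ * w r)
    (hen : traceFree (bdiag w) ((bdiag fun r => ρ r * w r) + F * (bdiag w)⁻¹ * F) = 0) :
    F = bform fun r => α r * (φ * w r) := by
  have hp := hw p
  have hq := hw q
  have hp' := hp.ne'
  have hq' := hq.ne'
  have hF' : ∀ i j, F i j = -F j i := fun i j => congrFun₂ hF j i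
  have hF0 : ∀ i, F i i = 0 := fun i => by linarith [hF' i i]
  obtain ⟨e1, e2, e3, e4, e5⟩ := starMat_bdiag hw hF hpq
  have hs := fun i j => congrFun₂ hsd i j
  simp only [Matrix.smul_apply, Matrix.add_apply, smul_eq_mul] at hs
  -- the self-dual part leaves three free components `y`, `b`, `c`
  have s1 := hs (p, 0) (p, 1)
  have s2 := hs (p, 0) (q, 0)
  have s3 := hs (p, 0) (q, 1)
  rw [e1, bform_apply] at s1
  rw [e2, bform_apply] at s2
  rw [e3, bform_apply] at s3
  simp only [hpq, if_true, if_false, and_self] at s1 s2 s3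
  obtain ⟨t, ht⟩ : ∃ t : ℝ, ∀ k l, traceFree (bdiag w) ((bdiag fun r => ρ r * w r) +
      F * (bdiag w)⁻¹ * F) k l = (if k = l then ρ k.1 * w k.1 else 0) +
      (∑ m, F k m * (w m.1)⁻¹ * F m l) - t * if k = l then w k.1 else 0 := by
    refine ⟨trG (bdiag w) ((bdiag fun r => ρ r * w r) + F * (bdiag w)⁻¹ * F) / 4, fun k l => ?_⟩
    simp only [traceFree, Matrix.sub_apply, Matrix.smul_apply, smul_eq_mul, Matrix.add_apply]
    rw [bdiag_apply, bdiag_apply w, bdiag_inv fun r => (hw r).ne', Matrix.mul_apply]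
    simp only [bdiag, Matrix.mul_diagonal]
  have hz : ∀ k l, (if k = l then ρ k.1 * w k.1 else 0) +
      (∑ m, F k m * (w m.1)⁻¹ * F m l) - t * (if k = l then w k.1 else 0) = 0 := fun k l => by
    rw [← ht, hen]; rfl
  generalize hy : F (p, 0) (p, 1) = y at s1
  generalize hy' : F (q, 0) (q, 1) = y' at s1
  generalize hb : F (p, 0) (q, 0) = b at s2
  generalize hb' : F (p, 1) (q, 1) = b' at s2
  generalize hc : F (p, 0) (q, 1) = c at s3
  generalize hc' : F (p, 1) (q, 0) = c' at s3
  have hbb : b' = b := by linarith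
  have hcc : c' = -c := by linarith
  subst hbb hcc
  have z1 := hz (p, 0) (q, 1)
  have z2 := hz (p, 0) (q, 0)
  have z3 := hz (p, 0) (p, 0)
  have z4 := hz (q, 0) (q, 0)
  rw [sum_Ix hpq] at z1 z2 z3 z4
  simp [hpq, hF0, hy, hy', hb, hb', hc, hc', hF' (p, 1) (p, 0), hF' (q, 1) (q, 0),
    hF' (q, 0) (p, 0), hF' (q, 0) (p, 1)] at z1 z2 z3 z4
  have hsum : y / w p + y' / w q = 2 * φ := by
    field_simp at s1 ⊢
    linarith
  have hb0 : b' = 0 := by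
    have : b' * (2 * φ) = 0 := by rw [← hsum]; linear_combination z1
    simpa [hφ.ne'] using this
  have hc0 : c = 0 := by
    have : c * (2 * φ) = 0 := by rw [← hsum]; linear_combination -z2
    simpa [hφ.ne'] using this
  subst hb0 hc0
  have hdiff : ρ p - (y / w p) ^ 2 = ρ q - (y' / w q) ^ 2 := by
    have a1 : ρ p - (y / w p) ^ 2 = t := by
      have : (ρ p - (y / w p) ^ 2 - t) * w p = ρ p * w p - y * (w p)⁻¹ * y - t * w p := by
        field_simp
      have := (mul_eq_zero.1 (this.trans (by linear_combination z3))).resolve_right hp'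
      linarith
    have a2 : ρ q - (y' / w q) ^ 2 = t := by
      have : (ρ q - (y' / w q) ^ 2 - t) * w q = ρ q * w q - y' * (w q)⁻¹ * y' - t * w q := by
        field_simp
      have := (mul_eq_zero.1 (this.trans (by linear_combination z4))).resolve_right hq'
      linarith
    rw [a1, a2]
  have hy2 : y' / w q = 2 * φ - y / w p := by linarith
  have hα2 : α q = 2 - α p := by linarith
  rw [hy2] at hdiff
  rw [hα2] at h
  have k1 : y / w p = α p * φ := by
    have : (4 * φ) * (y / w p - α p * φ) = 0 := by linear_combination h - hdiff
    have := (mul_eq_zero.1 this).resolve_left (by positivity)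
    linarith
  have k2 : y' / w q = α q * φ := by rw [hy2, k1, hα2]; ring
  refine antisymm_ext hF (bform_transpose _) hpq ?_ ?_ ?_
  · rw [hy, bform_apply]; simp; rw [← mul_assoc, ← k1]; field_simp
  · rw [hy', bform_apply]; simp; rw [← mul_assoc, ← k2]; field_simp
  · intro a b
    fin_cases a <;> fin_cases b <;> simp [bform_apply, hpq, hb, hb', hc, hc']

/-! ### Products of rotationally symmetric metrics -/

/-- The densities `e` for which `e(|z|²) |dz|²` is a smooth tensor on `CP₁`, given by the same
formula in both affine coordinates. -/
structure IsDensity (e : ℝ → ℝ) : Prop where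
  smooth : ∀ s, 0 ≤ s → ContDiffAt ℝ ∞ e s
  inv : ∀ s, 0 < s → e s⁻¹ = s ^ 2 * e s

lemma IsDensity.const_mul {e : ℝ → ℝ} (he : IsDensity e) (α : ℝ) :
    IsDensity fun s => α * e s where
  smooth s hs := contDiffAt_const.mul (he.smooth s hs)
  inv s hs := by rw [he.inv s hs]; ring

/-- The tensor `∑ e_r(|z_r|²) |dz_r|²`. -/
def radial (e : Fin 2 → ℝ → ℝ) : Tensor2 := fun _ x => bdiag fun r => e r (nsq r x)

section
variable {e : Fin 2 → ℝ → ℝ} (he : ∀ r, IsDensity (e r))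
include he

lemma isTensorField_radial : IsTensorField (radial e) := by
  refine ⟨fun c i j => ?_, isPullback_id_iff.2 fun c c' x x' h => ?_⟩
  · simp only [radial, bdiag_apply]
    split_ifs
    · exact contDiff_radial (he _).smooth _
    · exact contDiff_const
  · simp only [radial]
    rw [bdiag_pullback]
    congr 1
    funext r
    rw [norm_dz_sq, ← norm_zc_sq r x', zc_of_par_eq h]
    by_cases hr : c r = c' r
    · simp [hr, norm_zc_sq]
    · have h0 : 0 < nsq r x := lt_of_le_of_ne (nsq_nonneg r x)
        fun h1 => zc_ne_zero_of_par_eq h hr (nsq_eq_zero_iff.1 h1.symm)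
      have h4 : ‖zc r x‖ ^ 4 = nsq r x ^ 2 := by rw [← norm_zc_sq]; ring
      simp only [hr, if_false, norm_inv, inv_pow, norm_zc_sq, h4]
      rw [(he r).inv _ h0]
      field_simp

lemma isMetric_radial (hpos : ∀ r s, 0 ≤ s → 0 < e r s) : IsMetric (radial e) :=
  ⟨isTensorField_radial he, fun _ x => Matrix.PosDef.diagonal fun k => hpos _ _ (nsq_nonneg k.1 x)⟩

end

lemma IsTensorField.kahlerForm {T : Tensor2} (hT : IsTensorField T) :
    IsTensorField (kahlerForm T) := by
  refine ⟨fun c i j => ?_, isPullback_id_iff.2 fun c c' x x' h => ?_⟩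
  · simp only [EinsteinMaxwell.kahlerForm, Matrix.mul_apply]
    exact ContDiff.sum fun k _ => contDiff_const.mul (hT.1 c k j)
  · simp only [EinsteinMaxwell.kahlerForm]
    rw [blk_transpose_Jmat, isPullback_id_iff.1 hT.2 c c' x x' h]

lemma jInvariant_bdiag (u : Fin 2 → ℝ) : Jmatᵀ * bdiag u * Jmat = bdiag u := by
  rw [Jmat_eq_blk, bdiag_pullback]; simp

lemma jInvariant_bform (u : Fin 2 → ℝ) : Jmatᵀ * bform u * Jmat = bform u := by
  rw [Jmat_eq_blk, bform_pullback]; simp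

lemma kahlerForm_radial (e : Fin 2 → ℝ → ℝ) (c : Chart) (x : V) :
    kahlerForm (radial e) c x = bform fun r => e r (nsq r x) := rfl

lemma isTwoForm_radial {e : Fin 2 → ℝ → ℝ} (he : ∀ r, IsDensity (e r)) :
    IsTwoForm (kahlerForm (radial e)) :=
  ⟨(isTensorField_radial he).kahlerForm, fun _ _ => bform_transpose _⟩

lemma isClosedForm_radial {e : Fin 2 → ℝ → ℝ} (he : ∀ r s, 0 ≤ s → ContDiffAt ℝ ∞ (e r) s) :
    IsClosedForm (kahlerForm (radial e)) := by
  have h : ∀ (c : Chart) (i : Ix) (q b r d : Fin 2) (x : V),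
      pd i (fun y => kahlerForm (radial e) c y (q, b) (r, d)) x =
      if i.1 = q ∧ q = r then
        2 * x i * deriv (e q) (nsq q x) *
          (if b = 0 ∧ d = 1 then 1 else if b = 1 ∧ d = 0 then -1 else 0)
      else 0 := by
    intro c i q b r d x
    simp only [kahlerForm_radial, bform_apply]
    by_cases hqr : q = r
    · subst hqr
      have hr := pd_radial (he q) q i x
      fin_cases b <;> fin_cases d <;> simp [hr, pd_neg]; split_ifs <;> ring
    · simp [hqr]
  rintro c x ⟨p, a⟩ ⟨q, b⟩ ⟨r, d⟩
  rw [h, h, h]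
  by_cases hpq : p = q
  · by_cases hqr : q = r
    · subst hpq hqr
      fin_cases a <;> fin_cases b <;> (fin_cases d <;> simp)
    · simp [hpq, hqr, Ne.symm hqr]
  · simp only [hpq, false_and, if_false, zero_add]
    rw [if_neg fun h => hpq (h.1.trans h.2).symm]
    simp

lemma isKahler_radial {e : Fin 2 → ℝ → ℝ} (he : ∀ r, IsDensity (e r))
    (hpos : ∀ r s, 0 ≤ s → 0 < e r s) : IsKahler (radial e) where
  metric := isMetric_radial he hpos
  hermitian _ _ := jInvariant_bdiag _
  closed := isClosedForm_radial fun r => (he r).smooth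

/-! ### Conformal metrics -/

lemma isMetric_conformal {f : M → ℝ} {g : Tensor2} (hf : SmoothFun f) (h0 : ∀ m, 0 < f m)
    (hg : IsMetric g) : IsMetric (conformal f g) := by
  have hpos : ∀ m, 0 < ((f m) ^ 2)⁻¹ := fun m => inv_pos.2 (pow_pos (h0 m) 2)
  refine ⟨⟨fun c i j => ?_, isPullback_id_iff.2 fun c c' x x' h => ?_⟩, fun c x => ?_⟩
  · simp only [conformal, Matrix.smul_apply, smul_eq_mul]
    exact (((hf c).pow 2).inv fun y => (pow_pos (h0 _) 2).ne').mul (hg.1.1 c i j)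
  · simp only [conformal]
    rw [h, isPullback_id_iff.1 hg.1.2 c c' x x' h]
    simp
  · exact (hg.2 c x).smul (hpos _)

lemma conformal_radial (f : M → ℝ) (e : Fin 2 → ℝ → ℝ) (c : Chart) (x : V) :
    conformal f (radial e) c x =
      bdiag fun r => ((f (par c x)) ^ 2)⁻¹ * e r (nsq r x) := by
  ext k l
  simp only [conformal, radial, Matrix.smul_apply, bdiag_apply, smul_eq_mul]
  split_ifs <;> simp

/-- A rotationally symmetric product metric with a holomorphy potential `f` engenders a solution as
soon as the Ricci tensor of `h = f⁻² g` has, on the two factors, eigenvalues with constant sum and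
with difference `4 μ f⁴`: the 2-form is then `(1 + μ) ω_p + (1 - μ) ω_q`. -/
lemma engenders_radial {p q : Fin 2} (hpq : p ≠ q) {e : Fin 2 → ℝ → ℝ}
    (he : ∀ r, IsDensity (e r)) (hpos : ∀ r s, 0 ≤ s → 0 < e r s) {f : M → ℝ}
    (hf : IsHolomorphyPotential (radial e) f) (h0 : ∀ m, 0 < f m) {ρ : Fin 2 → Chart → V → ℝ}
    (hric : ∀ c x, ricci (conformal f (radial e) c) x =
      bdiag fun r => ρ r c x * (((f (par c x)) ^ 2)⁻¹ * e r (nsq r x)))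
    {σ μ : ℝ} (hsum : ∀ c x, ρ p c x + ρ q c x = σ)
    (hdiff : ∀ c x, ρ p c x - ρ q c x = 4 * μ * (f (par c x)) ^ 4) :
    Engenders (radial e) f := by
  let α : Fin 2 → ℝ := fun r => if r = p then 1 + μ else 1 - μ
  let β : Fin 2 → ℝ := fun r => if r = p then 1 - μ else 1 + μ
  have hαp : α p = 1 + μ := if_pos rfl
  have hαq : α q = 1 - μ := if_neg hpq.symm
  have hβp : β p = 1 - μ := if_pos rfl
  have hβq : β q = 1 + μ := if_neg hpq.symm
  have hφ : ∀ c x, 0 < (f (par c x)) ^ 2 := fun c x => pow_pos (h0 _) 2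
  have hw : ∀ c x r, 0 < ((f (par c x)) ^ 2)⁻¹ * e r (nsq r x) := fun c x r =>
    mul_pos (inv_pos.2 (hφ c x)) (hpos _ _ (nsq_nonneg r x))
  have hφw : ∀ c x r, (f (par c x)) ^ 2 * (((f (par c x)) ^ 2)⁻¹ * e r (nsq r x)) =
      e r (nsq r x) := fun c x r => mul_inv_cancel_left₀ (hφ c x).ne' _
  -- a 2-form with constant coefficients, written with respect to the metric `h`
  have hform : ∀ (γ : Fin 2 → ℝ) c x, kahlerForm (radial fun r s => γ r * e r s) c x =
      bform fun r => γ r * ((f (par c x)) ^ 2 * (((f (par c x)) ^ 2)⁻¹ * e r (nsq r x))) :=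
    fun γ c x => by simp only [kahlerForm_radial, hφw]
  have hmet : ∀ c x, conformal f (radial e) c x =
      bdiag fun r => ((f (par c x)) ^ 2)⁻¹ * e r (nsq r x) := conformal_radial f e
  have hstar : hodgeStar (conformal f (radial e)) (kahlerForm (radial fun r s => α r * e r s)) =
      kahlerForm (radial fun r s => β r * e r s) := by
    funext c x
    rw [hodgeStar_apply, hform, hform, hmet]
    exact starMat_bform (hw c x) hpq (by rw [hαp, hβq]) (by rw [hαq, hβp])
  have hen : ∀ c x, ρ p c x - (α p * (f (par c x)) ^ 2) ^ 2 =
      ρ q c x - (α q * (f (par c x)) ^ 2) ^ 2 := fun c x => by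
    rw [hαp, hαq]; linear_combination hdiff c x
  have hd : ∀ γ : Fin 2 → ℝ, ∀ r, IsDensity fun s => γ r * e r s := fun γ r => (he r).const_mul _
  refine ⟨isKahler_radial he hpos, hf, h0, ⟨2 * σ, fun c x => ?_⟩,
    kahlerForm (radial fun r s => α r * e r s), ⟨isMetric_conformal hf.1 h0 (isMetric_radial he hpos),
      isTwoForm_radial (hd α), isClosedForm_radial fun r => (hd α r).smooth, ?_, fun c x => ?_⟩,
    ?_, fun c x => ?_, fun c x => jInvariant_bform _, fun F' hF' hsd => ?_⟩
  · rw [scal, hric, hmet, trG_bdiag (hw c x) hpq, hsum]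
  · rw [hstar]
    exact isClosedForm_radial fun r => (hd β r).smooth
  · rw [composeForm, hric, hform, hmet]
    exact energy_bform (hw c x) hpq (hen c x)
  · funext c x
    rw [selfDualPart, hstar]
    ext ⟨r, a⟩ ⟨s, b⟩
    have hαβ : ∀ r, α r + β r = 2 := fun r => by
      rcases eq_or_eq_of_ne hpq r with rfl | rfl
      · rw [hαp, hβp]; ring
      · rw [hαq, hβq]; ring
    have h2 : β r = 2 - α r := by linarith [hαβ r]
    simp only [Matrix.smul_apply, Matrix.add_apply, kahlerForm_radial, bform_apply, smul_eq_mul, h2]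
    split_ifs <;> ring
  · rw [hmet, jInvariant_bdiag]
  · funext c x
    have hen' := hF'.energy c x
    rw [composeForm, hric, hmet] at hen'
    have hsd' := congrFun₂ hsd c x
    rw [selfDualPart, hodgeStar_apply, hmet, kahlerForm_radial] at hsd'
    rw [hform]
    refine eq_bform_of_energy (hw c x) hpq (hφ c x) (by rw [hαp, hαq]; ring) (hen c x)
      (hF'.form.2 c x) ?_ hen'
    rw [hsd']
    simp only [hφw]

/-! ### The Ricci endomorphism of a product -/

lemma ricciEnd_of_bdiag {G : V → Matrix Ix Ix ℝ} {x : V} {w ρ : Fin 2 → ℝ} (hw : ∀ r, w r ≠ 0)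
    (hG : G x = bdiag w) (hric : ricci G x = bdiag fun r => ρ r * w r) :
    ricciEnd G x = bdiag ρ := by
  rw [ricciEnd, hric, hG, bdiag_inv hw, bdiag, bdiag, Matrix.diagonal_mul_diagonal]
  congr 1
  funext k
  field_simp [hw k.1]

lemma trace_bdiag_pow {p q : Fin 2} (hpq : p ≠ q) (ρ : Fin 2 → ℝ) (n : ℕ) :
    (bdiag ρ ^ n).trace = 2 * (ρ p ^ n + ρ q ^ n) := by
  rw [bdiag, Matrix.diagonal_pow, Matrix.trace_diagonal, sum_Ix hpq]
  simp only [Pi.pow_apply]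
  ring

lemma contDiffAt_riem {G : V → Matrix Ix Ix ℝ} (hG : ∀ x, SmoothMatAt G x)
    (h0 : ∀ x, (G x).det ≠ 0) (l k i j : Ix) (x : V) : ContDiffAt ℝ ∞ (riem G l k i j) x := by
  have hc : ∀ l k i, ContDiffAt ℝ ∞ (christoffel G l i k) x := fun l k i =>
    smoothMatAt_conn (hG x) (h0 x) i l k
  unfold riem
  exact ((contDiffAt_pd (hc _ _ _)).sub (contDiffAt_pd (hc _ _ _))).add
    (ContDiffAt.sum fun m _ => ((hc _ _ _).mul (hc _ _ _)).sub ((hc _ _ _).mul (hc _ _ _)))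

/-- The Ricci tensor of a locally symmetric metric is parallel. -/
lemma pd_ricci_of_nablaRiem {G : V → Matrix Ix Ix ℝ} (hG : ∀ x, SmoothMatAt G x)
    (h0 : ∀ x, (G x).det ≠ 0) {x : V} (h : ∀ m l k i j, nablaRiem G m l k i j x = 0)
    (m k j : Ix) : pd m (fun y => ricci G y k j) x =
      ∑ n, (christoffel G n m k x * ricci G x n j + christoffel G n m j x * ricci G x k n) := by
  have hsum : ∑ i, nablaRiem G m i j i k x = 0 := Finset.sum_eq_zero fun i _ => h m i j i k
  simp only [nablaRiem, Finset.sum_add_distrib, Finset.sum_sub_distrib] at hsum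
  simp only [ricci, Matrix.of_apply, Finset.mul_sum, Finset.sum_add_distrib]
  rw [pd_sum fun i _ => (contDiffAt_riem hG h0 _ _ _ _ _).diffAt]
  have c1 : ∑ i, ∑ n, christoffel G i m n x * riem G n j i k x =
      ∑ i, ∑ n, christoffel G n m i x * riem G i j n k x := Finset.sum_comm
  have c2 : ∑ i, ∑ n, christoffel G n m j x * riem G i n i k x =
      ∑ n, ∑ i, christoffel G n m j x * riem G i n i k x := Finset.sum_comm
  have c3 : ∑ i, ∑ n, christoffel G n m k x * riem G i j i n x =
      ∑ n, ∑ i, christoffel G n m k x * riem G i j i n x := Finset.sum_comm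
  rw [c1, c2, c3] at hsum
  linarith

/-- The eigenvalues of the Ricci tensor of a locally symmetric metric are constant. -/
lemma pd_eigenvalue_of_nablaRiem {φ ρ : Fin 2 → V → ℝ} (hφ : ∀ r, ContDiff ℝ ∞ (φ r))
    (hρ : ∀ r, ContDiff ℝ ∞ (ρ r))
    (hric : ∀ x, ricci (expMetric φ) x = bdiag fun r => ρ r x * Real.exp (2 * φ r x)) {x : V}
    (h : ∀ m l k i j, nablaRiem (expMetric φ) m l k i j x = 0) (r : Fin 2) (m : Ix) :
    pd m (ρ r) x = 0 := by
  have hE : ∀ r, ContDiff ℝ ∞ fun x => Real.exp (2 * φ r x) := fun r =>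
    (contDiff_const.mul (hφ r)).exp
  have hG : ∀ x, SmoothMatAt (expMetric φ) x := fun x k l => by
    simp only [expMetric, bdiag_apply]
    split_ifs
    · exact (hE _).contDiffAt
    · exact contDiffAt_const
  have h0 : ∀ x, (expMetric φ x).det ≠ 0 := fun x => by
    rw [expMetric, bdiag, Matrix.det_diagonal]
    exact Finset.prod_ne_zero_iff.2 fun k _ => (Real.exp_pos _).ne'
  have key := pd_ricci_of_nablaRiem hG h0 h m (r, 0) (r, 0)
  simp only [hric, bdiag_apply, if_true, mul_ite, mul_zero, Finset.sum_add_distrib,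
    Finset.sum_ite_eq, Finset.sum_ite_eq', Finset.mem_univ] at key
  rw [pd_mul (hρ r).diffAt (hE r).diffAt, pd_exp_two_mul hφ, christoffel_expMetric hφ] at key
  have hΓ : (if ((r, 0) : Ix) = m then pd (r, 0) (φ r) x else 0) -
      (if m = (r, 0) then Real.exp (2 * (φ m.1 x - φ r x)) * pd (r, 0) (φ m.1) x else 0) = 0 := by
    by_cases hm : m = (r, 0)
    · subst hm; simp
    · simp [hm, Ne.symm hm]
  have hx := Real.exp_pos (2 * φ r x)
  have : Real.exp (2 * φ r x) * pd m (ρ r) x = 0 := by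
    simp only [if_true] at key
    linear_combination key + 2 * ρ r x * Real.exp (2 * φ r x) * hΓ
  exact (mul_eq_zero.1 this).resolve_left hx.ne'

/-! ### The product of two round spheres -/

/-- The density of the round metric of radius `R`. -/
def roundDensity (R s : ℝ) : ℝ := 4 * R ^ 2 / (1 + s) ^ 2

/-- Half of the logarithm of the density of the round metric of radius `R`. -/
def roundExponent (R s : ℝ) : ℝ := Real.log (2 * R) - Real.log (1 + s)

section
variable {R : ℝ}

lemma isDensity_round : IsDensity (roundDensity R) where
  smooth s hs := contDiffAt_const.div ((contDiffAt_const.add contDiffAt_id).pow 2)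
    (pow_ne_zero 2 (by positivity : (1 + s) ≠ 0))
  inv s hs := by
    unfold roundDensity
    field_simp
    ring

lemma roundDensity_pos (hR : 0 < R) {s : ℝ} (hs : 0 ≤ s) : 0 < roundDensity R s := by
  unfold roundDensity; positivity

lemma exp_roundExponent (hR : 0 < R) {s : ℝ} (hs : 0 ≤ s) :
    Real.exp (2 * roundExponent R s) = roundDensity R s := by
  have h1 : 0 < 1 + s := by positivity
  rw [roundExponent, roundDensity, two_mul, Real.exp_add, Real.exp_sub, Real.exp_log (by positivity),
    Real.exp_log h1]
  field_simp
  ring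

lemma contDiffAt_roundExponent {s : ℝ} (hs : 0 ≤ s) : ContDiffAt ℝ ∞ (roundExponent R) s :=
  contDiffAt_const.sub ((contDiffAt_const.add contDiffAt_id).log (by positivity : (1 + s) ≠ 0))

lemma roundExponent_curvature {s : ℝ} (hs : 0 ≤ s) :
    -4 * (deriv (roundExponent R) s + s * deriv (deriv (roundExponent R)) s) =
      4 / (1 + s) ^ 2 := by
  have h1 : ∀ u : ℝ, 1 + u ≠ 0 → HasDerivAt (roundExponent R) (-(1 + u)⁻¹) u := fun u hu => by
    have := ((((hasDerivAt_id u).const_add 1).log hu).const_sub (Real.log (2 * R)))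
    simp only [id, one_div] at this
    exact this
  have h0 : (1 + s) ≠ 0 := by positivity
  have h2 : deriv (roundExponent R) =ᶠ[𝓝 s] fun u => -(1 + u)⁻¹ := by
    have : ∀ᶠ u in 𝓝 s, 1 + u ≠ 0 :=
      (continuous_const.add continuous_id).continuousAt.eventually_ne h0
    filter_upwards [this] with u hu using (h1 u hu).deriv
  have h3 : HasDerivAt (fun u : ℝ => -(1 + u)⁻¹) (((1 + s) ^ 2)⁻¹) s := by
    have := (((hasDerivAt_id s).const_add 1).inv h0).neg
    simp only [id, neg_div, neg_neg, one_div] at this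
    exact this
  rw [h2.deriv_eq, h3.deriv, h2.self_of_nhds]
  field_simp
  ring

end

lemma roundProduct_eq (R : Fin 2 → ℝ) : roundProduct R = radial fun r => roundDensity (R r) := by
  funext c x
  ext k l
  simp only [roundProduct, roundFactor, radial, Pi.add_apply, Matrix.add_apply, bdiag_apply,
    Matrix.diagonal_apply, norm_zc_sq, roundDensity]
  obtain ⟨r, a⟩ := k
  by_cases h : ((r, a) : Ix) = l
  · fin_cases r <;> simp
  · simp [h]

lemma conformal_one (g : Tensor2) : conformal (fun _ => 1) g = g := by
  funext c x; simp [conformal]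

section
variable {R : Fin 2 → ℝ} (hR : ∀ r, 0 < R r)
include hR

lemma roundProduct_eq_expMetric (c : Chart) :
    roundProduct R c = expMetric fun r x => roundExponent (R r) (nsq r x) := by
  funext x
  simp only [roundProduct_eq, radial, expMetric, exp_roundExponent (hR _) (nsq_nonneg _ x)]

lemma isMetric_roundProduct : IsMetric (roundProduct R) := by
  rw [roundProduct_eq]
  exact isMetric_radial (fun _ => isDensity_round) fun r s hs => roundDensity_pos (hR r) hs

lemma ricci_roundProduct (c : Chart) (x : V) : ricci (roundProduct R c) x =
    bdiag fun r => (R r ^ 2)⁻¹ * roundDensity (R r) (nsq r x) := by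
  have e : (fun r x => roundExponent (R r) (nsq r x)) =
      warp 0 1 (roundExponent (R 0)) (roundExponent (R 1)) (fun _ => 0) := by
    funext r x
    rcases eq_or_eq_of_ne zero_ne_one r with rfl | rfl <;> simp [warp]
  rw [roundProduct_eq_expMetric hR, e, ricci_warp zero_ne_one
    (fun s hs => contDiffAt_roundExponent hs) (fun s hs => contDiffAt_roundExponent hs)
    (fun s _ => contDiffAt_const) x (by simp)]
  congr 1
  funext r
  have h : ∀ r, 4 / (1 + nsq r x) ^ 2 = (R r ^ 2)⁻¹ * roundDensity (R r) (nsq r x) := fun r => by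
    have := (hR r).ne'
    unfold roundDensity
    field_simp
  rcases eq_or_eq_of_ne zero_ne_one r with rfl | rfl <;>
    simp only [one_ne_zero, if_true, if_false, deriv_const, deriv_const', mul_zero,
      sub_zero, add_zero, roundExponent_curvature (nsq_nonneg _ x), ← h] <;> simp

lemma engenders_roundProduct : Engenders (roundProduct R) fun _ => 1 := by
  have hric := ricci_roundProduct hR
  have hc : ∀ c : Chart, ((fun _ => 1 : M → ℝ) ∘ par c) = fun _ => 1 := fun c => rfl
  have hd : ∀ j, pd j (fun _ : V => (1 : ℝ)) = fun _ => 0 := fun j => funext fun x => pd_const 1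
  rw [← conformal_one (roundProduct R), roundProduct_eq] at hric
  rw [roundProduct_eq]
  refine engenders_radial zero_ne_one (fun r => isDensity_round)
    (fun r s hs => roundDensity_pos (hR r) hs) ⟨fun c => contDiff_const, fun c x p q => ?_⟩
    (fun _ => one_pos) (ρ := fun r _ _ => (R r ^ 2)⁻¹) (fun c x => by rw [hric]; simp)
    (fun _ _ => rfl) (μ := ((R 0 ^ 2)⁻¹ - (R 1 ^ 2)⁻¹) / 4) fun _ _ => by ring
  simp [barBar, hess, hc, hd]

lemma locallySymmetric_roundProduct : LocallySymmetric (roundProduct R) := by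
  intro c x m l k i j
  rw [roundProduct_eq_expMetric hR]
  refine nablaRiem_product (A := fun r => roundExponent (R r)) (K := fun r => (R r ^ 2)⁻¹)
    (fun r s hs => contDiffAt_roundExponent hs) (fun r s hs => ?_) m l k i j x
  rw [roundExponent_curvature hs, exp_roundExponent (hR r) hs, roundDensity]
  have := (hR r).ne'
  field_simp

lemma trace_ricciEnd_roundProduct (n : ℕ) (c : Chart) (x : V) :
    (ricciEnd (roundProduct R c) x ^ n).trace = 2 * (((R 0 ^ 2)⁻¹) ^ n + ((R 1 ^ 2)⁻¹) ^ n) := by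
  rw [ricciEnd_of_bdiag (w := fun r => roundDensity (R r) (nsq r x))
    (fun r => (roundDensity_pos (hR r) (nsq_nonneg r x)).ne') (by rw [roundProduct_eq]; rfl)
    (ricci_roundProduct hR c x), trace_bdiag_pow zero_ne_one]

end

/-! ### The metric with quartic momentum profile -/

/-- The derivative of the quartic profile. -/
def dPsi (a b t : ℝ) : ℝ :=
  (2 * t - a - b) / (a - b) * (2 - 2 * ((t - a) * (t - b)) / (a * b))

/-- The second derivative of the quartic profile. -/
def ddPsi (a b t : ℝ) : ℝ :=
  2 / (a - b) * (2 - 2 * ((t - a) * (t - b)) / (a * b) - (2 * t - a - b) ^ 2 / (a * b))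

lemma hasDerivAt_Psi (a b t : ℝ) : HasDerivAt (Psi a b) (dPsi a b t) t := by
  have h := ((hasDerivAt_id t).sub_const a).mul ((hasDerivAt_id t).sub_const b)
  have := (h.div_const (a - b)).mul ((h.div_const (a * b)).const_sub 2)
  refine this.congr_deriv ?_
  simp only [Pi.mul_apply, id, dPsi]
  ring

lemma hasDerivAt_dPsi (a b t : ℝ) : HasDerivAt (dPsi a b) (ddPsi a b t) t := by
  have h := ((hasDerivAt_id t).sub_const a).mul ((hasDerivAt_id t).sub_const b)
  have h1 : HasDerivAt (fun t : ℝ => 2 * t - a - b) 2 t := by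
    simpa using (((hasDerivAt_id t).const_mul 2).sub_const a).sub_const b
  have := (h1.div_const (a - b)).mul (((h.const_mul 2).div_const (a * b)).const_sub 2)
  refine this.congr_deriv ?_
  simp only [Pi.mul_apply, id, ddPsi]
  ring

section
variable {a b : ℝ} {T : ℝ → ℝ} (hT : IsProfile a b T)
include hT

lemma IsProfile.contDiff_deriv : ContDiff ℝ ∞ (deriv T) :=
  (contDiff_infty_iff_deriv.1 hT.smooth).2

lemma IsProfile.hasDerivAt_deriv (s : ℝ) : HasDerivAt (deriv T) (deriv (deriv T) s) s :=
  hT.contDiff_deriv.diffAt.hasDerivAt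

lemma IsProfile.hasDerivAt_deriv_deriv (s : ℝ) :
    HasDerivAt (deriv (deriv T)) (deriv (deriv (deriv T)) s) s :=
  (contDiff_infty_iff_deriv.1 hT.contDiff_deriv).2.diffAt.hasDerivAt

/-- The first derivative of the differential equation of the profile. -/
lemma IsProfile.ode_deriv (s : ℝ) :
    s * (deriv (deriv T) s / deriv T s) = dPsi a b (T s) / 2 - 1 := by
  have h1 : HasDerivAt (fun s => s * deriv T s) (1 * deriv T s + s * deriv (deriv T) s) s :=
    (hasDerivAt_id s).mul (hT.hasDerivAt_deriv s)
  have h2 : HasDerivAt (fun s => s * deriv T s) (dPsi a b (T s) * deriv T s / 2) s := by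
    rw [funext hT.ode]
    exact ((hasDerivAt_Psi a b (T s)).comp s (hT.hasDerivAt s)).div_const 2
  have h3 := h1.unique h2
  have h0 := (hT.deriv_pos s).ne'
  field_simp
  linarith

/-- The second derivative of the differential equation of the profile. -/
lemma IsProfile.ode_deriv_deriv (s : ℝ) :
    s * (deriv (deriv (deriv T)) s / deriv T s - (deriv (deriv T) s / deriv T s) ^ 2) =
      ddPsi a b (T s) * deriv T s / 2 - deriv (deriv T) s / deriv T s := by
  have h0 := (hT.deriv_pos s).ne'
  have h1 := (hasDerivAt_id s).mul ((hT.hasDerivAt_deriv_deriv s).div (hT.hasDerivAt_deriv s) h0)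
  have h2 : HasDerivAt (id * fun s => deriv (deriv T) s / deriv T s)
      (ddPsi a b (T s) * deriv T s / 2) s := by
    have e : (id * fun s => deriv (deriv T) s / deriv T s) = fun s => dPsi a b (T s) / 2 - 1 :=
      funext fun s => hT.ode_deriv s
    rw [e]
    exact (((hasDerivAt_dPsi a b (T s)).comp s (hT.hasDerivAt s)).div_const 2).sub_const 1
  have h3 := h1.unique h2
  simp only [id, Pi.div_apply] at h3
  rw [← h3]
  field_simp
  ring

end

/-- The function `k log (2 u) + l log v`. -/
def logComb (u v : ℝ → ℝ) (k l s : ℝ) : ℝ := k * Real.log (2 * u s) + l * Real.log (v s)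

section
variable {u v : ℝ → ℝ} (hu : ContDiff ℝ ∞ u) (hv : ContDiff ℝ ∞ v) {s : ℝ} (hu0 : u s ≠ 0)
  (hv0 : v s ≠ 0) (k l : ℝ)
include hu hv hu0 hv0

lemma contDiffAt_logComb : ContDiffAt ℝ ∞ (logComb u v k l) s :=
  (contDiffAt_const.mul ((contDiffAt_const.mul hu.contDiffAt).log
    (mul_ne_zero two_ne_zero hu0))).add (contDiffAt_const.mul (hv.contDiffAt.log hv0))

lemma hasDerivAt_logComb :
    HasDerivAt (logComb u v k l) (k * (deriv u s / u s) + l * (deriv v s / v s)) s := by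
  have h1 := ((hu.diffAt (x := s)).hasDerivAt.const_mul 2).log (mul_ne_zero two_ne_zero hu0)
  have h2 := (hv.diffAt (x := s)).hasDerivAt.log hv0
  refine ((h1.const_mul k).add (h2.const_mul l)).congr_deriv ?_
  rw [mul_div_mul_left _ _ two_ne_zero]

lemma deriv_deriv_logComb : deriv (deriv (logComb u v k l)) s =
    k * (deriv (deriv u) s / u s - (deriv u s / u s) ^ 2) +
      l * (deriv (deriv v) s / v s - (deriv v s / v s) ^ 2) := by
  have h : deriv (logComb u v k l) =ᶠ[𝓝 s] fun s => k * (deriv u s / u s) + l * (deriv v s / v s) := by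
    filter_upwards [hu.continuous.continuousAt.eventually_ne hu0,
      hv.continuous.continuousAt.eventually_ne hv0] with y h1 h2
    exact (hasDerivAt_logComb hu hv h1 h2 k l).deriv
  have hu' := ((contDiff_infty_iff_deriv.1 hu).2.diffAt (x := s)).hasDerivAt
  have hv' := ((contDiff_infty_iff_deriv.1 hv).2.diffAt (x := s)).hasDerivAt
  have d1 := (hu'.div (hu.diffAt (x := s)).hasDerivAt hu0).const_mul k
  have d2 := (hv'.div (hv.diffAt (x := s)).hasDerivAt hv0).const_mul l
  rw [h.deriv_eq]
  refine ((d1.add d2).congr_deriv ?_).deriv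
  field_simp

end

/-- The momentum in the affine chart `i`, as a function of the squared modulus of the affine
coordinate; the second chart exchanges the poles. -/
def branch (a b : ℝ) (T : ℝ → ℝ) (i : Fin 2) (s : ℝ) : ℝ := if i = 0 then T s else a + b - T s

/-- The orientation of the affine chart `i`: the sign of the derivative of the momentum. -/
def sgn (i : Fin 2) : ℝ := if i = 0 then 1 else -1

lemma sgn_sq (i : Fin 2) : sgn i ^ 2 = 1 := by unfold sgn; split_ifs <;> norm_num

section
variable {a b : ℝ} {T : ℝ → ℝ} (hT : IsProfile a b T) (i : Fin 2)
include hT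

lemma contDiff_branch : ContDiff ℝ ∞ (branch a b T i) := by
  unfold branch
  split_ifs
  · exact hT.smooth
  · exact contDiff_const.sub hT.smooth

omit hT in
lemma deriv_branch : deriv (branch a b T i) = fun s => sgn i * deriv T s := by
  funext s
  unfold branch sgn
  split_ifs
  · simp
  · rw [deriv_const_sub]; ring

lemma deriv_deriv_branch (s : ℝ) :
    deriv (deriv (branch a b T i)) s = sgn i * deriv (deriv T) s := by
  rw [deriv_branch]
  exact ((hT.hasDerivAt_deriv s).const_mul _).deriv

lemma branch_mem {s : ℝ} (hs : 0 ≤ s) : branch a b T i s ∈ Set.Icc a b := by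
  have h1 := hT.le hs
  have h2 := hT.lt s
  unfold branch
  split_ifs <;> constructor <;> linarith

omit hT in
lemma Psi_branch (s : ℝ) : Psi a b (branch a b T i s) = Psi a b (T s) := by
  unfold branch Psi
  split_ifs <;> ring

omit hT in
lemma dPsi_branch (s : ℝ) : dPsi a b (branch a b T i s) = sgn i * dPsi a b (T s) := by
  unfold branch dPsi sgn
  split_ifs <;> ring

omit hT in
lemma ddPsi_branch (s : ℝ) : ddPsi a b (branch a b T i s) = ddPsi a b (T s) := by
  unfold branch ddPsi
  split_ifs <;> ring

end

/-- The densities of the metric with momentum profile on the factor `p` and of the round metric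
of radius `R` on the other factor. -/
def momentumDensity (p : Fin 2) (T : ℝ → ℝ) (R : ℝ) (r : Fin 2) : ℝ → ℝ :=
  if r = p then fun s => 2 * deriv T s else roundDensity R

/-- The moment map of the rotation of the factor `p`, as a function on `M`. -/
def momentum (p : Fin 2) (b : ℝ) (T : ℝ → ℝ) (m : M) : ℝ :=
  open Classical in if m p = affine 1 0 then b else T (‖affineCoord 0 (m p)‖ ^ 2)

section
variable {a b : ℝ} {T : ℝ → ℝ} (hT : IsProfile a b T) {p q : Fin 2} (hpq : p ≠ q) {R : ℝ}
  (hR : 0 < R)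
include hT

lemma momentum_comp_par (c : Chart) :
    momentum p b T ∘ par c = fun x => branch a b T (c p) (nsq p x) := by
  funext x
  have h0 : c p = 0 ∨ c p = 1 := by omega
  rcases h0 with h | h
  · have h1 : affine 0 (zc p x) ≠ affine 1 0 := by
      rw [Ne, affine_eq_affine_iff]; simp
    simp [momentum, par, branch, h, h1, affineCoord_affine, norm_zc_sq]
  · by_cases hz : zc p x = 0
    · have h1 := nsq_eq_zero_iff.2 hz
      simp [momentum, par, branch, h, h1, hz, hT.zero]
    · have h1 : affine 1 (zc p x) ≠ affine 1 0 := by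
        rw [Ne, affine_eq_affine_iff]; simpa
      have h2 : 0 < nsq p x := lt_of_le_of_ne (nsq_nonneg p x)
        fun h => hz (nsq_eq_zero_iff.1 h.symm)
      simp [momentum, par, branch, h, h1, affineCoord_affine, norm_zc_sq, hT.inv _ h2]

lemma momentum_par (c : Chart) (x : V) :
    momentum p b T (par c x) = branch a b T (c p) (nsq p x) :=
  congrFun (momentum_comp_par hT c) x

lemma smoothFun_momentum : SmoothFun (momentum p b T) := fun c => by
  rw [momentum_comp_par hT]
  exact (contDiff_branch hT _).comp (contDiff_nsq p)

lemma momentum_pos (ha : 0 < a) (m : M) : 0 < momentum p b T m := by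
  obtain ⟨c, x, rfl⟩ := exists_par m
  rw [momentum_par hT]
  exact ha.trans_le (branch_mem hT _ (nsq_nonneg p x)).1

lemma isDensity_momentum (r : Fin 2) : IsDensity (momentumDensity p T R r) := by
  unfold momentumDensity
  split_ifs
  · refine ⟨fun s _ => contDiffAt_const.mul hT.contDiff_deriv.contDiffAt, fun s hs => ?_⟩
    rw [hT.deriv_inv hs]; ring
  · exact isDensity_round

lemma momentumDensity_pos (hR : 0 < R) (r : Fin 2) (s : ℝ) (hs : 0 ≤ s) :
    0 < momentumDensity p T R r s := by
  unfold momentumDensity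
  split_ifs
  · have := hT.deriv_pos s
    positivity
  · exact roundDensity_pos hR hs

include hpq hR

/-- The metrics `t ^ (2l) g₂` (here `l` is `0` or `-1`) are exponentials of warped products. -/
lemma smul_radial_momentum (c : Chart) (l : ℝ) (x : V) :
    expMetric (warp p q (logComb (deriv T) (branch a b T (c p)) (1 / 2) l) (roundExponent R)
        (logComb (deriv T) (branch a b T (c p)) 0 l)) x =
      bdiag fun r => Real.exp (2 * (l * Real.log (branch a b T (c p) (nsq p x)))) *
        momentumDensity p T R r (nsq r x) := by
  have h1 : Real.exp (2 * roundExponent R (nsq q x)) = _ := exp_roundExponent hR (nsq_nonneg q x)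
  have h2 : Real.exp (2 * (1 / 2 * Real.log (2 * deriv T (nsq p x)))) =
      2 * deriv T (nsq p x) := by
    rw [← mul_assoc, mul_one_div_cancel two_ne_zero, one_mul, Real.exp_log]
    have := hT.deriv_pos (nsq p x)
    positivity
  unfold expMetric
  congr 1
  funext r
  rcases eq_or_eq_of_ne hpq r with rfl | rfl
  · simp only [warp, momentumDensity, logComb, if_true, mul_add, Real.exp_add, h2]
    ring
  · simp only [warp, momentumDensity, logComb, hpq.symm, if_false, mul_add, Real.exp_add, h1]
    simp; ring

end

/-! ### The second solution, and its comparison with the product -/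

section
variable {a b : ℝ} {T : ℝ → ℝ} (hT : IsProfile a b T) {p q : Fin 2} (hpq : p ≠ q) {R : ℝ}
  (hR : 0 < R) (ha : 0 < a)
include hT hpq hR

lemma radial_momentum_eq (c : Chart) : radial (momentumDensity p T R) c =
    expMetric (warp p q (logComb (deriv T) (branch a b T (c p)) (1 / 2) 0) (roundExponent R)
      fun _ => 0) := by
  funext x
  have h := smul_radial_momentum hT hpq hR c 0 x
  simp only [zero_mul, mul_zero, Real.exp_zero, one_mul] at h
  have e : logComb (deriv T) (branch a b T (c p)) 0 0 = fun _ => 0 := by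
    funext s; simp [logComb]
  rw [e] at h
  exact h.symm

include ha

omit hT hpq hR in
/-- The eigenvalues of the Ricci tensor of `t⁻² g₂`. -/
lemma momentum_eigenvalues (hab : a < b) (hR2 : R ^ 2 = (b - a) * a * b / (a + b) ^ 2) (t : ℝ) :
    -(t ^ 2 * ddPsi a b t) / 2 + 2 * t * dPsi a b t - 3 * Psi a b t =
      3 * a * b / (b - a) - t ^ 4 / (a * b * (b - a)) ∧
    t ^ 2 * (R ^ 2)⁻¹ + t * dPsi a b t - 3 * Psi a b t =
      3 * a * b / (b - a) + t ^ 4 / (a * b * (b - a)) := by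
  have hb : 0 < b := ha.trans hab
  have h1 : a - b ≠ 0 := by linarith
  have h2 : b - a ≠ 0 := by linarith
  have h3 : a + b ≠ 0 := by linarith
  rw [hR2]
  unfold Psi dPsi ddPsi
  have e : a - b = -(b - a) := by ring
  constructor
  · rw [e]; field_simp; ring
  · rw [e]; field_simp; ring

omit hpq hR in
lemma contDiffAt_logComb_branch (k l : ℝ) (i : Fin 2) {s : ℝ} (hs : 0 ≤ s) :
    ContDiffAt ℝ ∞ (logComb (deriv T) (branch a b T i) k l) s :=
  contDiffAt_logComb hT.contDiff_deriv (contDiff_branch hT i) (hT.deriv_pos s).ne'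
    (ha.trans_le (branch_mem hT i hs).1).ne' k l

lemma conformal_momentum_eq (c : Chart) :
    conformal (momentum p b T) (radial (momentumDensity p T R)) c =
      expMetric (warp p q (logComb (deriv T) (branch a b T (c p)) (1 / 2) (-1)) (roundExponent R)
        (logComb (deriv T) (branch a b T (c p)) 0 (-1))) := by
  funext x
  have h0 : 0 < branch a b T (c p) (nsq p x) :=
    ha.trans_le (branch_mem hT _ (nsq_nonneg p x)).1
  rw [smul_radial_momentum hT hpq hR c (-1) x, conformal_radial, momentum_par hT]
  congr 1
  funext r
  congr 1
  rw [neg_one_mul, mul_neg, Real.exp_neg, two_mul, Real.exp_add, Real.exp_log h0, sq]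

/-- The Ricci tensor of `t⁻² g₂`. -/
lemma ricci_conformal_momentum (hab : a < b) (hR2 : R ^ 2 = (b - a) * a * b / (a + b) ^ 2)
    (c : Chart) (x : V) :
    ricci (conformal (momentum p b T) (radial (momentumDensity p T R)) c) x =
      bdiag fun r => (3 * a * b / (b - a) + (if r = p then -1 else 1) *
        (momentum p b T (par c x) ^ 4 / (a * b * (b - a)))) *
        ((momentum p b T (par c x) ^ 2)⁻¹ * momentumDensity p T R r (nsq r x)) := by
  have hs := nsq_nonneg p x
  have hτ0 : 0 < branch a b T (c p) (nsq p x) := ha.trans_le (branch_mem hT _ hs).1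
  have hy0 := hT.deriv_pos (nsq p x)
  have hu := hT.contDiff_deriv
  have hv := contDiff_branch hT (c p)
  have dA := (hasDerivAt_logComb hu hv hy0.ne' hτ0.ne' (1 / 2) (-1)).deriv
  have dC := (hasDerivAt_logComb hu hv hy0.ne' hτ0.ne' 0 (-1)).deriv
  have ddA := deriv_deriv_logComb hu hv hy0.ne' hτ0.ne' (1 / 2) (-1)
  have ddC := deriv_deriv_logComb hu hv hy0.ne' hτ0.ne' 0 (-1)
  simp only [deriv_deriv_branch hT] at ddA ddC
  simp only [deriv_branch] at dA dC ddA ddC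
  obtain ⟨m1, m2⟩ := momentum_eigenvalues ha hab hR2 (branch a b T (c p) (nsq p x))
  rw [Psi_branch, dPsi_branch, ddPsi_branch] at m1
  rw [Psi_branch, dPsi_branch] at m2
  have h1 := hT.ode (nsq p x)
  have h2 := hT.ode_deriv (nsq p x)
  have h3 := hT.ode_deriv_deriv (nsq p x)
  have hε := sgn_sq (c p)
  have hmet := congrFun (conformal_momentum_eq hT hpq hR ha c) x
  have hE : ∀ r, Real.exp (2 * warp p q (logComb (deriv T) (branch a b T (c p)) (1 / 2) (-1))
      (roundExponent R) (logComb (deriv T) (branch a b T (c p)) 0 (-1)) r x) =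
      (branch a b T (c p) (nsq p x) ^ 2)⁻¹ * momentumDensity p T R r (nsq r x) := fun r => by
    have := congrFun₂ hmet (r, 0) (r, 0)
    rw [conformal_radial, bdiag_apply, expMetric, bdiag_apply, momentum_par hT] at this
    simpa using this.symm
  rw [conformal_momentum_eq hT hpq hR ha, ricci_warp hpq
    (fun s hs => contDiffAt_logComb_branch hT ha _ _ _ hs)
    (fun s hs => contDiffAt_roundExponent hs)
    (fun s hs => contDiffAt_logComb_branch hT ha _ _ _ hs), momentum_par hT]
  · congr 1
    funext r
    have hB := roundExponent_curvature (R := R) (nsq_nonneg q x)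
    have hyL : deriv (deriv T) (nsq p x) =
        (deriv (deriv T) (nsq p x) / deriv T (nsq p x)) * deriv T (nsq p x) := by field_simp
    have hz : branch a b T (c p) (nsq p x) * (branch a b T (c p) (nsq p x))⁻¹ = 1 :=
      mul_inv_cancel₀ hτ0.ne'
    have hp : momentumDensity p T R p (nsq p x) = 2 * deriv T (nsq p x) := by
      simp [momentumDensity]
    have hq : momentumDensity p T R q (nsq q x) = roundDensity R (nsq q x) := by
      simp [momentumDensity, hpq.symm]
    have hq' : roundDensity R (nsq q x) * (R ^ 2)⁻¹ = 4 / (1 + nsq q x) ^ 2 := by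
      have := hR.ne'
      unfold roundDensity
      field_simp
    rw [mul_sub, Real.exp_sub, hE, hE, dA, dC, ddA, ddC, hp]
    -- everything is now a polynomial identity in `τ`, `1 / τ` and the derivatives of the profile
    rcases eq_or_eq_of_ne hpq r with hr | hr <;> rw [hr]
    on_goal 1 => rw [if_pos rfl, if_pos rfl, hp]
    on_goal 2 => rw [if_neg hpq.symm, if_neg hpq.symm, hq, hB, ← hq', mul_div_mul_left _ _
      (by positivity)]
    all_goals
      generalize deriv (deriv (deriv T)) (nsq p x) / deriv T (nsq p x) = N at *
      generalize deriv (deriv T) (nsq p x) / deriv T (nsq p x) = L at *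
      rw [hyL]
      generalize deriv T (nsq p x) = y at *
      generalize branch a b T (c p) (nsq p x) = τ at *
      generalize nsq p x = s at *
      generalize sgn (c p) = ε at *
      rw [← inv_pow τ]
      simp only [div_eq_mul_inv _ τ]
      generalize τ⁻¹ = z at *
    · linear_combination 2 * y * z ^ 2 * m1 - 2 * h3 + 8 * ε * y * z * h2 - 12 * y * z ^ 2 * h1 -
        12 * s * y ^ 2 * z ^ 2 * hε +
        (ddPsi a b (T s) * y * (τ * z + 1) - 4 * ε * dPsi a b (T s) * y * z) * hz
    · have hy : y * y⁻¹ = 1 := mul_inv_cancel₀ hy0.ne'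
      generalize roundDensity R (nsq q x) = e at *
      rw [div_eq_mul_inv e, mul_inv]
      linear_combination e * z ^ 2 * m2 - e / 2 * y⁻¹ * (-4 * ε * y * z * h2 + 12 * y * z ^ 2 * h1 +
        12 * s * y ^ 2 * z ^ 2 * hε) -
        e / 2 * (-2 * ε * dPsi a b (T s) * z + 6 * Psi a b (T s) * z ^ 2) * hy -
        (e * (R ^ 2)⁻¹ * (τ * z + 1) + e * ε * dPsi a b (T s) * z) * hz
  · rw [dA, dC, ddC]
    have hyL : deriv (deriv T) (nsq p x) =
        (deriv (deriv T) (nsq p x) / deriv T (nsq p x)) * deriv T (nsq p x) := by field_simp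
    generalize deriv (deriv T) (nsq p x) / deriv T (nsq p x) = L at *
    rw [hyL]
    ring

/-- The momentum is a holomorphy potential: its gradient is the holomorphic field `z ∂/∂z`. -/
lemma isHolomorphyPotential_momentum :
    IsHolomorphyPotential (radial (momentumDensity p T R)) (momentum p b T) := by
  refine ⟨smoothFun_momentum hT, fun c x r s => ?_⟩
  have hy0 := hT.deriv_pos (nsq p x)
  have hu := hT.contDiff_deriv
  have hv := contDiff_branch hT (c p)
  have hτ0 : 0 < branch a b T (c p) (nsq p x) :=
    ha.trans_le (branch_mem hT _ (nsq_nonneg p x)).1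
  rw [radial_momentum_eq hT hpq hR, momentum_comp_par hT, hess_warp hpq
    (fun s hs => contDiffAt_logComb_branch hT ha _ _ _ hs)
    (fun s hs => contDiffAt_roundExponent hs) (fun s _ => hv.contDiffAt)]
  · by_cases h : r = s <;> simp [barBar, bdiag_apply, h]
  · rw [deriv_deriv_branch hT, deriv_branch,
      (hasDerivAt_logComb hu hv hy0.ne' hτ0.ne' _ _).deriv]
    field_simp
    ring

lemma engenders_momentum (hab : a < b) (hR2 : R ^ 2 = (b - a) * a * b / (a + b) ^ 2) :
    Engenders (radial (momentumDensity p T R)) (momentum p b T) := by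
  refine engenders_radial hpq (isDensity_momentum hT) (momentumDensity_pos hT hR)
    (isHolomorphyPotential_momentum hT hpq hR ha) (momentum_pos hT ha)
    (fun c x => ricci_conformal_momentum hT hpq hR ha hab hR2 c x)
    (σ := 6 * a * b / (b - a)) (μ := -1 / (2 * (a * b * (b - a)))) (fun c x => ?_) fun c x => ?_
  · simp only [if_true, hpq.symm, if_false]; ring
  · have hb : 0 < b := ha.trans hab
    have h2 : b - a ≠ 0 := by linarith
    simp only [if_true, hpq.symm, if_false]
    field_simp
    ring

omit hpq hR ha in
/-- There are points with momentum `a` and points with momentum between `a` and `b`. -/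
lemma exists_momentum_ne : ∃ x y : V, nsq p x = 0 ∧ T (nsq p y) ∈ Set.Ioo a b := by
  refine ⟨0, fun k => if k.2 = 0 then 1 else 0, by simp [nsq], ?_, hT.lt _⟩
  simp only [nsq, if_true]
  rw [← hT.zero]
  exact hT.strictMono (by norm_num)

/-- The difference of the two eigenvalues of the Ricci tensor of `t⁻² g₂` is a multiple of `t⁴`, so
these are not constant. -/
lemma not_locallySymmetric_momentum (hab : a < b)
    (hR2 : R ^ 2 = (b - a) * a * b / (a + b) ^ 2) :
    ¬ LocallySymmetric (conformal (momentum p b T) (radial (momentumDensity p T R))) := by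
  intro h
  have hb : 0 < b := ha.trans hab
  set φ := warp p q (logComb (deriv T) (branch a b T 0) (1 / 2) (-1)) (roundExponent R)
        (logComb (deriv T) (branch a b T 0) 0 (-1)) with hφ
  have hG : conformal (momentum p b T) (radial (momentumDensity p T R)) 0 = expMetric φ :=
    conformal_momentum_eq hT hpq hR ha 0
  set ρ : Fin 2 → V → ℝ := fun r x => 3 * a * b / (b - a) + (if r = p then -1 else 1) *
        ((T (nsq p x)) ^ 4 / (a * b * (b - a))) with hρ
  have hm : ∀ x, momentum p b T (par 0 x) = T (nsq p x) := fun x => by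
    rw [momentum_par hT]; simp [branch]
  have hsm : ∀ r, ContDiff ℝ ∞ (ρ r) := fun r => contDiff_const.add (contDiff_const.mul
    (((hT.smooth.comp (contDiff_nsq p)).pow 4).div_const _))
  have hpd := fun x => pd_eigenvalue_of_nablaRiem (φ := φ) (ρ := ρ)
    (contDiff_warp (fun s hs => contDiffAt_logComb_branch hT ha _ _ _ hs)
      (fun s hs => contDiffAt_roundExponent hs)
      (fun s hs => contDiffAt_logComb_branch hT ha _ _ _ hs)) hsm (fun x => by
      have h1 := ricci_conformal_momentum hT hpq hR ha hab hR2 0 x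
      have h2 := fun r => congrFun₂ (congrFun hG x) (r, 0) (r, 0)
      simp only [conformal_radial, bdiag_apply, if_true, expMetric] at h2
      simp only [h2] at h1
      rw [← hG, h1]
      simp only [hρ, hm]) (x := x) (fun m l k i j => by rw [← hG]; exact h 0 x m l k i j) p
  obtain ⟨x, y, hx, hy⟩ := exists_momentum_ne hT (p := p)
  have e := eq_of_pd_eq_zero ((hsm p).differentiable (by simp)) (fun i x => hpd x i) x y
  have hD : 0 < a * b * (b - a) := mul_pos (mul_pos ha hb) (by linarith)
  have hlt : a ^ 4 < (T (nsq p y)) ^ 4 := pow_lt_pow_left₀ hy.1 ha.le (by norm_num)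
  simp only [hρ, if_true, hx, hT.zero] at e
  have := div_lt_div_of_pos_right hlt hD
  linarith

/-- The scalar curvature of the metric with momentum profile is not constant. -/
lemma not_sameOrbit_momentum (hab : a < b) {R' : Fin 2 → ℝ} (hR' : ∀ r, 0 < R' r) :
    ¬ SameOrbit (roundProduct R') (radial (momentumDensity p T R)) := by
  rintro ⟨A, hA⟩
  have hb : 0 < b := ha.trans hab
  have hric : ∀ x, ricci (radial (momentumDensity p T R) 0) x = bdiag fun r =>
      (if r = p then -ddPsi a b (T (nsq p x)) / 2 else (R ^ 2)⁻¹) *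
        momentumDensity p T R r (nsq r x) := by
    intro x
    have hy0 := hT.deriv_pos (nsq p x)
    have hu := hT.contDiff_deriv
    have hv := contDiff_branch hT 0
    have hτ0 : 0 < branch a b T 0 (nsq p x) :=
      ha.trans_le (branch_mem hT _ (nsq_nonneg p x)).1
    have h3 := hT.ode_deriv_deriv (nsq p x)
    rw [radial_momentum_eq hT hpq hR, ricci_warp hpq
      (fun s hs => contDiffAt_logComb_branch hT ha _ _ _ hs)
      (fun s hs => contDiffAt_roundExponent hs) (fun s _ => contDiffAt_const) x (by simp)]
    congr 1
    funext r
    rcases eq_or_eq_of_ne hpq r with hr | hr <;> rw [hr]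
    · simp only [if_true, momentumDensity, Pi.zero_apply,
        (hasDerivAt_logComb hu hv hy0.ne' hτ0.ne' _ _).deriv,
        deriv_deriv_logComb hu hv hy0.ne' hτ0.ne', deriv_const]
      linear_combination -2 * h3
    · have hR0 := hR.ne'
      simp only [if_false, hpq.symm, momentumDensity, deriv_const, deriv_const',
        roundExponent_curvature (nsq_nonneg q x)]
      unfold roundDensity
      field_simp
      simp
  have key := fun x => trace_ricciEnd_pow_const one_pos (smoothMap_act A) (act_surjective A)
    (isMetric_roundProduct hR') (isMetric_radial (isDensity_momentum hT)
      (momentumDensity_pos hT hR)) (by rw [one_smul]; exact hA) 1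
    (trace_ricciEnd_roundProduct hR' 1) 0 x
  simp only [fun x => ricciEnd_of_bdiag (G := radial (momentumDensity p T R) 0) (x := x)
    (w := fun r => momentumDensity p T R r (nsq r x))
    (fun r => (momentumDensity_pos hT hR r _ (nsq_nonneg r x)).ne') rfl (hric x),
    trace_bdiag_pow hpq] at key
  simp only [pow_one, if_true, hpq.symm, if_false] at key
  obtain ⟨x, y, hx, hy⟩ := exists_momentum_ne hT (p := p)
  have e : ddPsi a b a = ddPsi a b (T (nsq p y)) := by
    have h1 := key x
    have h2 := key y
    rw [hx, hT.zero] at h1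
    linarith
  have h2 : 0 < b - a := by linarith
  generalize T (nsq p y) = t at hy e
  have e2 : 12 * ((t - a) * (b - t)) / ((b - a) * (a * b)) = 0 := by
    have e1 : a - b = -(b - a) := by ring
    have : ddPsi a b a - ddPsi a b t = 12 * ((t - a) * (b - t)) / ((b - a) * (a * b)) := by
      unfold ddPsi
      rw [e1]
      field_simp
      ring
    rw [← this, e, sub_self]
  have h3 : 0 < 12 * ((t - a) * (b - t)) / ((b - a) * (a * b)) := by
    have := hy.1
    have := hy.2
    have : 0 < t - a := by linarith
    have : 0 < b - t := by linarith
    positivity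
  exact h3.ne' e2

/-- The trace of the square of the Ricci endomorphism of `t⁻² g₂` is not constant; its trace, the
scalar curvature, is. -/
lemma not_homothetic_momentum (hab : a < b) (hR2 : R ^ 2 = (b - a) * a * b / (a + b) ^ 2)
    {R' : Fin 2 → ℝ} (hR' : ∀ r, 0 < R' r) :
    ¬ Homothetic (roundProduct R')
      (conformal (momentum p b T) (radial (momentumDensity p T R))) := by
  rintro ⟨Φ, hΦ, -, k, hk, hpull⟩
  have hb : 0 < b := ha.trans hab
  have hw : ∀ x r, 0 < ((momentum p b T (par 0 x)) ^ 2)⁻¹ * momentumDensity p T R r (nsq r x) :=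
    fun x r => mul_pos (inv_pos.2 (pow_pos (momentum_pos hT ha _) 2))
      (momentumDensity_pos hT hR r _ (nsq_nonneg r x))
  have key := fun x => trace_ricciEnd_pow_const hk hΦ Φ.surjective
    (isMetric_roundProduct hR') (isMetric_conformal (smoothFun_momentum hT) (momentum_pos hT ha)
      (isMetric_radial (isDensity_momentum hT) (momentumDensity_pos hT hR))) hpull 2
    (trace_ricciEnd_roundProduct hR' 2) 0 x
  have hm : ∀ x, momentum p b T (par 0 x) = T (nsq p x) := fun x => by
    rw [momentum_par hT]; simp [branch]
  simp only [fun x => ricciEnd_of_bdiag (fun r => (hw x r).ne') (conformal_radial _ _ _ _)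
    (ricci_conformal_momentum hT hpq hR ha hab hR2 0 x),
    trace_bdiag_pow hpq, if_true, hpq.symm, if_false, hm] at key
  obtain ⟨x, y, hx, hy⟩ := exists_momentum_ne hT (p := p)
  have h1 := key x
  have h2 := key y
  rw [hx, hT.zero] at h1
  have hD : 0 < a * b * (b - a) := mul_pos (mul_pos ha hb) (by linarith)
  have hlt : a ^ 4 < (T (nsq p y)) ^ 4 := pow_lt_pow_left₀ hy.1 ha.le (by norm_num)
  have h3 := div_lt_div_of_pos_right hlt hD
  have h4 : 0 < a ^ 4 / (a * b * (b - a)) := by positivity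
  nlinarith

omit ha hR in
lemma isMomentumProduct :
    IsMomentumProduct p q a b R (radial (momentumDensity p T R)) (momentum p b T) where
  fromFactor m m' h := by unfold momentum; rw [h]
  southPole m h := by
    have h1 : affine 0 0 ≠ affine 1 0 := by
      rw [Ne, affine_eq_affine_iff]; simp
    simp [momentum, h, h1, affineCoord_affine, hT.zero]
  northPole m h := by simp [momentum, h]
  range m h0 h1 := by
    rcases exists_affine_zero (m p) with ⟨z, hz⟩ | hz
    · have hz0 : z ≠ 0 := by rintro rfl; exact h0 hz
      rw [momentum, if_neg h1, hz, affineCoord_affine, if_pos rfl]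
      refine ⟨?_, hT.lt _⟩
      rw [← hT.zero]
      exact hT.strictMono (by positivity)
    · exact absurd hz h1
  formula c x hx k l := by
    have hv := contDiff_branch hT (c p)
    have hy0 := hT.deriv_pos (nsq p x)
    have hs0 : nsq p x ≠ 0 := fun h => hx (nsq_eq_zero_iff.1 h)
    have hode : Psi a b (T (nsq p x)) = 2 * nsq p x * deriv T (nsq p x) := by
      linear_combination -2 * hT.ode (nsq p x)
    have hε := sgn_sq (c p)
    have hnsq : nsq p x = x (p, 0) ^ 2 + x (p, 1) ^ 2 := rfl
    rw [momentum_par hT, momentum_comp_par hT, Psi_branch, pd_radial fun s _ => hv.contDiffAt,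
      pd_radial fun s _ => hv.contDiffAt, deriv_branch, hode]
    simp only [radial, bdiag_apply, roundFactor, Matrix.diagonal_apply, dTheta, norm_zc_sq, zc_re,
      zc_im]
    obtain ⟨r, i⟩ := k
    obtain ⟨s, j⟩ := l
    rcases eq_or_eq_of_ne hpq r with hr | hr <;> rcases eq_or_eq_of_ne hpq s with hs | hs <;>
      simp only [hr, hs, momentumDensity, hpq, hpq.symm, if_true, if_false, Prod.mk.injEq,
        true_and, false_and, mul_zero, zero_mul, add_zero, zero_div, zero_add]
    · have t1 : ∀ A B : ℝ, 2 * A * (sgn (c p) * deriv T (nsq p x)) *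
          (2 * B * (sgn (c p) * deriv T (nsq p x))) / (2 * nsq p x * deriv T (nsq p x)) =
          2 * deriv T (nsq p x) * (A * B) / nsq p x := fun A B => by
        field_simp
        linear_combination A * B * hε
      have t2 : ∀ A B : ℝ, 2 * nsq p x * deriv T (nsq p x) * (A / nsq p x) * (B / nsq p x) =
          2 * deriv T (nsq p x) * (A * B) / nsq p x := fun A B => by
        field_simp
      rw [t1, t2, ite_self, add_zero, ← add_div, eq_div_iff hs0, hnsq]
      fin_cases i <;> fin_cases j <;> simp <;> ring
    · rfl

end

/-! ### Linear flows and the Cartan formula -/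

/-- The pull-back of a covariant 2-tensor on `ℝ⁴` under the linear map `D`. -/
def linPull (D : Matrix Ix Ix ℝ) (P : V → Matrix Ix Ix ℝ) (x : V) : Matrix Ix Ix ℝ :=
  Dᵀ * P (D *ᵥ x) * D

/-- The Lie derivative of a covariant 2-tensor along the linear vector field `x ↦ K x`. -/
def lieLin (K : Matrix Ix Ix ℝ) (P : V → Matrix Ix Ix ℝ) (x : V) : Matrix Ix Ix ℝ :=
  Kᵀ * P x + P x * K + ∑ m, (K *ᵥ x) m • pdm m P x

/-- The contraction of a 2-form with the linear vector field `x ↦ K x`. -/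
def contract (K : Matrix Ix Ix ℝ) (P : V → Matrix Ix Ix ℝ) (x : V) (j : Ix) : ℝ :=
  ∑ k, (K *ᵥ x) k * P x k j

lemma contDiff_mulVec (D : Matrix Ix Ix ℝ) (k : Ix) : ContDiff ℝ ∞ fun x : V => (D *ᵥ x) k := by
  simp only [Matrix.mulVec, dotProduct]
  exact ContDiff.sum fun i _ => contDiff_const.mul (contDiff_apply ℝ ℝ i)

lemma pd_mulVec (D : Matrix Ix Ix ℝ) (i k : Ix) (x : V) :
    pd i (fun y => (D *ᵥ y) k) x = D k i := by
  simp only [Matrix.mulVec, dotProduct]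
  rw [pd_sum fun m _ => by fun_prop]
  have : ∀ m, pd i (fun y : V => D k m * y m) x = if m = i then D k m else 0 := fun m => by
    rw [pd_const_mul _ (by fun_prop), pd_coord]; simp
  simp [this]

lemma jac_mulVec (D : Matrix Ix Ix ℝ) (x : V) : jac (fun y => D *ᵥ y) x = D := by
  ext k i; exact pd_mulVec D i k x

section
variable {P : V → Matrix Ix Ix ℝ} (hP : ∀ x, SmoothMatAt P x) (D K : Matrix Ix Ix ℝ) {x : V}
include hP

lemma smoothMatAt_linPull : SmoothMatAt (linPull D P) x := by
  have h1 : SmoothMatAt (fun y => P (D *ᵥ y)) x :=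
    (hP _).comp (contDiffAt_pi.2 fun k => (contDiff_mulVec D k).contDiffAt)
  have hc : ∀ E : Matrix Ix Ix ℝ, SmoothMatAt (fun _ => E) x := fun E k l => contDiffAt_const
  exact ((hc _).mul h1).mul (hc _)

lemma pdm_linPull (i : Ix) : pdm i (linPull D P) x =
    ∑ a, D a i • (Dᵀ * pdm a P (D *ᵥ x) * D) := by
  have hφ : ContDiffAt ℝ ∞ (fun y : V => D *ᵥ y) x :=
    contDiffAt_pi.2 fun k => (contDiff_mulVec D k).contDiffAt
  have h1 : SmoothMatAt (fun y => P (D *ᵥ y)) x := (hP _).comp hφ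
  have h2 := pdm_comp (hP (D *ᵥ x)) hφ i
  rw [jac_mulVec] at h2
  have h3 : pdm i (linPull D P) x = Dᵀ * pdm i (fun y => P (D *ᵥ y)) x * D := by
    ext k l
    simp only [pdm, linPull, Matrix.mul_apply, Matrix.of_apply]
    have d : ∀ a b, DifferentiableAt ℝ (fun y => P (D *ᵥ y) a b) x := fun a b => (h1 a b).diffAt
    have d1 : ∀ k b, DifferentiableAt ℝ (fun y => ∑ a, Dᵀ k a * P (D *ᵥ y) a b) x := fun k b =>
      DifferentiableAt.fun_sum fun a _ => (d a b).const_mul _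
    rw [pd_sum fun b _ => (d1 k b).mul_const _]
    refine Finset.sum_congr rfl fun b _ => ?_
    simp only [mul_comm _ (D b l)]
    rw [pd_const_mul _ (d1 k b), pd_sum fun a _ => (d a b).const_mul _]
    simp only [fun a => pd_const_mul (i := i) (Dᵀ k a) (d a b)]
  rw [h3, h2, Matrix.mul_sum, Matrix.sum_mul]
  simp only [Matrix.mul_smul, Matrix.smul_mul]

/-- The Cartan formula for a closed 2-form. -/
lemma lieLin_eq (ha : ∀ x, (P x)ᵀ = -P x)
    (hc : ∀ i j k, pd i (fun y => P y j k) x + pd j (fun y => P y k i) x +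
      pd k (fun y => P y i j) x = 0) (i j : Ix) :
    pd i (fun y => contract K P y j) x - pd j (fun y => contract K P y i) x =
      lieLin K P x i j := by
  have ha' : ∀ i j x, P x i j = -P x j i := fun i j x => congrFun₂ (ha x) j i
  have d : ∀ k l, DifferentiableAt ℝ (fun y => P y k l) x := fun k l => (hP x k l).diffAt
  have dK : ∀ k, DifferentiableAt ℝ (fun y : V => (K *ᵥ y) k) x := fun k =>
    (contDiff_mulVec K k).diffAt
  have e : ∀ i j, pd i (fun y => contract K P y j) x =
      ∑ k, (K k i * P x k j + (K *ᵥ x) k * pd i (fun y => P y k j) x) := fun i j => by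
    simp only [contract]
    rw [pd_sum fun k _ => (dK k).fun_mul (d k j)]
    refine Finset.sum_congr rfl fun k _ => ?_
    rw [pd_mul (dK k) (d k j), pd_mulVec]
  rw [e, e, ← Finset.sum_sub_distrib]
  simp only [lieLin, Matrix.add_apply, Matrix.mul_apply, Matrix.sum_apply, Matrix.smul_apply,
    Matrix.transpose_apply, smul_eq_mul, pdm, Matrix.of_apply, ← Finset.sum_add_distrib]
  refine Finset.sum_congr rfl fun k _ => ?_
  have h1 : pd i (fun y => P y k j) x = -pd i (fun y => P y j k) x := by
    rw [← pd_neg]; simp only [← ha' k j]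
  rw [h1, ha' i k x]
  linear_combination -(K *ᵥ x) k * hc i j k

lemma closed_linPull
    (hc : ∀ x i j k, pd i (fun y => P y j k) x + pd j (fun y => P y k i) x +
      pd k (fun y => P y i j) x = 0) (i j k : Ix) :
    pd i (fun y => linPull D P y j k) x + pd j (fun y => linPull D P y k i) x +
      pd k (fun y => linPull D P y i j) x = 0 := by
  have e : ∀ i j k, pd i (fun y => linPull D P y j k) x =
      ∑ m, ∑ a, ∑ b, D m i * D a j * D b k * pd m (fun y => P y a b) (D *ᵥ x) := fun i j k => by
    have := congrFun₂ (pdm_linPull hP D (x := x) i) j k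
    simp only [pdm, Matrix.of_apply] at this
    rw [this]
    simp only [Matrix.sum_apply, Matrix.smul_apply, Matrix.mul_apply, smul_eq_mul,
      Matrix.transpose_apply, Matrix.of_apply, Finset.mul_sum, Finset.sum_mul]
    refine Finset.sum_congr rfl fun m _ => ?_
    rw [Finset.sum_comm]
    refine Finset.sum_congr rfl fun a _ => Finset.sum_congr rfl fun b _ => ?_
    ring
  have s1 : ∀ f : Ix → Ix → Ix → ℝ, ∑ a, ∑ b, ∑ m, f a b m = ∑ m, ∑ a, ∑ b, f a b m := fun f =>
    (Finset.sum_congr rfl fun a _ => Finset.sum_comm).trans Finset.sum_comm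
  have s2 : ∀ f : Ix → Ix → Ix → ℝ, ∑ b, ∑ m, ∑ a, f b m a = ∑ m, ∑ a, ∑ b, f b m a := fun f =>
    Finset.sum_comm.trans (Finset.sum_congr rfl fun a _ => Finset.sum_comm)
  rw [e i, e j, e k, s1 fun a b m => D a j * D b k * D m i * pd a (fun y => P y b m) (D *ᵥ x),
    s2 fun b m a => D b k * D m i * D a j * pd b (fun y => P y m a) (D *ᵥ x)]
  simp only [← Finset.sum_add_distrib]
  refine Finset.sum_eq_zero fun m _ => Finset.sum_eq_zero fun a _ => Finset.sum_eq_zero fun b _ => ?_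
  linear_combination D m i * D a j * D b k * hc (D *ᵥ x) m a b

end

/-- Entrywise derivatives of a curve of matrices. -/
def HasMatDerivAt (A : ℝ → Matrix Ix Ix ℝ) (A' : Matrix Ix Ix ℝ) (s : ℝ) : Prop :=
  ∀ i j, HasDerivAt (fun s => A s i j) (A' i j) s

lemma HasMatDerivAt.mul {A B : ℝ → Matrix Ix Ix ℝ} {A' B' : Matrix Ix Ix ℝ} {s : ℝ}
    (hA : HasMatDerivAt A A' s) (hB : HasMatDerivAt B B' s) :
    HasMatDerivAt (fun s => A s * B s) (A' * B s + A s * B') s := fun i j => by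
  simp only [Matrix.mul_apply, Matrix.add_apply, ← Finset.sum_add_distrib]
  exact HasDerivAt.fun_sum fun k _ => (hA i k).mul (hB k j)

/-- Along the flow of a linear vector field, the pull-back of a tensor is differentiated by the Lie
derivative. -/
lemma hasMatDerivAt_linPull {P : V → Matrix Ix Ix ℝ} (hP : ∀ x, SmoothMatAt P x)
    {D : ℝ → Matrix Ix Ix ℝ} {K : Matrix Ix Ix ℝ} {s : ℝ} (hD : HasMatDerivAt D (D s * K) s)
    (x : V) : HasMatDerivAt (fun s => linPull (D s) P x) (lieLin K (linPull (D s) P) x) s := by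
  have hx : HasDerivAt (fun s => D s *ᵥ x) ((D s * K) *ᵥ x) s := by
    rw [hasDerivAt_pi]
    intro k
    simp only [Matrix.mulVec, dotProduct]
    exact HasDerivAt.fun_sum fun i _ => (hD k i).mul_const _
  have h1 : HasMatDerivAt (fun s => P (D s *ᵥ x))
      (∑ a, ((D s * K) *ᵥ x) a • pdm a P (D s *ᵥ x)) s := fun i j => by
    have := ((hP (D s *ᵥ x) i j).diffAt.hasFDerivAt).comp_hasDerivAt s hx
    rw [fderiv_apply_eq_sum] at this
    simp only [Matrix.sum_apply, Matrix.smul_apply, pdm, Matrix.of_apply, smul_eq_mul]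
    exact this
  have h2 : HasMatDerivAt (fun s => (D s)ᵀ) (D s * K)ᵀ s := fun i j => hD j i
  have h3 := (h2.mul h1).mul hD
  have e : lieLin K (linPull (D s) P) x = ((D s * K)ᵀ * P (D s *ᵥ x) + (D s)ᵀ *
      ∑ a, ((D s * K) *ᵥ x) a • pdm a P (D s *ᵥ x)) * D s + (D s)ᵀ * P (D s *ᵥ x) * (D s * K) := by
    have e1 : ∑ m, (K *ᵥ x) m • pdm m (linPull (D s) P) x =
        (D s)ᵀ * (∑ a, ((D s * K) *ᵥ x) a • pdm a P (D s *ᵥ x)) * D s := by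
      simp only [pdm_linPull hP, Finset.smul_sum, smul_smul]
      rw [Finset.sum_comm, Matrix.mul_sum, Matrix.sum_mul]
      refine Finset.sum_congr rfl fun a _ => ?_
      rw [← Finset.sum_smul, Matrix.mul_smul, Matrix.smul_mul]
      congr 1
      rw [← Matrix.mulVec_mulVec]
      simp only [Matrix.mulVec, dotProduct, mul_comm]
    rw [lieLin, e1, linPull, Matrix.transpose_mul]
    simp only [Matrix.add_mul, Matrix.mul_assoc]
    abel
  rw [e]
  exact h3

/-! ### Rotations of the factors and averages over them -/

lemma zc_blk_mulVec (d : Fin 2 → ℂ) (x : V) (r : Fin 2) : zc r (blk d *ᵥ x) = d r * zc r x := by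
  apply Complex.ext
  · simp only [zc_re, Matrix.mulVec, dotProduct, Fintype.sum_prod_type, blk, Matrix.of_apply,
      Complex.mul_re, zc_im]
    fin_cases r <;> simp [mulMat, Fin.sum_univ_two] <;> ring
  · simp only [zc_re, Matrix.mulVec, dotProduct, Fintype.sum_prod_type, blk, Matrix.of_apply,
      Complex.mul_im, zc_im]
    fin_cases r <;> simp [mulMat, Fin.sum_univ_two] <;> ring

lemma blk_one : blk (fun _ => 1) = 1 := by
  ext ⟨p, a⟩ ⟨q, b⟩
  simp only [blk, mulMat, Matrix.of_apply, Matrix.one_apply, Prod.mk.injEq]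
  fin_cases a <;> fin_cases b <;> simp

lemma hasMatDerivAt_blk {d : ℝ → Fin 2 → ℂ} {d' : Fin 2 → ℂ} {s : ℝ}
    (h : ∀ r, HasDerivAt (fun s => d s r) (d' r) s) : HasMatDerivAt (fun s => blk (d s)) (blk d') s := by
  rintro ⟨p, a⟩ ⟨q, b⟩
  have hre : HasDerivAt (fun s => (d s p).re) (d' p).re s :=
    Complex.reCLM.hasFDerivAt.comp_hasDerivAt s (h p)
  have him : HasDerivAt (fun s => (d s p).im) (d' p).im s :=
    Complex.imCLM.hasFDerivAt.comp_hasDerivAt s (h p)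
  simp only [blk, mulMat, Matrix.of_apply]
  split_ifs
  exacts [hre, him.neg, him, hre, hasDerivAt_const _ _]

/-- The generator of the rotation of the factor `p` of `CP₁ × CP₁`, in the chart `c`: the two affine
charts see opposite rotations. -/
def rotGen (p : Fin 2) (c : Chart) (r : Fin 2) : ℂ := if r = p then sgn (c p) * Complex.I else 0

/-- The rotation by the angle `s` of the factor `p` of `CP₁ × CP₁`, in the chart `c`. -/
def rotC (p : Fin 2) (c : Chart) (s : ℝ) (r : Fin 2) : ℂ := Complex.exp (s * rotGen p c r)

/-- The pull-back of a covariant 2-tensor field under the rotation of the factor `p`. -/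
def rotate (p : Fin 2) (s : ℝ) (F : Tensor2) : Tensor2 := fun c =>
  linPull (blk (rotC p c s)) (F c)

section
variable (p : Fin 2) (c : Chart)

lemma rotC_ne_zero (s : ℝ) (r : Fin 2) : rotC p c s r ≠ 0 := Complex.exp_ne_zero _

lemma rotC_add (s u : ℝ) (r : Fin 2) : rotC p c (s + u) r = rotC p c s r * rotC p c u r := by
  simp only [rotC, Complex.ofReal_add, add_mul, Complex.exp_add]

lemma rotC_zero : rotC p c 0 = fun _ => 1 := by
  funext r; simp [rotC]

lemma rotC_of_ne {r : Fin 2} (h : r ≠ p) (s : ℝ) : rotC p c s r = 1 := by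
  simp [rotC, rotGen, h]

lemma sgn_cases (i : Fin 2) : sgn i = 1 ∨ sgn i = -1 := by
  unfold sgn; split_ifs <;> simp

lemma rotC_two_pi : rotC p c (2 * Real.pi) = fun _ => 1 := by
  funext r
  unfold rotC rotGen
  split_ifs
  · rcases sgn_cases (c p) with h | h
    · simp [h, Complex.exp_two_pi_mul_I]
    · simp [h, Complex.exp_neg, Complex.exp_two_pi_mul_I]
  · simp

lemma norm_rotC (s : ℝ) (r : Fin 2) : ‖rotC p c s r‖ = 1 := by
  unfold rotC rotGen
  split_ifs
  · rw [← mul_assoc, ← Complex.ofReal_mul, Complex.norm_exp_ofReal_mul_I]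
  · simp

lemma rotC_inv {c' : Chart} (h : c p ≠ c' p) (s : ℝ) : rotC p c' s p = (rotC p c s p)⁻¹ := by
  rw [rotC, rotC, ← Complex.exp_neg]
  have : sgn (c' p) = -sgn (c p) := by
    have h0 : c p = 0 ∨ c p = 1 := by omega
    have h1 : c' p = 0 ∨ c' p = 1 := by omega
    rcases h0 with h0 | h0 <;> rcases h1 with h1 | h1 <;> simp [h0, h1, sgn] at h ⊢
  simp [rotGen, this]

lemma rotC_eq {c' : Chart} (h : c p = c' p) (s : ℝ) (r : Fin 2) : rotC p c' s r = rotC p c s r := by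
  simp only [rotC, rotGen, h]

lemma hasMatDerivAt_rotC (s : ℝ) : HasMatDerivAt (fun s => blk (rotC p c s))
    (blk (rotC p c s) * blk (rotGen p c)) s := by
  rw [blk_mul_blk]
  refine hasMatDerivAt_blk fun r => ?_
  have h1 : HasDerivAt (fun s : ℝ => (s : ℂ) * rotGen p c r) (rotGen p c r) s := by
    simpa using (Complex.ofRealCLM.hasDerivAt (x := s)).mul_const (rotGen p c r)
  exact h1.cexp

lemma contDiff_rotC (k l : Ix) : ContDiff ℝ ∞ fun s : ℝ => blk (rotC p c s) k l := by
  have h : ContDiff ℝ ∞ fun s : ℝ => rotC p c s k.1 :=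
    (Complex.ofRealCLM.contDiff.mul contDiff_const).cexp
  have hre : ContDiff ℝ ∞ fun s : ℝ => (rotC p c s k.1).re := Complex.reCLM.contDiff.comp h
  have him : ContDiff ℝ ∞ fun s : ℝ => (rotC p c s k.1).im := Complex.imCLM.contDiff.comp h
  simp only [blk, mulMat, Matrix.of_apply]
  split_ifs
  exacts [hre, him.neg, him, hre, contDiff_const]

/-- Rotations are compatible with the transition maps. -/
lemma par_rotC {c' : Chart} {x x' : V} (h : par c x = par c' x') (s : ℝ) :
    par c (blk (rotC p c s) *ᵥ x) = par c' (blk (rotC p c' s) *ᵥ x') := by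
  rw [par_eq_par_iff] at h ⊢
  intro r
  rw [zc_blk_mulVec, zc_blk_mulVec]
  rcases h r with ⟨h1, h2⟩ | ⟨h1, h2⟩
  · refine Or.inl ⟨h1, ?_⟩
    by_cases hr : r = p
    · subst hr; rw [rotC_eq r c h1, h2]
    · rw [rotC_of_ne p c hr, rotC_of_ne p c' hr, h2]
  · refine Or.inr ⟨h1, ?_⟩
    by_cases hr : r = p
    · subst hr
      rw [rotC_inv r c h1, mul_mul_mul_comm, mul_inv_cancel₀ (rotC_ne_zero r c s r), one_mul, h2]
    · rw [rotC_of_ne p c hr, rotC_of_ne p c' hr, one_mul, one_mul, h2]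

lemma dz_rotC (c' : Chart) (x : V) (s : ℝ) (r : Fin 2) :
    dz c c' (blk (rotC p c s) *ᵥ x) r * rotC p c s r = rotC p c' s r * dz c c' x r := by
  simp only [dz, zc_blk_mulVec]
  by_cases hr : r = p
  · subst hr
    have h0 := rotC_ne_zero r c s r
    by_cases h : c r = c' r
    · simp only [h, if_true, rotC_eq r c h, one_mul, mul_one]
    · simp only [h, if_false, rotC_inv r c h, mul_pow, mul_inv]
      field_simp
  · simp [rotC_of_ne p c hr, rotC_of_ne p c' hr]

lemma dz_rotGen {c' : Chart} {x x' : V} (h : par c x = par c' x') (r : Fin 2) :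
    dz c c' x r * (rotGen p c r * zc r x) = rotGen p c' r * zc r x' := by
  rw [zc_of_par_eq h]
  unfold dz rotGen
  by_cases hr : r = p
  · subst hr
    by_cases h1 : c r = c' r
    · simp [h1]
    · have h0 := zc_ne_zero_of_par_eq h h1
      have : sgn (c' r) = -sgn (c r) := by
        have h2 : c r = 0 ∨ c r = 1 := by omega
        have h3 : c' r = 0 ∨ c' r = 1 := by omega
        rcases h2 with h2 | h2 <;> rcases h3 with h3 | h3 <;> simp [h2, h3, sgn] at h1 ⊢
      simp only [h1, if_false, if_true, this]
      push_cast
      field_simp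
  · simp [hr]

end

section
variable {F : Tensor2} (p : Fin 2)

lemma IsTensorField.rotated (hF : IsTensorField F) (s : ℝ) : IsTensorField (rotate p s F) := by
  refine ⟨fun c i j => contDiff_iff_contDiffAt.2 fun x => smoothMatAt_linPull (P := F c)
    (fun x i j => (hF.1 c i j).contDiffAt) _ i j, isPullback_id_iff.2 fun c c' x x' h => ?_⟩
  simp only [rotate, linPull]
  rw [isPullback_id_iff.1 hF.2 _ _ _ _ (par_rotC p c h s)]
  have e : blk (dz c c' (blk (rotC p c s) *ᵥ x)) * blk (rotC p c s) =
      blk (rotC p c' s) * blk (dz c c' x) := by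
    rw [blk_mul_blk, blk_mul_blk]
    simp only [dz_rotC]
  calc _ = (blk (dz c c' (blk (rotC p c s) *ᵥ x)) * blk (rotC p c s))ᵀ *
        F c' (blk (rotC p c' s) *ᵥ x') *
        (blk (dz c c' (blk (rotC p c s) *ᵥ x)) * blk (rotC p c s)) := by
        simp only [Matrix.transpose_mul, Matrix.mul_assoc]
    _ = _ := by rw [e]; simp only [Matrix.transpose_mul, Matrix.mul_assoc]

lemma linPull_linPull (D E : Matrix Ix Ix ℝ) (P : V → Matrix Ix Ix ℝ) :
    linPull D (linPull E P) = linPull (E * D) P := by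
  funext x
  simp only [linPull, Matrix.transpose_mul, Matrix.mul_assoc, Matrix.mulVec_mulVec]

lemma rotate_rotate (s u : ℝ) : rotate p u (rotate p s F) = rotate p (s + u) F := by
  funext c
  rw [rotate, rotate, linPull_linPull, blk_mul_blk, rotate]
  simp only [← rotC_add]

lemma rotate_comm (q : Fin 2) (s u : ℝ) :
    rotate q u (rotate p s F) = rotate p s (rotate q u F) := by
  funext c
  simp only [rotate, linPull_linPull]
  rw [blk_comm]

lemma rotate_zero : rotate p 0 F = F := by
  funext c x
  simp [rotate, rotC_zero, blk_one, linPull]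

lemma rotate_two_pi : rotate p (2 * Real.pi) F = F := by
  funext c x
  simp [rotate, rotC_two_pi, blk_one, linPull]

lemma contDiff_rotate (hF : IsTensorField F) (c : Chart) (i j : Ix) :
    ContDiff ℝ ∞ (Function.uncurry fun x s => rotate p s F c x i j) := by
  have hD : ∀ k l, ContDiff ℝ ∞ fun z : V × ℝ => blk (rotC p c z.2) k l := fun k l =>
    (contDiff_rotC p c k l).comp contDiff_snd
  have hx : ContDiff ℝ ∞ fun z : V × ℝ => blk (rotC p c z.2) *ᵥ z.1 := by
    rw [contDiff_pi]
    intro k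
    simp only [Matrix.mulVec, dotProduct]
    exact ContDiff.sum fun l _ => (hD k l).mul ((contDiff_apply ℝ ℝ l).comp contDiff_fst)
  simp only [rotate, linPull, Matrix.mul_apply, Function.uncurry_def, Matrix.transpose_apply]
  exact ContDiff.sum fun l _ => (ContDiff.sum fun k _ =>
    (hD k i).mul ((hF.1 c k l).comp hx)).mul (hD l j)

lemma continuous_rotate (hF : IsTensorField F) (c : Chart) (x : V) (i j : Ix) :
    Continuous fun s => rotate p s F c x i j := by
  have h : Continuous fun s : ℝ => (x, s) := Continuous.prodMk_right x
  have h2 := (contDiff_rotate p hF c i j).continuous.comp h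
  simpa only [Function.comp_def, Function.uncurry_apply_pair] using h2

/-- The average of a tensor field over the rotations of the factor `p`. -/
def average (p : Fin 2) (F : Tensor2) : Tensor2 := fun c x => Matrix.of fun i j =>
  (2 * Real.pi)⁻¹ * ∫ s in (0 : ℝ)..2 * Real.pi, rotate p s F c x i j

lemma mul_integral_mul {f : ℝ → Matrix Ix Ix ℝ} (hf : ∀ i j, Continuous fun s => f s i j)
    (A B : Matrix Ix Ix ℝ) (κ u v : ℝ) (i j : Ix) :
    (A * (Matrix.of fun i j => κ * ∫ s in u..v, f s i j) * B) i j =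
      κ * ∫ s in u..v, (A * f s * B) i j := by
  simp only [Matrix.mul_apply, Matrix.of_apply, Finset.sum_mul]
  rw [intervalIntegral.integral_finsetSum fun k _ =>
    (Continuous.intervalIntegrable (by fun_prop) _ _), Finset.mul_sum]
  refine Finset.sum_congr rfl fun k _ => ?_
  rw [intervalIntegral.integral_finsetSum fun l _ =>
    (Continuous.intervalIntegrable (by fun_prop) _ _), Finset.mul_sum]
  refine Finset.sum_congr rfl fun l _ => ?_
  rw [intervalIntegral.integral_mul_const, intervalIntegral.integral_const_mul]
  ring

lemma IsTensorField.averaged (hF : IsTensorField F) : IsTensorField (average p F) := by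
  refine ⟨fun c i j => contDiff_const.mul
    (contDiff_intervalIntegral (contDiff_rotate p hF c i j) _ _),
    isPullback_id_iff.2 fun c c' x x' h => ?_⟩
  ext i j
  have hr := fun s => isPullback_id_iff.1 (hF.rotated p s).2 c c' x x' h
  conv_lhs => simp only [average, Matrix.of_apply, hr]
  exact (mul_integral_mul (continuous_rotate p hF c' x') _ _ _ _ _ i j).symm

lemma rotate_antisymm (hF : ∀ c x, (F c x)ᵀ = -F c x) (s : ℝ) (c : Chart) (x : V) :
    (rotate p s F c x)ᵀ = -rotate p s F c x := by
  simp [rotate, linPull, Matrix.transpose_mul, hF, Matrix.mul_assoc]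

lemma IsTwoForm.averaged (hF : IsTwoForm F) : IsTwoForm (average p F) := by
  refine ⟨hF.1.averaged p, fun c x => ?_⟩
  ext i j
  have hr : ∀ s, rotate p s F c x j i = -rotate p s F c x i j := fun s =>
    congrFun₂ (rotate_antisymm p hF.2 s c x) i j
  simp [average, hr]

lemma JInvariant.averaged (hF : IsTensorField F) (hJ : JInvariant F) :
    JInvariant (average p F) := by
  intro c x
  have hr : ∀ s, Jmatᵀ * rotate p s F c x * Jmat = rotate p s F c x := fun s => by
    have e : blk (rotC p c s) * Jmat = Jmat * blk (rotC p c s) := by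
      rw [Jmat_eq_blk, blk_comm]
    have e' : Jmatᵀ * (blk (rotC p c s))ᵀ = (blk (rotC p c s))ᵀ * Jmatᵀ := by
      rw [← Matrix.transpose_mul, e, Matrix.transpose_mul]
    calc _ = Jmatᵀ * (blk (rotC p c s))ᵀ * F c (blk (rotC p c s) *ᵥ x) *
          (blk (rotC p c s) * Jmat) := by simp only [rotate, linPull, Matrix.mul_assoc]
      _ = (blk (rotC p c s))ᵀ * (Jmatᵀ * F c (blk (rotC p c s) *ᵥ x) * Jmat) *
          blk (rotC p c s) := by rw [e, e']; simp only [Matrix.mul_assoc]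
      _ = _ := by rw [hJ]; rfl
  ext i j
  rw [average, mul_integral_mul (continuous_rotate p hF c x)]
  simp only [hr, Matrix.of_apply]

lemma IsClosedForm.rotated (hF : IsTensorField F) (hc : IsClosedForm F) (s : ℝ) :
    IsClosedForm (rotate p s F) := fun c _ i j k =>
  closed_linPull (P := F c) (fun _ i j => (hF.1 c i j).contDiffAt) _ (hc c) i j k

lemma pd_average (hF : IsTensorField F) (c : Chart) (x : V) (i j k : Ix) :
    pd i (fun y => average p F c y j k) x =
      (2 * Real.pi)⁻¹ * ∫ s in (0 : ℝ)..2 * Real.pi, pd i (fun y => rotate p s F c y j k) x := by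
  simp only [average, Matrix.of_apply]
  rw [pd_const_mul _ (contDiff_intervalIntegral (contDiff_rotate p hF c j k) _ _).diffAt,
    pd_intervalIntegral (contDiff_rotate p hF c j k)]

/-- Partial derivatives of a family of functions are smooth in the variable and the parameter. -/
lemma contDiff_pd_param {f : V → ℝ → ℝ} (hf : ContDiff ℝ ∞ (Function.uncurry f)) (i : Ix) :
    ContDiff ℝ ∞ (Function.uncurry fun x s => pd i (fun y => f y s) x) := by
  have h : ContDiff ℝ ∞ (fun z : V × ℝ => fderiv ℝ (fun y => f y z.2) z.1) :=
    ContDiff.fderiv (m := ∞) (n := ∞) (f := fun (z : V × ℝ) y => f y z.2) (g := fun z => z.1)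
      (hf.comp (contDiff_snd.prodMk (contDiff_snd.comp contDiff_fst))) contDiff_fst (by norm_num)
  exact h.clm_apply contDiff_const

lemma IsClosedForm.averaged (hF : IsTensorField F) (hc : IsClosedForm F) :
    IsClosedForm (average p F) := by
  intro c x i j k
  have hi : ∀ i j k, IntervalIntegrable (fun s => pd i (fun y => rotate p s F c y j k) x)
      MeasureTheory.volume 0 (2 * Real.pi) := fun i j k => by
    have h : Continuous fun s : ℝ => (x, s) := Continuous.prodMk_right x
    have h2 := (contDiff_pd_param (contDiff_rotate p hF c j k) i).continuous.comp h
    simp only [Function.comp_def, Function.uncurry_apply_pair] at h2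
    exact h2.intervalIntegrable _ _
  rw [pd_average p hF, pd_average p hF, pd_average p hF, ← mul_add, ← mul_add,
    ← intervalIntegral.integral_add (hi _ _ _) (hi _ _ _),
    ← intervalIntegral.integral_add ((hi _ _ _).add (hi _ _ _)) (hi _ _ _)]
  simp only [hc.rotated p hF _ c x i j k]
  simp

/-- Averages are invariant under rotations. -/
lemma rotate_average (hF : IsTensorField F) (u : ℝ) : rotate p u (average p F) = average p F := by
  funext c x
  ext i j
  have h : ∀ s, (blk (rotC p c u))ᵀ * rotate p s F c (blk (rotC p c u) *ᵥ x) * blk (rotC p c u) =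
      rotate p (s + u) F c x := fun s => by
    rw [← rotate_rotate]; rfl
  rw [rotate, linPull, average, mul_integral_mul (continuous_rotate p hF c _)]
  simp only [h, average, Matrix.of_apply]
  congr 1
  rw [intervalIntegral.integral_comp_add_right (fun s => rotate p s F c x i j), zero_add, add_comm]
  have hper : Function.Periodic (fun s => rotate p s F c x i j) (2 * Real.pi) := fun s => by
    simp only [add_comm s, ← rotate_rotate, rotate_two_pi]
  have := hper.intervalIntegral_add_eq u 0
  rwa [zero_add] at this

lemma rotate_average_of_invariant {q : Fin 2} (hF : IsTensorField F)
    (h : ∀ u, rotate q u F = F) (u : ℝ) : rotate q u (average p F) = average p F := by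
  funext c x
  ext i j
  have h : ∀ s, (blk (rotC q c u))ᵀ * rotate p s F c (blk (rotC q c u) *ᵥ x) * blk (rotC q c u) =
      rotate p s F c x := fun s => by
    conv_rhs => rw [← h u, ← rotate_comm]
    rfl
  rw [rotate, linPull, average, mul_integral_mul (continuous_rotate p hF c _)]
  simp only [h, average, Matrix.of_apply]

/-- Tensors invariant under the rotations have vanishing Lie derivative. -/
lemma lieLin_of_invariant (hF : IsTensorField F) (h : ∀ u, rotate p u F = F) (c : Chart) (x : V) :
    lieLin (blk (rotGen p c)) (F c) x = 0 := by
  have h1 := hasMatDerivAt_linPull (P := F c) (fun x i j => (hF.1 c i j).contDiffAt)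
    (hasMatDerivAt_rotC p c 0) x
  have e : ∀ s, linPull (blk (rotC p c s)) (F c) = F c := fun s => congrFun (h s) c
  simp only [e] at h1
  ext i j
  exact (h1 i j).unique (hasDerivAt_const _ _)

end

/-! ### Averages have the same cohomology class -/

lemma contract_eq_vecMul (K : Matrix Ix Ix ℝ) (P : V → Matrix Ix Ix ℝ) (x : V) :
    contract K P x = (K *ᵥ x) ᵥ* P x := rfl

lemma blk_rotGen_mulVec {p : Fin 2} {c c' : Chart} {x x' : V} (h : par c x = par c' x') :
    blk (dz c c' x) *ᵥ (blk (rotGen p c) *ᵥ x) = blk (rotGen p c') *ᵥ x' := by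
  refine ext_zc fun r => ?_
  rw [zc_blk_mulVec, zc_blk_mulVec, zc_blk_mulVec, dz_rotGen p c h]

/-- The contraction of a tensor field with the generator of a rotation is a 1-form. -/
lemma contract_transition {p : Fin 2} {G : Tensor2} (hG : IsTensorField G) {c c' : Chart} {x x' : V}
    (h : par c x = par c' x') : contract (blk (rotGen p c)) (G c) x =
      (blk (dz c c' x))ᵀ *ᵥ contract (blk (rotGen p c')) (G c') x' := by
  rw [contract_eq_vecMul, contract_eq_vecMul, isPullback_id_iff.1 hG.2 _ _ _ _ h,
    Matrix.mulVec_transpose, ← blk_rotGen_mulVec h]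
  simp only [← Matrix.vecMul_vecMul, Matrix.vecMul_transpose]

section
variable {F : Tensor2} (p : Fin 2)

lemma contDiff_contract_rotate (hF : IsTensorField F) (c : Chart) (j : Ix) :
    ContDiff ℝ ∞ (Function.uncurry fun x s =>
      (2 * Real.pi - s) * contract (blk (rotGen p c)) (rotate p s F c) x j) := by
  simp only [contract, Function.uncurry_def]
  refine (contDiff_const.sub contDiff_snd).mul (ContDiff.sum fun k _ => ?_)
  exact ((contDiff_mulVec _ k).comp contDiff_fst).mul (contDiff_rotate p hF c k j)

/-- A closed 2-form is cohomologous to its average over the rotations of a factor. -/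
lemma cohomologous_average (hF : IsTwoForm F) (hc : IsClosedForm F) :
    Cohomologous (average p F) F := by
  have hsm := contDiff_contract_rotate p hF.1
  refine ⟨fun c x j => (2 * Real.pi)⁻¹ * ∫ s in (0 : ℝ)..2 * Real.pi,
    (2 * Real.pi - s) * contract (blk (rotGen p c)) (rotate p s F c) x j,
    ⟨fun c j => contDiff_const.mul (contDiff_intervalIntegral (hsm c j) _ _),
      fun c c' x x' h => ?_⟩, fun c x i j => ?_⟩
  · rw [jac_transition_of_eq h]
    funext j
    have hcont : ∀ k, Continuous fun s => (2 * Real.pi - s) *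
        contract (blk (rotGen p c')) (rotate p s F c') x' k := fun k => by
      have h1 : Continuous fun s : ℝ => (x', s) := Continuous.prodMk_right x'
      have h2 := (hsm c' k).continuous.comp h1
      simpa only [Function.comp_def, Function.uncurry_apply_pair] using h2
    have e : ∀ s, (2 * Real.pi - s) * contract (blk (rotGen p c)) (rotate p s F c) x j =
        ∑ k, (blk (dz c c' x))ᵀ j k *
          ((2 * Real.pi - s) * contract (blk (rotGen p c')) (rotate p s F c') x' k) := fun s => by
      rw [contract_transition (hF.1.rotated p s) h, Matrix.mulVec, dotProduct, Finset.mul_sum]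
      exact Finset.sum_congr rfl fun k _ => by ring
    simp only [e, Matrix.mulVec, dotProduct]
    rw [intervalIntegral.integral_finsetSum fun k _ =>
      ((hcont k).const_mul _).intervalIntegrable _ _, Finset.mul_sum]
    refine Finset.sum_congr rfl fun k _ => ?_
    rw [intervalIntegral.integral_const_mul]
    ring
  · have hπ := Real.pi_pos
    have hpd : ∀ i j, pd i (fun y => (2 * Real.pi)⁻¹ * ∫ s in (0 : ℝ)..2 * Real.pi,
        (2 * Real.pi - s) * contract (blk (rotGen p c)) (rotate p s F c) y j) x =
        (2 * Real.pi)⁻¹ * ∫ s in (0 : ℝ)..2 * Real.pi, (2 * Real.pi - s) *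
          pd i (fun y => contract (blk (rotGen p c)) (rotate p s F c) y j) x := fun i j => by
      rw [pd_const_mul _ (contDiff_intervalIntegral (hsm c j) _ _).diffAt,
        pd_intervalIntegral (hsm c j)]
      congr 1
      refine intervalIntegral.integral_congr fun s _ => ?_
      have hd : ContDiff ℝ ∞ fun y => contract (blk (rotGen p c)) (rotate p s F c) y j := by
        simp only [contract]
        exact ContDiff.sum fun k _ => (contDiff_mulVec _ k).mul ((hF.1.rotated p s).1 c k j)
      exact pd_const_mul _ hd.diffAt
    have hint : ∀ i j, IntervalIntegrable (fun s => (2 * Real.pi - s) *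
        pd i (fun y => contract (blk (rotGen p c)) (rotate p s F c) y j) x)
        MeasureTheory.volume 0 (2 * Real.pi) := fun i j => by
      have hd : ContDiff ℝ ∞ (Function.uncurry fun x s =>
          contract (blk (rotGen p c)) (rotate p s F c) x j) := by
        simp only [contract, Function.uncurry_def]
        exact ContDiff.sum fun k _ => ((contDiff_mulVec _ k).comp contDiff_fst).mul
          (contDiff_rotate p hF.1 c k j)
      have h1 : Continuous fun s : ℝ => (x, s) := Continuous.prodMk_right x
      have h2 := (contDiff_pd_param hd i).continuous.comp h1
      simp only [Function.comp_def, Function.uncurry_apply_pair] at h2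
      exact ((continuous_const.sub continuous_id).mul h2).intervalIntegrable _ _
    rw [hpd, hpd, ← mul_sub, ← intervalIntegral.integral_sub (hint _ _) (hint _ _)]
    simp only [← mul_sub]
    have hsmooth : ContDiff ℝ ∞ fun s => rotate p s F c x i j := by
      have h2 := (contDiff_rotate p hF.1 c i j).comp (contDiff_prodMk_right x)
      simpa only [Function.comp_def, Function.uncurry_apply_pair] using h2
    have hder : ∀ s, HasDerivAt (fun s => rotate p s F c x i j)
        (lieLin (blk (rotGen p c)) (rotate p s F c) x i j) s := fun s =>
      hasMatDerivAt_linPull (P := F c) (fun x i j => (hF.1.1 c i j).contDiffAt)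
        (hasMatDerivAt_rotC p c s) x i j
    have hcart : ∀ s, pd i (fun y => contract (blk (rotGen p c)) (rotate p s F c) y j) x -
        pd j (fun y => contract (blk (rotGen p c)) (rotate p s F c) y i) x =
        deriv (fun s => rotate p s F c x i j) s := fun s => by
      rw [(hder s).deriv]
      exact lieLin_eq (P := rotate p s F c)
        (fun x i j => ((hF.1.rotated p s).1 c i j).contDiffAt) _ (rotate_antisymm p hF.2 s c)
        (hc.rotated p hF.1 s c x) i j
    simp only [hcart]
    have hu : ∀ s ∈ Set.uIcc 0 (2 * Real.pi), HasDerivAt (fun s : ℝ => 2 * Real.pi - s) (-1) s :=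
      fun s _ => by simpa using (hasDerivAt_id s).const_sub (2 * Real.pi)
    have hcd : Continuous (deriv fun s => rotate p s F c x i j) :=
      hsmooth.continuous_deriv (by simp)
    rw [intervalIntegral.integral_mul_deriv_eq_deriv_mul hu
      (fun s _ => hsmooth.diffAt.hasDerivAt) intervalIntegrable_const
      (hcd.intervalIntegrable _ _)]
    simp only [average, Matrix.of_apply, rotate_zero, rotate_two_pi, neg_one_mul,
      intervalIntegral.integral_neg]
    field_simp
    ring

end

lemma Cohomologous.trans {F G H : Tensor2} (h1 : Cohomologous F G) (h2 : Cohomologous G H) :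
    Cohomologous F H := by
  obtain ⟨α, hα, h1⟩ := h1
  obtain ⟨β, hβ, h2⟩ := h2
  refine ⟨fun c x i => α c x i + β c x i, ⟨fun c i => (hα.1 c i).add (hβ.1 c i),
    fun c c' x x' h => ?_⟩, fun c x i j => ?_⟩
  · change α c x + β c x = _ *ᵥ (α c' x' + β c' x')
    rw [hα.2 _ _ _ _ h, hβ.2 _ _ _ _ h, ← Matrix.mulVec_add]
  · rw [pd_add (hα.1 c j).diffAt (hβ.1 c j).diffAt, pd_add (hα.1 c i).diffAt (hβ.1 c i).diffAt]
    linear_combination h1 c x i j + h2 c x i j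

lemma Cohomologous.symm {F G : Tensor2} (h : Cohomologous F G) : Cohomologous G F := by
  obtain ⟨α, hα, h⟩ := h
  refine ⟨fun c x i => -α c x i, ⟨fun c i => (hα.1 c i).neg, fun c c' x x' h => ?_⟩,
    fun c x i j => ?_⟩
  · change -α c x = _ *ᵥ (-α c' x')
    rw [hα.2 _ _ _ _ h, ← Matrix.mulVec_neg]
  · rw [pd_neg, pd_neg]
    linear_combination -h c x i j

/-! ### Primitives of invariant 2-forms in a chart -/

/-- The homothety with factor `r` of the coordinate plane of the factor `p`. -/
def scale (p : Fin 2) (r : ℝ) (x : V) : V := fun k => if k.1 = p then r * x k else x k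

/-- The weighted mean of a function along the segments to `z_p = 0`. -/
def rayMean (p : Fin 2) (u : V → ℝ) (x : V) : ℝ := ∫ r in (0 : ℝ)..1, r * u (scale p r x)

/-- The components of the rotation fields `x_p ∂_{y_p} - y_p ∂_{x_p}`, which are also those of the
1-forms `x_p dy_p - y_p dx_p`. -/
def rotCoord (k : Ix) (x : V) : ℝ := if k.2 = 0 then -x (k.1, 1) else x (k.1, 0)

/-- The matrix of the rotation field of the factor `p`. -/
def rotMat (p : Fin 2) : Matrix Ix Ix ℝ := blk fun r => if r = p then Complex.I else 0

lemma rotMat_mulVec (p : Fin 2) (x : V) (k : Ix) :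
    (rotMat p *ᵥ x) k = if k.1 = p then rotCoord k x else 0 := by
  obtain ⟨r, a⟩ := k
  have h := zc_blk_mulVec (fun r => if r = p then Complex.I else 0) x r
  rw [← cpt_zc r a (rotMat p *ᵥ x), rotMat, h]
  by_cases hr : r = p
  · fin_cases a <;> simp [hr, rotCoord]
  · fin_cases a <;> simp [hr]

lemma contDiff_rotCoord (k : Ix) : ContDiff ℝ ∞ (rotCoord k) := by
  unfold rotCoord; split_ifs <;> fun_prop

lemma pd_rotCoord (i k : Ix) (x : V) : pd i (rotCoord k) x =
    if k.2 = 0 then (if i = (k.1, 1) then -1 else 0) else if i = (k.1, 0) then 1 else 0 := by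
  unfold rotCoord
  split_ifs with h1 h2 h3
  · rw [pd_neg, pd_coord, if_pos h2.symm]
  · rw [pd_neg, pd_coord, if_neg (Ne.symm h2), neg_zero]
  · rw [pd_coord, if_pos h3.symm]
  · rw [pd_coord, if_neg (Ne.symm h3)]

section
variable {p q : Fin 2}

lemma contDiff_scale (p : Fin 2) : ContDiff ℝ ∞ fun z : V × ℝ => scale p z.2 z.1 := by
  rw [contDiff_pi]
  intro k
  unfold scale
  split_ifs <;> fun_prop

lemma scale_one (x : V) : scale p 1 x = x := by
  funext k; simp [scale]

variable {u : V → ℝ} (hu : ContDiff ℝ ∞ u)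
include hu

lemma contDiff_scale_comp (p : Fin 2) :
    ContDiff ℝ ∞ (Function.uncurry fun x r => r * u (scale p r x)) :=
  contDiff_snd.mul (hu.comp (contDiff_scale p))

lemma contDiff_rayMean (p : Fin 2) : ContDiff ℝ ∞ (rayMean p u) :=
  contDiff_intervalIntegral (contDiff_scale_comp hu p) _ _

lemma pd_comp_scale (i : Ix) (r : ℝ) (x : V) : pd i (fun y => u (scale p r y)) x =
    (if i.1 = p then r else 1) * pd i u (scale p r x) := by
  have hs : ContDiff ℝ ∞ (scale p r) := by
    rw [contDiff_pi]
    intro k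
    unfold scale
    split_ifs <;> fun_prop
  rw [pd_comp_map hu.diffAt hs.diffAt]
  have e : ∀ k, pd i (fun y => scale p r y k) x =
      if k = i then (if i.1 = p then r else 1) else 0 := fun k => by
    unfold scale
    by_cases hk : k.1 = p
    · simp only [hk, if_true]
      rw [pd_const_mul _ (by fun_prop), pd_coord]
      by_cases h : k = i
      · simp [← h, hk]
      · simp [h]
    · simp only [hk, if_false, pd_coord]
      by_cases h : k = i
      · simp [← h, hk]
      · simp [h]
  simp [e]

lemma pd_rayMean (i : Ix) (x : V) : pd i (rayMean p u) x =
    ∫ r in (0 : ℝ)..1, r * ((if i.1 = p then r else 1) * pd i u (scale p r x)) := by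
  unfold rayMean
  rw [pd_intervalIntegral (contDiff_scale_comp hu p)]
  refine intervalIntegral.integral_congr fun r _ => ?_
  have hs : ContDiff ℝ ∞ fun y => u (scale p r y) :=
    hu.comp ((contDiff_scale p).comp (contDiff_prodMk_left r))
  rw [← pd_comp_scale hu]
  exact pd_const_mul _ hs.diffAt

omit hu in
lemma continuous_comp_scale {v : V → ℝ} (hv : Continuous v) (x : V) :
    Continuous fun r => v (scale p r x) :=
  hv.comp ((contDiff_scale p).continuous.comp (Continuous.prodMk_right x))

lemma hasDerivAt_comp_scale (x : V) (r : ℝ) : HasDerivAt (fun r => u (scale p r x))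
    (x (p, 0) * pd (p, 0) u (scale p r x) + x (p, 1) * pd (p, 1) u (scale p r x)) r := by
  have hs : HasDerivAt (fun r => scale p r x) (fun k => if k.1 = p then x k else 0) r := by
    rw [hasDerivAt_pi]
    intro k
    unfold scale
    split_ifs
    · simpa using (hasDerivAt_id r).mul_const (x k)
    · exact hasDerivAt_const _ _
  have := (hu.diffAt (x := scale p r x)).hasFDerivAt.comp_hasDerivAt r hs
  rw [fderiv_apply_eq_sum] at this
  obtain ⟨q, hqp⟩ := exists_ne p
  have hpq := hqp.symm
  rw [sum_Ix hpq] at this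
  simp only [hqp, if_true, if_false, zero_mul, add_zero] at this
  exact this

/-- Euler's identity for the weighted mean. -/
lemma rayMean_euler (x : V) : 2 * rayMean p u x + (x (p, 0) * pd (p, 0) (rayMean p u) x +
    x (p, 1) * pd (p, 1) (rayMean p u) x) = u x := by
  have hd : ∀ r ∈ Set.uIcc (0 : ℝ) 1, HasDerivAt (fun r => r ^ 2 * u (scale p r x))
      (2 * (r * u (scale p r x)) + (x (p, 0) * (r * (r * pd (p, 0) u (scale p r x))) +
        x (p, 1) * (r * (r * pd (p, 1) u (scale p r x))))) r := fun r _ => by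
    refine ((hasDerivAt_pow 2 r).mul (hasDerivAt_comp_scale hu x r)).congr_deriv ?_
    push_cast
    ring
  have c0 : Continuous fun r => scale p r x :=
    (contDiff_scale p).continuous.comp (Continuous.prodMk_right x)
  have c1 := hu.continuous
  have c2 := fun a => (contDiff_pd (i := (p, a)) hu).continuous
  have h := intervalIntegral.integral_eq_sub_of_hasDerivAt hd
    (Continuous.intervalIntegrable (by fun_prop) _ _)
  rw [intervalIntegral.integral_add (Continuous.intervalIntegrable (by fun_prop) _ _)
    (Continuous.intervalIntegrable (by fun_prop) _ _),
    intervalIntegral.integral_add (Continuous.intervalIntegrable (by fun_prop) _ _)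
    (Continuous.intervalIntegrable (by fun_prop) _ _), intervalIntegral.integral_const_mul,
    intervalIntegral.integral_const_mul, intervalIntegral.integral_const_mul, scale_one] at h
  rw [pd_rayMean hu, pd_rayMean hu]
  simp only [if_true, rayMean]
  rw [h]; simp

/-- The weighted mean of a rotationally invariant function is rotationally invariant. -/
lemma rayMean_invariant {r : Fin 2}
    (h : ∀ x, rotCoord (r, 0) x * pd (r, 0) u x + rotCoord (r, 1) x * pd (r, 1) u x = 0) (x : V) :
    rotCoord (r, 0) x * pd (r, 0) (rayMean p u) x +
      rotCoord (r, 1) x * pd (r, 1) (rayMean p u) x = 0 := by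
  have c1 := fun i => continuous_comp_scale (p := p) (contDiff_pd (i := i) hu).continuous x
  rw [pd_rayMean hu, pd_rayMean hu, ← intervalIntegral.integral_const_mul,
    ← intervalIntegral.integral_const_mul, ← intervalIntegral.integral_add
    (Continuous.intervalIntegrable (by split_ifs <;> fun_prop) _ _)
    (Continuous.intervalIntegrable (by split_ifs <;> fun_prop) _ _)]
  rw [intervalIntegral.integral_congr (g := fun _ => 0) fun s _ => ?_]
  · simp
  · have := h (scale p s x)
    by_cases hr : r = p
    · simp only [rotCoord, scale, hr, if_true, one_ne_zero, if_false] at this ⊢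
      linear_combination s * this
    · simp only [rotCoord, scale, hr, if_true, one_ne_zero, if_false] at this ⊢
      linear_combination s * this

end

/-! ### The moment maps -/

section
variable {P : V → Matrix Ix Ix ℝ} (hP : ∀ i j, ContDiff ℝ ∞ fun x => P x i j)
  (ha : ∀ x, (P x)ᵀ = -P x)
  (hc : ∀ x i j k, pd i (fun y => P y j k) x + pd j (fun y => P y k i) x +
      pd k (fun y => P y i j) x = 0)
  {p q : Fin 2} (hpq : p ≠ q)
include hP ha

omit hP in
lemma contract_left (x : V) (a : Fin 2) :
    contract (rotMat p) P x (p, a) = -(x (p, a) * P x (p, 0) (p, 1)) := by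
  obtain ⟨q, hqp⟩ := exists_ne p
  have hpq := hqp.symm
  have ha' : ∀ i j, P x i j = -P x j i := fun i j => congrFun₂ (ha x) j i
  have h0 : ∀ i, P x i i = 0 := fun i => by linarith [ha' i i]
  simp only [contract, rotMat_mulVec, sum_Ix hpq, hpq.symm, if_true, if_false]
  fin_cases a
  · simp [rotCoord, h0, ha' (p, 1) (p, 0)]
  · simp [rotCoord, h0]

omit hP ha in
include hpq in
lemma contract_right (x : V) (b : Fin 2) : contract (rotMat p) P x (q, b) =
    rotCoord (p, 0) x * P x (p, 0) (q, b) + rotCoord (p, 1) x * P x (p, 1) (q, b) := by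
  simp [contract, rotMat_mulVec, sum_Ix hpq, hpq.symm]

omit ha in
lemma contDiff_contract (K : Matrix Ix Ix ℝ) (j : Ix) :
    ContDiff ℝ ∞ fun x => contract K P x j := by
  simp only [contract]
  exact ContDiff.sum fun k _ => (contDiff_mulVec _ k).mul (hP k j)

omit hP ha in
lemma area_invariant {r : Fin 2} (hL : ∀ x, lieLin (rotMat r) P x = 0) (p : Fin 2) (x : V)
    (ha : ∀ x, (P x)ᵀ = -P x) :
    rotCoord (r, 0) x * pd (r, 0) (fun y => P y (p, 0) (p, 1)) x +
      rotCoord (r, 1) x * pd (r, 1) (fun y => P y (p, 0) (p, 1)) x = 0 := by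
  have h := congrFun₂ (hL x) (p, 0) (p, 1)
  have ha' : ∀ i j, P x i j = -P x j i := fun i j => congrFun₂ (ha x) j i
  have h0 : ∀ i, P x i i = 0 := fun i => by linarith [ha' i i]
  obtain ⟨s, hsr⟩ := exists_ne r
  have hrs := hsr.symm
  simp only [lieLin, Matrix.add_apply, Matrix.smul_apply, smul_eq_mul, pdm,
    Matrix.of_apply, rotMat_mulVec, sum_Ix hrs, Matrix.mul_apply, Matrix.transpose_apply,
    Matrix.zero_apply] at h
  have e : ∀ i j, rotMat r i j = if i.1 = j.1 then mulMat (if i.1 = r then Complex.I else 0) i.2 j.2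
    else 0 := fun i j => rfl
  simp only [e] at h
  by_cases hp : p = r
  · subst hp
    simp [hrs.symm, mulMat, h0] at h
    linarith
  · have hps : p = s := (eq_or_eq_of_ne hrs p).resolve_left hp
    subst hps
    simp [hrs, hrs.symm, mulMat] at h
    linarith

include hc

include hpq in
/-- The differential of the moment map of a rotation in the directions of the other factor. -/
lemma contract_right_eq (hL : ∀ x, lieLin (rotMat p) P x = 0) (x : V) (b : Fin 2) :
    contract (rotMat p) P x (q, b) =
      -(nsq p x * pd (q, b) (rayMean p fun y => P y (p, 0) (p, 1)) x) := by
  have hPs : ∀ x, SmoothMatAt P x := fun x i j => (hP i j).contDiffAt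
  have hρ := hP (p, 0) (p, 1)
  -- the contraction of an invariant closed form with the rotation field is closed
  have hcl : ∀ y a, pd (p, a) (fun y => contract (rotMat p) P y (q, b)) y =
      -(y (p, a) * pd (q, b) (fun y => P y (p, 0) (p, 1)) y) := fun y a => by
    have h1 := lieLin_eq hPs (rotMat p) ha (hc y) (p, a) (q, b)
    rw [hL, Matrix.zero_apply] at h1
    rw [sub_eq_zero.1 h1]
    simp only [contract_left ha]
    have hne : ((p, a) : Ix) ≠ (q, b) := fun h => hpq (congrArg Prod.fst h)
    rw [pd_neg, pd_mul (by fun_prop) hρ.diffAt, pd_coord, if_neg hne]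
    ring
  have hd : ∀ r ∈ Set.uIcc (0 : ℝ) 1, HasDerivAt
      (fun r => contract (rotMat p) P (scale p r x) (q, b))
      (-(nsq p x * (r * (1 * pd (q, b) (fun y => P y (p, 0) (p, 1)) (scale p r x))))) r :=
    fun r _ => by
    refine (hasDerivAt_comp_scale (contDiff_contract hP (rotMat p) (q, b)) x r).congr_deriv ?_
    rw [hcl, hcl]
    simp only [scale, if_true, nsq]
    ring
  have c0 : Continuous fun r => scale p r x :=
    (contDiff_scale p).continuous.comp (Continuous.prodMk_right x)
  have c2 := (contDiff_pd (i := (q, b)) hρ).continuous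
  have h := intervalIntegral.integral_eq_sub_of_hasDerivAt hd
    (Continuous.intervalIntegrable (by fun_prop) _ _)
  rw [scale_one, contract_right hpq (scale p 0 x), intervalIntegral.integral_neg,
    intervalIntegral.integral_const_mul] at h
  rw [pd_rayMean hρ]
  simp only [hpq.symm, if_false]
  rw [h]
  simp [rotCoord, scale]

omit hc in
/-- The differential of the moment map of a rotation in the directions of its own factor. -/
lemma contract_left_eq (hL : ∀ x, lieLin (rotMat p) P x = 0) (x : V) (a : Fin 2) :
    contract (rotMat p) P x (p, a) =
      -pd (p, a) (fun y => nsq p y * rayMean p (fun y => P y (p, 0) (p, 1)) y) x := by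
  have hρ := hP (p, 0) (p, 1)
  have hinv := rayMean_invariant (p := p) hρ (area_invariant hL p · ha) x
  rw [contract_left ha, pd_mul (contDiff_nsq p).diffAt (contDiff_rayMean hρ p).diffAt, pd_nsq,
    if_pos rfl, ← rayMean_euler hρ x]
  simp only [rotCoord, if_true, one_ne_zero, if_false] at hinv
  fin_cases a
  · simp only [Fin.zero_eta, nsq]
    linear_combination -x (p, 1) * hinv
  · simp only [Fin.mk_one, nsq]
    linear_combination x (p, 0) * hinv

/-- The moment map of a rotation. -/
lemma contract_eq (hL : ∀ x, lieLin (rotMat p) P x = 0) (x : V) (k : Ix) :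
    contract (rotMat p) P x k =
      -pd k (fun y => nsq p y * rayMean p (fun y => P y (p, 0) (p, 1)) y) x := by
  obtain ⟨r, a⟩ := k
  by_cases h : r = p
  · subst h
    exact contract_left_eq hP ha hL x a
  · have hρ := hP (p, 0) (p, 1)
    rw [contract_right_eq hP ha hc (Ne.symm h) hL,
      pd_mul (contDiff_nsq p).diffAt (contDiff_rayMean hρ p).diffAt, pd_nsq, if_neg h]
    ring

omit hP ha hc in
lemma dense_ne_zero (p q : Fin 2) : Dense {x : V | nsq p x ≠ 0 ∧ nsq q x ≠ 0} := by
  intro x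
  have h1 : ∀ r, ∀ᶠ t : ℝ in 𝓝[≠] 0, nsq r (fun k => x k + t) ≠ 0 := fun r => by
    have : ∀ᶠ t : ℝ in 𝓝[≠] 0, x (r, 0) + t ≠ 0 := by
      by_cases h : x (r, 0) = 0
      · filter_upwards [self_mem_nhdsWithin] with t ht
        simpa [h] using ht
      · exact nhdsWithin_le_nhds ((continuous_const.add continuous_id).continuousAt.eventually_ne
          (by simpa using h))
    filter_upwards [this] with t ht
    have : 0 < (x (r, 0) + t) ^ 2 := by positivity
    unfold nsq
    positivity
  have h2 : Filter.Tendsto (fun t : ℝ => fun k => x k + t) (𝓝[≠] 0) (𝓝 x) := by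
    have : Continuous fun t : ℝ => (fun k => x k + t : V) := by fun_prop
    simpa using (this.tendsto 0).mono_left nhdsWithin_le_nhds
  exact mem_closure_of_tendsto h2 ((h1 p).and (h1 q))

omit hP ha hc in
/-- The solution of the linear system of `eq_exterior_derivative` at one point. -/
lemma mixed_components {xp yp xq yq s t A₀ A₁ B₀ B₁ : ℝ} (hp : xp ^ 2 + yp ^ 2 ≠ 0)
    (hq : xq ^ 2 + yq ^ 2 ≠ 0)
    (e1 : -yp * s + xp * -t = -((xp ^ 2 + yp ^ 2) * B₀))
    (e2 : -yp * t + xp * s = -((xp ^ 2 + yp ^ 2) * B₁))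
    (e3 : -yq * -s + xq * -t = -((xq ^ 2 + yq ^ 2) * A₀))
    (e4 : -yq * t + xq * -s = -((xq ^ 2 + yq ^ 2) * A₁))
    (i1 : -yq * B₀ + xq * B₁ = 0) :
    s = -yq * A₀ - -yp * B₀ ∧ t = xq * A₀ - -yp * B₁ ∧ -t = -yq * A₁ - xp * B₀ ∧
      s = xq * A₁ - xp * B₁ := by
  have hs : s = yp * B₀ - xp * B₁ := by
    apply mul_left_cancel₀ hp
    linear_combination -yp * e1 + xp * e2
  have ht : t = xp * B₀ + yp * B₁ := by
    apply mul_left_cancel₀ hp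
    linear_combination -xp * e1 - yp * e2
  subst hs ht
  have k1 : yq * A₀ = xp * B₁ := by
    apply mul_left_cancel₀ hq
    linear_combination yq * e3 + (yq * yp - xq * xp) * i1
  have k2 : xq * A₀ = xp * B₀ := by
    apply mul_left_cancel₀ hq
    linear_combination xq * e3 + (xq * yp + yq * xp) * i1
  have k3 : yq * A₁ = yp * B₁ := by
    apply mul_left_cancel₀ hq
    linear_combination yq * e4 - (xq * yp + yq * xp) * i1
  have k4 : xq * A₁ = yp * B₀ := by
    apply mul_left_cancel₀ hq
    linear_combination xq * e4 + (yq * yp - xq * xp) * i1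
  exact ⟨by linear_combination k1, by linear_combination -k2, by linear_combination k3,
    by linear_combination -k4⟩

end

/-- The sum `∑ h_p dθ_p` over the two rotations, with moment maps `h_p` normalized to vanish at
`z_p = 0`; here `h_p = |z_p|² f_p` with a smooth function `f_p`. -/
def primitive (P : V → Matrix Ix Ix ℝ) (k : Ix) (x : V) : ℝ :=
  rotCoord k x * rayMean k.1 (fun y => P y (k.1, 0) (k.1, 1)) x

section
variable {P : V → Matrix Ix Ix ℝ} (hP : ∀ i j, ContDiff ℝ ∞ fun x => P x i j)
include hP

lemma contDiff_primitive (k : Ix) : ContDiff ℝ ∞ (primitive P k) :=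
  (contDiff_rotCoord k).mul (contDiff_rayMean (hP _ _) _)

/-- A closed `J`-invariant 2-form which is invariant under both rotations is the exterior
derivative of `∑ h_p dθ_p`. -/
lemma eq_exterior_derivative (ha : ∀ x, (P x)ᵀ = -P x)
    (hc : ∀ x i j k, pd i (fun y => P y j k) x + pd j (fun y => P y k i) x +
      pd k (fun y => P y i j) x = 0) (hJ : ∀ x, Jmatᵀ * P x * Jmat = P x)
    (hL : ∀ p x, lieLin (rotMat p) P x = 0) (x : V) (i j : Ix) :
    P x i j = pd i (primitive P j) x - pd j (primitive P i) x := by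
  have hcont : Continuous fun x => pd i (primitive P j) x - pd j (primitive P i) x :=
    (contDiff_pd (contDiff_primitive hP j)).continuous.sub
      (contDiff_pd (contDiff_primitive hP i)).continuous
  refine congrFun (Continuous.ext_on (dense_ne_zero 0 1) (hP i j).continuous hcont ?_) x
  intro x hx
  set f : Fin 2 → V → ℝ := fun p => rayMean p (fun y => P y (p, 0) (p, 1)) with hf
  have hfs : ∀ p, ContDiff ℝ ∞ (f p) := fun p => contDiff_rayMean (hP _ _) p
  have hd : ∀ k l, pd l (primitive P k) x =
      (if k.2 = 0 then (if l = (k.1, 1) then -1 else 0) else if l = (k.1, 0) then 1 else 0) *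
        f k.1 x + rotCoord k x * pd l (f k.1) x := fun k l => by
    have e : primitive P k = fun x => rotCoord k x * f k.1 x := rfl
    rw [e, pd_mul (contDiff_rotCoord k).diffAt (hfs _).diffAt, pd_rotCoord]
  have key : P x = Matrix.of fun i j => pd i (primitive P j) x - pd j (primitive P i) x := by
    refine antisymm_ext (p := 0) (q := 1) (ha x) ?_ zero_ne_one ?_ ?_ ?_
    · ext i j; simp
    · have := rayMean_euler (hP (0, 0) (0, 1)) x (p := 0)
      simp only [Matrix.of_apply, hd, hf, rotCoord]
      simp
      linear_combination -this
    · have := rayMean_euler (hP (1, 0) (1, 1)) x (p := 1)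
      simp only [Matrix.of_apply, hd, hf, rotCoord]
      simp
      linear_combination -this
    · have ha' : ∀ i j, P x i j = -P x j i := fun i j => congrFun₂ (ha x) j i
      have hJ' : ∀ a b : Fin 2, (Jmatᵀ * P x * Jmat) (0, a) (1, b) = P x (0, a) (1, b) :=
        fun a b => by rw [hJ]
      simp only [Jmat_eq_blk, blk_mul_apply, Fin.sum_univ_two, mulMat] at hJ'
      have j1 := hJ' 0 0
      have j2 := hJ' 1 0
      simp at j1 j2
      have c1 := fun b => contract_right_eq hP ha hc (zero_ne_one (α := Fin 2)) (hL 0) x b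
      have c2 := fun b => contract_right_eq hP ha hc (one_ne_zero (α := Fin 2)) (hL 1) x b
      simp only [contract_right (zero_ne_one (α := Fin 2))] at c1
      simp only [contract_right (one_ne_zero (α := Fin 2)), ha' (1, _)] at c2
      have i1 := rayMean_invariant (p := 0) (hP (0, 0) (0, 1))
        (area_invariant (hL 1) 0 · ha) x
      have c10 := c1 0
      have c11 := c1 1
      have c20 := c2 0
      have c21 := c2 1
      simp only [rotCoord, if_true, one_ne_zero, if_false, nsq, j1, ← j2, neg_neg] at c10 c11 c20 c21 i1
      obtain ⟨r1, r2, r3, r4⟩ := mixed_components hx.1 hx.2 c10 c11 c20 c21 i1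
      intro a b
      simp only [Matrix.of_apply, hd, rotCoord, hf]
      fin_cases a <;> fin_cases b <;> simp
      all_goals linarith
  exact congrFun₂ key i j

end

/-! ### Exactness of invariant 2-forms without periods -/

lemma blk_rotGen (p : Fin 2) (c : Chart) : blk (rotGen p c) = sgn (c p) • rotMat p := by
  ext ⟨r, a⟩ ⟨s, b⟩
  simp only [blk, rotMat, rotGen, Matrix.smul_apply, Matrix.of_apply, smul_eq_mul, mulMat]
  split_ifs <;> simp

lemma contract_smul (a : ℝ) (K : Matrix Ix Ix ℝ) (P : V → Matrix Ix Ix ℝ) (x : V) (j : Ix) :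
    contract (a • K) P x j = a * contract K P x j := by
  simp only [contract, Matrix.smul_mulVec, Pi.smul_apply, smul_eq_mul, Finset.mul_sum, mul_assoc]

lemma lieLin_smul (a : ℝ) (K : Matrix Ix Ix ℝ) (P : V → Matrix Ix Ix ℝ) (x : V) :
    lieLin (a • K) P x = a • lieLin K P x := by
  simp only [lieLin, Matrix.transpose_smul, Matrix.smul_mul, Matrix.mul_smul, Matrix.smul_mulVec,
    Pi.smul_apply, smul_add, Finset.smul_sum, smul_smul, smul_eq_mul]

lemma sgn_ne_zero (i : Fin 2) : sgn i ≠ 0 := by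
  rcases sgn_cases i with h | h <;> simp [h]

lemma lieLin_rotMat_of_invariant {F : Tensor2} (hF : IsTensorField F) {p : Fin 2}
    (h : ∀ u, rotate p u F = F) (c : Chart) (x : V) : lieLin (rotMat p) (F c) x = 0 := by
  have := lieLin_of_invariant p hF h c x
  rw [blk_rotGen, lieLin_smul] at this
  exact (smul_eq_zero.1 this).resolve_left (sgn_ne_zero _)

/-- The area density of the factor `p`. -/
def area (p : Fin 2) (F : Tensor2) (c : Chart) (x : V) : ℝ := F c x (p, 0) (p, 1)

/-- The moment map of the rotation of the factor `p` which vanishes at the origin of the chart. -/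
def moment (p : Fin 2) (F : Tensor2) (c : Chart) (x : V) : ℝ :=
  nsq p x * rayMean p (area p F c) x

lemma area_transition {F : Tensor2} (hF : IsTwoForm F) {c c' : Chart} {x x' : V}
    (h : par c x = par c' x') (p : Fin 2) :
    area p F c x = ‖dz c c' x p‖ ^ 2 * area p F c' x' := by
  have ha' : ∀ i j, F c' x' i j = -F c' x' j i := fun i j => congrFun₂ (hF.2 c' x') j i
  have h0 : ∀ i, F c' x' i i = 0 := fun i => by linarith [ha' i i]
  rw [area, isPullback_id_iff.1 hF.1.2 _ _ _ _ h, blk_mul_apply, ← Complex.normSq_eq_norm_sq,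
    Complex.normSq_apply]
  simp only [Fin.sum_univ_two, h0, ha' (p, 1) (p, 0), mulMat, area]
  simp
  ring

lemma zc_scale (p r : Fin 2) (s : ℝ) (x : V) :
    zc r (scale p s x) = (if r = p then (s : ℂ) else 1) * zc r x := by
  apply Complex.ext <;> by_cases h : r = p <;> simp [scale, h]

lemma rayMean_area_transition {F : Tensor2} (hF : IsTwoForm F) {c c' : Chart} {x x' : V} {p : Fin 2}
    (h : par c x = par c' x') (hp : c p = c' p) :
    rayMean p (area p F c) x = rayMean p (area p F c') x' := by
  unfold rayMean
  refine intervalIntegral.integral_congr fun s _ => ?_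
  have h2 : par c (scale p s x) = par c' (scale p s x') := by
    rw [par_eq_par_iff] at h ⊢
    intro r
    rw [zc_scale, zc_scale]
    rcases h r with ⟨h1, h2⟩ | ⟨h1, h2⟩
    · exact Or.inl ⟨h1, by rw [h2]⟩
    · have hr : r ≠ p := by rintro rfl; exact h1 hp
      exact Or.inr ⟨h1, by simpa [hr] using h2⟩
  have := area_transition hF h2 p
  rw [norm_dz_sq, if_pos hp, one_mul] at this
  simp only [this]

lemma moment_transition {F : Tensor2} (hF : IsTwoForm F) {c c' : Chart} {x x' : V} {p : Fin 2}
    (h : par c x = par c' x') (hp : c p = c' p) : moment p F c x = moment p F c' x' := by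
  rw [moment, moment, rayMean_area_transition hF h hp, ← norm_zc_sq, ← norm_zc_sq,
    zc_of_par_eq h, if_pos hp]

/-- The point of a chart with the coordinates `z` on the factor `p` and `w` on the other one. -/
def point (p : Fin 2) (z w : ℂ) : V := ofZ fun r => if r = p then z else w

lemma contDiffAt_transition {c c' : Chart} {x : V} (h : ∀ r, c r ≠ c' r → zc r x ≠ 0) :
    ContDiffAt ℝ ∞ (coord c' ∘ par c) x := by
  rw [contDiffAt_pi]
  rintro ⟨r, a⟩
  have h1 : ContDiffAt ℝ ∞ (fun y => if c r = c' r then zc r y else (zc r y)⁻¹) x := by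
    by_cases hr : c r = c' r
    · simpa only [hr, if_true] using (contDiff_zc r).contDiffAt
    · simp only [hr, if_false]
      exact (contDiff_zc r).contDiffAt.inv (h r hr)
  simp only [Function.comp_apply, coord_par, ofZ, cpt]
  by_cases ha : a = 0
  · simp only [ha, if_true]
    exact Complex.reCLM.contDiff.contDiffAt.comp x h1
  · simp only [ha, if_false]
    exact Complex.imCLM.contDiff.contDiffAt.comp x h1

section
variable {F : Tensor2} (hF : IsTwoForm F) (hc : IsClosedForm F)
  (hinv : ∀ p u, rotate p u F = F)
include hF

lemma contDiff_moment (p : Fin 2) (c : Chart) : ContDiff ℝ ∞ (moment p F c) :=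
  (contDiff_nsq p).mul (contDiff_rayMean (hF.1.1 c _ _) p)

include hc hinv

lemma contract_eq_moment (p : Fin 2) (c : Chart) (x : V) (k : Ix) :
    contract (rotMat p) (F c) x k = -pd k (moment p F c) x :=
  contract_eq (fun i j => hF.1.1 c i j) (hF.2 c) (hc c)
    (lieLin_rotMat_of_invariant hF.1 (hinv p) c) x k

/-- The sum of the moment maps normalized at the two poles is locally constant. -/
lemma pd_moment_add_moment {p : Fin 2} {c c' : Chart} (hp : c p ≠ c' p) {x : V}
    (hx : ∀ r, c r ≠ c' r → zc r x ≠ 0) (k : Ix) :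
    pd k (fun y => moment p F c y + moment p F c' (coord c' (par c y))) x = 0 := by
  have h := par_eq_ofZ hx
  have hx' : coord c' (par c x) = _ := coord_par c c' x
  have hψ := contDiffAt_transition hx
  have h1 := contract_transition (p := p) hF.1 h
  have hs : sgn (c' p) = -sgn (c p) := by
    have h2 : c p = 0 ∨ c p = 1 := by omega
    have h3 : c' p = 0 ∨ c' p = 1 := by omega
    rcases h2 with h2 | h2 <;> rcases h3 with h3 | h3 <;> simp [h2, h3, sgn] at hp ⊢
  have h2 := congrFun h1 k
  simp only [blk_rotGen, Matrix.mulVec, dotProduct, contract_smul, hs,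
    contract_eq_moment hF hc hinv, Matrix.transpose_apply] at h2
  rw [← hx'] at h2
  have hm : DifferentiableAt ℝ (fun y => moment p F c' ((coord c' ∘ par c) y)) x :=
    (contDiff_moment hF p c').diffAt.comp x hψ.diffAt
  have hj : ∀ m, pd k (fun y => (coord c' ∘ par c) y m) x = blk (dz c c' x) m k := fun m => by
    rw [← jac_transition hx]; rfl
  have e := pd_comp_map (i := k) (u := moment p F c') (φ := coord c' ∘ par c)
    (contDiff_moment hF p c').diffAt hψ.diffAt
  simp only [hj] at e
  have h3 := pd_add (i := k) (contDiff_moment hF p c).diffAt hm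
  refine h3.trans ?_
  rw [e]
  have h4 : sgn (c p) * (pd k (moment p F c) x + ∑ m, blk (dz c c' x) m k *
      pd m (moment p F c') ((coord c' ∘ par c) x)) = 0 := by
    have : ∑ m, blk (dz c c' x) m k * (-sgn (c p) * -pd m (moment p F c') (coord c' (par c x))) =
        sgn (c p) * ∑ m, blk (dz c c' x) m k *
          pd m (moment p F c') ((coord c' ∘ par c) x) := by
      rw [Finset.mul_sum]
      exact Finset.sum_congr rfl fun m _ => by simp only [Function.comp_apply]; ring
    rw [this] at h2
    linarith
  exact (mul_eq_zero.1 h4).resolve_left (sgn_ne_zero _)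

/-- The sum of the moment maps does not change along the paths `(e^{st} z, w(s))`. -/
lemma moment_add_moment_eq {p : Fin 2} {c c' : Chart} (hp : c p ≠ c' p)
    (hp' : ∀ r, r ≠ p → c r = c' r) {z : ℂ} (hz : z ≠ 0) (w w' : ℂ) (t : ℝ) :
    moment p F c (point p z w) + moment p F c' (point p z⁻¹ w) =
      moment p F c (point p (Real.exp t * z) w') + moment p F c' (point p (Real.exp t * z)⁻¹ w') := by
  -- the path stays in the common domain of the two charts, where `D` is locally constant
  set D : V → ℝ := fun y => moment p F c y + moment p F c' (coord c' (par c y)) with hD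
  have hval : ∀ (z w : ℂ), D (point p z w) =
      moment p F c (point p z w) + moment p F c' (point p z⁻¹ w) := fun z w => by
    simp only [hD]
    congr 2
    rw [coord_par]
    congr 1
    funext r
    by_cases hr : r = p
    · subst hr; simp [hp, point]
    · simp [hp' r hr, hr, point]
  set γ : ℝ → V := fun s => point p (Real.exp (s * t) * z) (w + s * (w' - w)) with hγ
  have hγs : Differentiable ℝ γ := by
    rw [differentiable_pi]
    rintro ⟨r, a⟩
    have h1 : Differentiable ℝ fun s : ℝ => ((Real.exp (s * t) : ℝ) : ℂ) * z :=
      (Complex.ofRealCLM.differentiable.comp (by fun_prop)).mul_const z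
    have h2 : Differentiable ℝ fun s : ℝ => w + (s : ℂ) * (w' - w) :=
      (Complex.ofRealCLM.differentiable.mul_const _).const_add w
    have h3 : Differentiable ℝ fun s : ℝ => if r = p then ((Real.exp (s * t) : ℝ) : ℂ) * z
        else w + (s : ℂ) * (w' - w) := by split_ifs <;> assumption
    simp only [hγ, point, ofZ, cpt]
    by_cases ha : a = 0
    · simp only [ha, if_true]
      exact Complex.reCLM.differentiable.comp h3
    · simp only [ha, if_false]
      exact Complex.imCLM.differentiable.comp h3
  have hγ0 : ∀ s r, c r ≠ c' r → zc r (γ s) ≠ 0 := fun s r hr => by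
    have : r = p := by by_contra h; exact hr (hp' r h)
    subst this
    simp [hγ, point, hz]
  have hDd : ∀ s, DifferentiableAt ℝ D (γ s) := fun s =>
    (contDiff_moment hF p c).diffAt.add ((contDiff_moment hF p c').diffAt.comp _
      (contDiffAt_transition (hγ0 s)).diffAt)
  have hd : ∀ s, HasDerivAt (D ∘ γ) 0 s := fun s => by
    have := (hDd s).hasFDerivAt.comp_hasDerivAt s (hγs s).hasDerivAt
    rw [fderiv_apply_eq_sum] at this
    rwa [Finset.sum_eq_zero fun k _ => by
      rw [pd_moment_add_moment hF hc hinv hp (hγ0 s) k, mul_zero]] at this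
  have := is_const_of_deriv_eq_zero (fun s => (hd s).differentiableAt) (fun s => (hd s).deriv) 0 1
  rw [← hval, ← hval]
  simpa [hγ] using this

end

lemma zc_point_self (p : Fin 2) (z w : ℂ) : zc p (point p z w) = z := by simp [point]

lemma zc_point_of_ne {p r : Fin 2} (h : r ≠ p) (z w : ℂ) : zc r (point p z w) = w := by
  simp [point, h]

lemma point_zc {p q : Fin 2} (hpq : p ≠ q) (x : V) : point p (zc p x) (zc q x) = x := by
  refine ext_zc fun r => ?_
  rcases eq_or_eq_of_ne hpq r with rfl | rfl
  · exact zc_point_self _ _ _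
  · exact zc_point_of_ne hpq.symm _ _

lemma continuous_point (p : Fin 2) : Continuous fun z : ℂ × ℂ => point p z.1 z.2 := by
  rw [continuous_pi_iff]
  rintro ⟨r, a⟩
  have h : Continuous fun z : ℂ × ℂ => if r = p then z.1 else z.2 := by
    split_ifs <;> fun_prop
  simp only [point, ofZ, cpt]
  by_cases ha : a = 0
  · simp only [ha, if_true]
    exact Complex.continuous_re.comp h
  · simp only [ha, if_false]
    exact Complex.continuous_im.comp h

lemma moment_of_zc_eq_zero {F : Tensor2} {p : Fin 2} {c : Chart} {x : V} (h : zc p x = 0) :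
    moment p F c x = 0 := by
  rw [moment, ← norm_zc_sq, h]; simp

section
variable {F : Tensor2} (hF : IsTwoForm F) (hc : IsClosedForm F)
  (hinv : ∀ p u, rotate p u F = F)
  (hlim : ∀ p z, z ≠ 0 → Filter.Tendsto
    (fun t : ℝ => moment p F 0 (point p (Real.exp t * z) 0)) Filter.atTop (𝓝 0))
include hF hc hinv hlim

/-- If the moment map normalized at one pole of the factor `p` tends to `0` at the other pole, along
the curve on which the other coordinate is `0`, then the two normalizations agree; here for the
charts which are standard on the other factor. -/
lemma moment_add_moment_zero (p : Fin 2) {z : ℂ} (hz : z ≠ 0) (w : ℂ) :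
    moment p F 0 (point p z w) + moment p F (Function.update 0 p 1) (point p z⁻¹ w) = 0 := by
  set c' : Chart := Function.update 0 p 1
  have hp : (0 : Chart) p ≠ c' p := by simp [c']
  have hp' : ∀ r, r ≠ p → (0 : Chart) r = c' r := fun r hr => by simp [c', hr]
  have h1 : Filter.Tendsto (fun t : ℝ => moment p F c' (point p (Real.exp t * z)⁻¹ 0))
      Filter.atTop (𝓝 0) := by
    have h2 : Filter.Tendsto (fun t : ℝ => ((Real.exp t : ℂ) * z)⁻¹) Filter.atTop (𝓝 0) := by
      have h3 : Filter.Tendsto (fun t : ℝ => ((Real.exp (-t) : ℝ) : ℂ) * z⁻¹) Filter.atTop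
          (𝓝 (((0 : ℝ) : ℂ) * z⁻¹)) :=
        ((Complex.continuous_ofReal.tendsto 0).comp
          (Real.tendsto_exp_neg_atTop_nhds_zero)).mul_const _
      rw [Complex.ofReal_zero, zero_mul] at h3
      refine h3.congr fun t => ?_
      rw [mul_inv, ← Complex.ofReal_inv, ← Real.exp_neg]
    have h4 := ((contDiff_moment hF p c').continuous.comp
      ((continuous_point p).comp (Continuous.prodMk_left (0 : ℂ)))).tendsto 0
    have h5 := h4.comp h2
    simp only [Function.comp_apply] at h5
    rw [moment_of_zc_eq_zero (zc_point_self p 0 0)] at h5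
    exact h5
  have h2 := (hlim p z hz).add h1
  rw [add_zero] at h2
  -- the sum does not depend on `t`, and both terms tend to `0`
  refine tendsto_nhds_unique (tendsto_const_nhds.congr fun t => ?_) h2
  exact moment_add_moment_eq hF hc hinv hp hp' hz w 0 t

/-- The general choice of the chart on the other factor reduces to the standard one at the points
where the other coordinate is `1`. -/
lemma moment_add_moment_zero' {p : Fin 2} {c : Chart} (hc0 : c p = 0) {z : ℂ} (hz : z ≠ 0)
    (w : ℂ) :
    moment p F c (point p z w) + moment p F (Function.update c p 1) (point p z⁻¹ w) = 0 := by
  have h := moment_add_moment_zero hF hc hinv hlim p hz 1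
  have h1 := moment_add_moment_eq hF hc hinv (p := p) (c := c) (c' := Function.update c p 1)
    (by simp [hc0]) (fun r hr => by simp [hr]) hz w 1 0
  rw [h1, Real.exp_zero, Complex.ofReal_one, one_mul, ← h]
  congr 1
  · refine moment_transition hF (par_eq_par_iff.2 fun r => ?_) hc0
    by_cases hr : r = p
    · subst hr; simp [hc0]
    · rw [zc_point_of_ne hr]
      by_cases h0 : c r = 0 <;> simp [h0]
  · refine moment_transition hF (par_eq_par_iff.2 fun r => ?_) (by simp)
    by_cases hr : r = p
    · subst hr; simp
    · rw [zc_point_of_ne hr]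
      by_cases h0 : c r = 0 <;> simp [hr, h0]

/-- The moment maps normalized at the two poles of the factor `p` are opposite to each other. -/
lemma moment_add_moment {p : Fin 2} {c c' : Chart} (hp : c p ≠ c' p) {x x' : V}
    (h : par c x = par c' x') : moment p F c x + moment p F c' x' = 0 := by
  wlog h0 : c p = 0 generalizing c c' x x'
  · rw [add_comm]
    exact this hp.symm h.symm (by omega)
  have hz := zc_ne_zero_of_par_eq h hp
  obtain ⟨q, hq⟩ := exists_ne p
  have h1 : c' p = 1 := by omega
  have h2 := moment_add_moment_zero' hF hc hinv hlim h0 hz (zc q x)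
  rw [point_zc hq.symm] at h2
  rw [← h2]
  congr 1
  -- both charts agree on the factor `p`, so only the other factor has to be compared
  refine (moment_transition hF ?_ (by simp [h1])).symm
  rw [← h, eq_comm, par_eq_par_iff]
  intro r
  rcases eq_or_eq_of_ne hq.symm r with rfl | rfl
  · right; simp [zc_point_self, h0, hz]
  · left; simp [zc_point_of_ne hq, hq]

/-- The primitives of the charts fit together. -/
lemma isOneForm_primitive : IsOneForm fun c x k => primitive (F c) k x := by
  refine ⟨fun c k => contDiff_primitive (fun i j => hF.1.1 c i j) k, fun c c' x x' h => ?_⟩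
  rw [jac_transition_of_eq h]
  funext ⟨p, a⟩
  have e : (((blk (dz c c' x))ᵀ *ᵥ fun k => primitive (F c') k x') (p, a)) =
      ∑ b, mulMat (dz c c' x p) b a * primitive (F c') (p, b) x' := by
    simp only [Matrix.mulVec, dotProduct, Matrix.transpose_apply, blk, Matrix.of_apply,
      Fintype.sum_prod_type]
    fin_cases p <;> simp [Fin.sum_univ_two]
  rw [e]
  change rotCoord (p, a) x * rayMean p (area p F c) x =
    ∑ b, mulMat (dz c c' x p) b a * (rotCoord (p, b) x' * rayMean p (area p F c') x')
  have hx := zc_of_par_eq h p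
  by_cases hp : c p = c' p
  · rw [rayMean_area_transition hF h hp]
    rw [if_pos hp] at hx
    have h0 : x' (p, 0) = x (p, 0) := congrArg Complex.re hx
    have h1 : x' (p, 1) = x (p, 1) := congrArg Complex.im hx
    fin_cases a <;> simp [Fin.sum_univ_two, dz, hp, mulMat, rotCoord, h0, h1]
  · have hz := zc_ne_zero_of_par_eq h hp
    have hm := moment_add_moment hF hc hinv hlim hp h
    rw [moment, moment, ← norm_zc_sq, ← norm_zc_sq, hx, if_neg hp, norm_inv, norm_zc_sq] at hm
    rw [if_neg hp] at hx
    have h0 : x' (p, 0) = (zc p x)⁻¹.re := congrArg Complex.re hx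
    have h1 : x' (p, 1) = (zc p x)⁻¹.im := congrArg Complex.im hx
    rw [inv_pow, norm_zc_sq] at hm
    have hn : nsq p x ≠ 0 := fun h0 => hz (nsq_eq_zero_iff.1 h0)
    -- `|z|² f + |z|⁻² f' = 0` for the means `f`, `f'` in the two charts
    have hm' : rayMean p (area p F c') x' = -(nsq p x ^ 2 * rayMean p (area p F c) x) := by
      field_simp at hm
      linear_combination hm
    rw [hm', dz, if_neg hp, ← inv_pow]
    simp only [nsq] at hn
    have hn' : x (p, 0) * x (p, 0) + x (p, 1) * x (p, 1) ≠ 0 := by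
      rwa [← pow_two, ← pow_two]
    simp only [Fin.sum_univ_two, rotCoord, h0, h1, Complex.inv_re, Complex.inv_im, zc_re, zc_im,
      Complex.normSq_apply, mulMat, pow_two, Complex.neg_re, Complex.neg_im, Complex.mul_re,
      Complex.mul_im, nsq]
    fin_cases a
    · simp
      field_simp
      ring
    · simp
      field_simp
      ring

/-- A closed `J`-invariant 2-form which is invariant under both rotations is exact, if its moment
maps vanish at both poles. -/
lemma cohomologous_zero_of_invariant (hJ : JInvariant F) : Cohomologous F 0 :=
  ⟨_, isOneForm_primitive hF hc hinv hlim, fun c x i j => by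
    rw [← eq_exterior_derivative (fun i j => hF.1.1 c i j) (hF.2 c) (hc c) (hJ c)
      (fun p x => lieLin_rotMat_of_invariant hF.1 (hinv p) c x) x i j]
    exact sub_zero _⟩

end

/-! ### Periods -/

lemma slice_eq_point (p : Fin 2) (z : ℂ) : slice p z = point p z 0 := by
  funext ⟨r, a⟩
  by_cases h : r = p <;> simp [slice, point, ofZ, cpt, h]

lemma continuous_slice (p : Fin 2) : Continuous (slice p) := by
  have h : slice p = fun z => point p z 0 := funext (slice_eq_point p)
  rw [h]
  exact (continuous_point p).comp (Continuous.prodMk_left (0 : ℂ))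

lemma continuous_area_slice {F : Tensor2} (hF : IsTensorField F) (p : Fin 2) (c : Chart) :
    Continuous fun z => area p F c (slice p z) :=
  (hF.1 c _ _).continuous.comp (continuous_slice p)

/-- The area density of a 2-form in an affine coordinate decays like that of the round sphere. -/
lemma exists_abs_area_le {F : Tensor2} (hF : IsTwoForm F) (p : Fin 2) :
    ∃ C, ∀ z, |area p F 0 (slice p z)| ≤ C * (1 + ‖z‖ ^ 2) ^ (-(4 : ℝ) / 2) := by
  set c' : Chart := Function.update 0 p 1
  have hb : ∀ c, ∃ C, ∀ z ∈ Metric.closedBall (0 : ℂ) 1, ‖area p F c (slice p z)‖ ≤ C := fun c =>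
    (isCompact_closedBall _ _).exists_bound_of_continuousOn
      (continuous_area_slice hF.1 p c).continuousOn
  obtain ⟨C, hC⟩ := hb 0
  obtain ⟨C', hC'⟩ := hb c'
  have hpow : ∀ z : ℂ, (1 + ‖z‖ ^ 2) ^ (-(4 : ℝ) / 2) = ((1 + ‖z‖ ^ 2) ^ 2)⁻¹ := fun z => by
    rw [show (-(4 : ℝ) / 2) = -((2 : ℕ) : ℝ) by norm_num, Real.rpow_neg (by positivity),
      Real.rpow_natCast]
  have hC0 : 0 ≤ C := (norm_nonneg _).trans (hC 0 (by simp))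
  have hC'0 : 0 ≤ C' := (norm_nonneg _).trans (hC' 0 (by simp))
  refine ⟨4 * (C + C'), fun z => ?_⟩
  rw [hpow, ← div_eq_mul_inv, le_div_iff₀ (by positivity)]
  rcases le_total ‖z‖ 1 with hz | hz
  · have h1 := hC z (by simpa using hz)
    rw [Real.norm_eq_abs] at h1
    have h2 : (1 + ‖z‖ ^ 2) ^ 2 ≤ 4 := by
      have : ‖z‖ ^ 2 ≤ 1 := pow_le_one₀ (norm_nonneg _) hz
      nlinarith [sq_nonneg ‖z‖]
    calc _ ≤ C * 4 := mul_le_mul h1 h2 (by positivity) hC0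
      _ ≤ _ := by linarith
  · have hz0 : z ≠ 0 := norm_pos_iff.1 (by linarith)
    have hp : (0 : Chart) p ≠ c' p := by simp [c']
    have h : par 0 (slice p z) = par c' (slice p z⁻¹) := by
      rw [slice_eq_point, slice_eq_point, par_eq_par_iff]
      intro r
      by_cases hr : r = p
      · subst hr; right; exact ⟨hp, by simp [zc_point_self, hz0]⟩
      · left; simp [zc_point_of_ne hr, c', hr]
    have h1 := hC' z⁻¹ (by simpa using inv_le_one_of_one_le₀ hz)
    rw [Real.norm_eq_abs] at h1
    have hzc : zc p (slice p z) = z := by rw [slice_eq_point, zc_point_self]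
    rw [area_transition hF h, norm_dz_sq, if_neg hp, hzc, abs_mul,
      abs_of_nonneg (by positivity : (0 : ℝ) ≤ (‖z‖ ^ 4)⁻¹)]
    have h2 : (1 + ‖z‖ ^ 2) ^ 2 ≤ 4 * ‖z‖ ^ 4 := by
      have : 1 ≤ ‖z‖ ^ 2 := one_le_pow₀ hz
      nlinarith
    have h3 : (‖z‖ ^ 4)⁻¹ * (1 + ‖z‖ ^ 2) ^ 2 ≤ 4 := by
      rw [inv_mul_le_iff₀ (by positivity)]; linarith
    calc _ = |area p F c' (slice p z⁻¹)| * ((‖z‖ ^ 4)⁻¹ * (1 + ‖z‖ ^ 2) ^ 2) := by ring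
      _ ≤ C' * 4 := mul_le_mul h1 h3 (by positivity) hC'0
      _ ≤ _ := by linarith

lemma integrable_decay :
    MeasureTheory.Integrable fun z : ℂ => (1 + ‖z‖ ^ 2) ^ (-(4 : ℝ) / 2) :=
  integrable_rpow_neg_one_add_norm_sq (by rw [Complex.finrank_real_complex]; norm_num)

lemma integrable_area {F : Tensor2} (hF : IsTwoForm F) (p : Fin 2) :
    MeasureTheory.Integrable fun z => area p F 0 (slice p z) := by
  obtain ⟨C, hC⟩ := exists_abs_area_le hF p
  exact (integrable_decay.const_mul C).mono' (continuous_area_slice hF.1 p 0).aestronglyMeasurable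
    (Filter.Eventually.of_forall hC)

lemma period_sub {F G : Tensor2} (hF : IsTwoForm F) (hG : IsTwoForm G) (p : Fin 2) :
    period (F - G) p = period F p - period G p :=
  MeasureTheory.integral_sub (integrable_area hF p) (integrable_area hG p)

lemma area_rotate {F : Tensor2} (hF : IsTwoForm F) (p r : Fin 2) (s : ℝ) (c : Chart) (x : V) :
    area p (rotate r s F) c x = area p F c (blk (rotC r c s) *ᵥ x) := by
  set y := blk (rotC r c s) *ᵥ x
  have ha' : ∀ i j, F c y i j = -F c y j i := fun i j => congrFun₂ (hF.2 c y) j i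
  have h0 : ∀ i, F c y i i = 0 := fun i => by linarith [ha' i i]
  have hn : (rotC r c s p).re * (rotC r c s p).re + (rotC r c s p).im * (rotC r c s p).im = 1 := by
    rw [← Complex.normSq_apply, Complex.normSq_eq_norm_sq, norm_rotC, one_pow]
  rw [area, rotate, linPull, blk_mul_apply]
  simp only [Fin.sum_univ_two, mulMat, area]
  change _ * F c y _ _ * _ + _ * F c y _ _ * _ + (_ * F c y _ _ * _ + _ * F c y _ _ * _) = _
  simp only [h0, ha' (p, 1) (p, 0)]
  simp
  linear_combination F c y (p, 0) (p, 1) * hn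

lemma rotC_mulVec_slice (p r : Fin 2) (s : ℝ) (z : ℂ) :
    blk (rotC r 0 s) *ᵥ slice p z = slice p (rotC r 0 s p * z) := by
  refine ext_zc fun k => ?_
  rw [zc_blk_mulVec, slice_eq_point, slice_eq_point]
  by_cases h : k = p
  · subst h; simp [zc_point_self]
  · simp [zc_point_of_ne h]

lemma integral_comp_mul_of_norm_eq_one (f : ℂ → ℝ) {u : ℂ} (hu : ‖u‖ = 1) :
    ∫ z, f (u * z) = ∫ z, f z := by
  have h := (rotation ⟨u, mem_sphere_zero_iff_norm.2 hu⟩).measurePreserving.integral_comp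
    (rotation ⟨u, mem_sphere_zero_iff_norm.2 hu⟩).toHomeomorph.measurableEmbedding f
  exact h

/-- Averaging over rotations does not change the periods. -/
lemma period_average {F : Tensor2} (hF : IsTwoForm F) (p r : Fin 2) :
    period (average r F) p = period F p := by
  obtain ⟨C, hC⟩ := exists_abs_area_le hF p
  have h1 : ∀ s z, rotate r s F 0 (slice p z) (p, 0) (p, 1) =
      area p F 0 (slice p (rotC r 0 s p * z)) := fun s z => by
    rw [← rotC_mulVec_slice, ← area_rotate hF]; rfl
  have h2 : Continuous fun z : ℂ × ℝ => area p F 0 (slice p (rotC r 0 z.2 p * z.1)) := by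
    have h : Continuous fun z : ℂ × ℝ => rotC r 0 z.2 p * z.1 := by
      unfold rotC; fun_prop
    exact (continuous_area_slice hF.1 p 0).comp h
  have h3 : MeasureTheory.Integrable
      (Function.uncurry fun (z : ℂ) (s : ℝ) => area p F 0 (slice p (rotC r 0 s p * z)))
      (MeasureTheory.volume.prod (MeasureTheory.volume.restrict (Set.Ioc 0 (2 * Real.pi)))) := by
    refine ((integrable_decay.const_mul C).comp_fst _).mono' h2.aestronglyMeasurable
      (Filter.Eventually.of_forall fun z => ?_)
    have := hC (rotC r 0 z.2 p * z.1)
    rwa [norm_mul, norm_rotC, one_mul] at this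
  simp only [period, average, Matrix.of_apply, h1]
  rw [MeasureTheory.integral_const_mul]
  simp only [intervalIntegral.integral_of_le Real.two_pi_pos.le]
  rw [MeasureTheory.integral_integral_swap h3]
  simp only [integral_comp_mul_of_norm_eq_one (fun z => area p F 0 (slice p z)) (norm_rotC r 0 _ p)]
  rw [MeasureTheory.integral_const]
  simp [Real.two_pi_pos.le, area]
  field_simp

/-- The integral over the plane of a rotationally symmetric function. -/
lemma integral_radial {f : ℂ → ℝ} {φ : ℝ → ℝ} (h : ∀ z, f z = φ ‖z‖) :
    ∫ z, f z = 2 * Real.pi * ∫ y in Set.Ioi 0, y * φ y := by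
  simp only [h]
  rw [MeasureTheory.integral_fun_norm_addHaar MeasureTheory.volume φ, Complex.finrank_real_complex]
  simp [MeasureTheory.Measure.real, mul_assoc]

lemma integrable_radial {f : ℂ → ℝ} {φ : ℝ → ℝ} (h : ∀ z, f z = φ ‖z‖)
    (hf : MeasureTheory.Integrable f) :
    MeasureTheory.IntegrableOn (fun y => y * φ y) (Set.Ioi 0) := by
  simp only [funext h] at hf
  rw [MeasureTheory.integrable_fun_norm_addHaar MeasureTheory.volume,
    Complex.finrank_real_complex] at hf
  simpa using hf

/-- The moment map at the far pole is the period, up to a factor. -/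
lemma tendsto_moment {F : Tensor2} (hF : IsTwoForm F) {p : Fin 2} (hinv : ∀ u, rotate p u F = F)
    {z : ℂ} (hz : z ≠ 0) :
    Filter.Tendsto (fun t : ℝ => moment p F 0 (point p (Real.exp t * z) 0)) Filter.atTop
      (𝓝 ((2 * Real.pi)⁻¹ * period F p)) := by
  set φ : ℝ → ℝ := fun y => area p F 0 (slice p y) with hφ
  have h : ∀ z, area p F 0 (slice p z) = φ ‖z‖ := fun z => by
    have h1 := area_rotate hF p p (-(Complex.arg z)) 0 (slice p z)
    rw [hinv, rotC_mulVec_slice] at h1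
    rw [h1, hφ]
    congr 2
    have h2 : rotC p 0 (-(Complex.arg z)) p * (Complex.exp (Complex.arg z * Complex.I)) = 1 := by
      rw [rotC, ← Complex.exp_add]
      simp [rotGen, sgn]
    calc _ = rotC p 0 (-(Complex.arg z)) p * (‖z‖ * Complex.exp (Complex.arg z * Complex.I)) := by
          rw [Complex.norm_mul_exp_arg_mul_I]
      _ = _ := by rw [mul_left_comm, h2, mul_one]
  have hi := integrable_radial h (integrable_area hF p)
  have hper : (2 * Real.pi)⁻¹ * period F p = ∫ y in Set.Ioi 0, y * φ y := by
    have := integral_radial h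
    simp only [area] at this
    rw [period, this, inv_mul_cancel_left₀ Real.two_pi_pos.ne']
  have hm : ∀ w : ℂ, moment p F 0 (point p w 0) = ∫ y in (0 : ℝ)..‖w‖, y * φ y := fun w => by
    rw [moment, ← norm_zc_sq, zc_point_self, rayMean]
    have h1 : ∀ s ∈ Set.uIcc (0 : ℝ) 1, s * area p F 0 (scale p s (point p w 0)) =
        s * φ (‖w‖ * s) := fun s hs => by
      rw [Set.uIcc_of_le zero_le_one] at hs
      have h2 : scale p s (point p w 0) = slice p (s * w) := by
        rw [slice_eq_point]
        refine ext_zc fun r => ?_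
        rw [zc_scale]
        by_cases hr : r = p
        · subst hr; simp [zc_point_self]
        · simp [zc_point_of_ne hr]
      rw [h2, h, norm_mul, Complex.norm_real, Real.norm_of_nonneg hs.1, mul_comm ‖w‖]
    rw [intervalIntegral.integral_congr h1]
    have h3 := intervalIntegral.mul_integral_comp_mul_left (a := 0) (b := 1)
      (f := fun y => y * φ y) (c := ‖w‖)
    rw [mul_zero, mul_one] at h3
    rw [← h3, pow_two, mul_assoc, ← intervalIntegral.integral_const_mul]
    simp only [mul_assoc]
  rw [hper]
  simp only [hm]
  refine MeasureTheory.intervalIntegral_tendsto_integral_Ioi 0 hi ?_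
  have : ∀ t : ℝ, ‖(Real.exp t : ℂ) * z‖ = Real.exp t * ‖z‖ := fun t => by
    rw [norm_mul, Complex.norm_real, Real.norm_of_nonneg (Real.exp_pos t).le]
  simp only [this]
  exact Real.tendsto_exp_atTop.atTop_mul_const (norm_pos_iff.2 hz)

/-! ### Forms with equal periods -/

lemma IsClosedForm.sub {F G : Tensor2} (hF : IsTensorField F) (hG : IsTensorField G)
    (h : IsClosedForm F) (h' : IsClosedForm G) : IsClosedForm (F - G) := by
  intro c x i j k
  have e : ∀ i j k, pd i (fun y => (F - G) c y j k) x =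
      pd i (fun y => F c y j k) x - pd i (fun y => G c y j k) x := fun i j k =>
    pd_sub (hF.1 c j k).diffAt (hG.1 c j k).diffAt
  rw [e, e, e]
  linear_combination h c x i j k - h' c x i j k

lemma IsTwoForm.sub {F G : Tensor2} (hF : IsTwoForm F) (hG : IsTwoForm G) :
    IsTwoForm (F - G) := by
  refine ⟨⟨fun c i j => (hF.1.1 c i j).sub (hG.1.1 c i j),
    isPullback_id_iff.2 fun c c' x x' h => ?_⟩, fun c x => ?_⟩
  · simp only [Pi.sub_apply, Matrix.mul_sub, Matrix.sub_mul]
    rw [isPullback_id_iff.1 hF.1.2 _ _ _ _ h, isPullback_id_iff.1 hG.1.2 _ _ _ _ h]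
  · simp only [Pi.sub_apply, Matrix.transpose_sub, hF.2, hG.2]
    abel

lemma JInvariant.sub {F G : Tensor2} (hF : JInvariant F) (hG : JInvariant G) :
    JInvariant (F - G) := by
  intro c x
  simp only [Pi.sub_apply, Matrix.mul_sub, Matrix.sub_mul, hF c x, hG c x]

/-- Closed `J`-invariant 2-forms with the same periods are cohomologous. Averaging their difference
over both rotations changes neither its class nor its periods. -/
lemma cohomologous_of_period_eq {F G : Tensor2} (hF : IsTwoForm F) (hG : IsTwoForm G)
    (hFc : IsClosedForm F) (hGc : IsClosedForm G) (hFJ : JInvariant F) (hGJ : JInvariant G)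
    (h : ∀ p, period F p = period G p) : Cohomologous F G := by
  have hD := hF.sub hG
  have hDc := hFc.sub hF.1 hG.1 hGc
  have hDJ := hFJ.sub hGJ
  have h0 := hD.averaged 0
  have h0c := hDc.averaged 0 hD.1
  have h0J := hDJ.averaged 0 hD.1
  have h1 := h0.averaged 1
  have hinv : ∀ p u, rotate p u (average 1 (average 0 (F - G))) =
      average 1 (average 0 (F - G)) := fun p u => by
    have hp : p = 0 ∨ p = 1 := by omega
    rcases hp with rfl | rfl
    · exact rotate_average_of_invariant 1 h0.1 (rotate_average 0 hD.1) u
    · exact rotate_average 1 h0.1 u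
  obtain ⟨α, hα, e⟩ := ((cohomologous_average 0 hD hDc).symm.trans
    (cohomologous_average 1 h0 h0c).symm).trans
    (cohomologous_zero_of_invariant h1 (h0c.averaged 1 h0.1) hinv (fun p z hz => by
      have := tendsto_moment h1 (hinv p) hz
      rwa [period_average h0, period_average hD, period_sub hF hG, h, sub_self, mul_zero] at this)
      (h0J.averaged 1 h0.1))
  refine ⟨α, hα, fun c x i j => ?_⟩
  rw [← e]
  exact (sub_zero _).symm

/-! ### Kähler forms and areas -/

lemma IsKahler.isTwoForm {g : Tensor2} (hg : IsKahler g) : IsTwoForm (kahlerForm g) := by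
  refine ⟨hg.metric.1.kahlerForm, fun c x => ?_⟩
  have h1 : (g c x)ᵀ = g c x := (hg.metric.2 c x).isHermitian.eq
  have h2 : Jmat * Jmat = -1 := by
    ext ⟨p, a⟩ ⟨q, b⟩
    rw [Jmat_eq_blk, blk_mul_blk]
    simp only [blk, mulMat, Matrix.of_apply, Matrix.neg_apply, Matrix.one_apply, Prod.mk.injEq]
    fin_cases a <;> fin_cases b <;> by_cases h : p = q <;> simp [h]
  have h3 := congrArg (· * Jmat) (hg.hermitian c x)
  simp only [Matrix.mul_assoc, h2] at h3
  simp only [kahlerForm, Matrix.transpose_mul, Matrix.transpose_transpose, h1, ← h3]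
  simp

lemma IsKahler.jInvariant_kahlerForm {g : Tensor2} (hg : IsKahler g) :
    JInvariant (kahlerForm g) := by
  intro c x
  have := congrArg (Jmatᵀ * ·) (hg.hermitian c x)
  simpa only [kahlerForm, Matrix.mul_assoc] using this

lemma cohomologous_kahlerForm {g g' : Tensor2} (hg : IsKahler g) (hg' : IsKahler g')
    (h : ∀ p, period (kahlerForm g) p = period (kahlerForm g') p) :
    Cohomologous (kahlerForm g) (kahlerForm g') :=
  cohomologous_of_period_eq hg.isTwoForm hg'.isTwoForm hg.closed hg'.closed
    hg.jInvariant_kahlerForm hg'.jInvariant_kahlerForm h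

lemma period_pos {g : Tensor2} (hg : IsKahler g) (p : Fin 2) : 0 < period (kahlerForm g) p := by
  have e : ∀ x, kahlerForm g 0 x (p, 0) (p, 1) = g 0 x (p, 1) (p, 1) := fun x => by
    simp only [kahlerForm, Matrix.mul_apply, Matrix.transpose_apply, Jmat, Matrix.of_apply,
      Fintype.sum_prod_type]
    fin_cases p <;> simp
  have h0 : ∀ z, 0 < kahlerForm g 0 (slice p z) (p, 0) (p, 1) := fun z => by
    rw [e]; exact (hg.metric.2 0 _).diag_pos
  exact MeasureTheory.integral_pos_of_integrable_nonneg_nonzero (x := 0)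
    (continuous_area_slice hg.isTwoForm.1 p 0) (integrable_area hg.isTwoForm p)
    (fun z => (h0 z).le) (h0 0).ne'

/-- The area of the factor `p` for a rotationally symmetric product, from a primitive `E` of the
density. -/
lemma period_radial {e : Fin 2 → ℝ → ℝ} (hpos : ∀ r s, 0 ≤ s → 0 < e r s) {p : Fin 2} {E : ℝ → ℝ}
    {ℓ : ℝ} (hE : ∀ s, 0 ≤ s → HasDerivAt E (e p s) s)
    (hlim : Filter.Tendsto E Filter.atTop (𝓝 ℓ)) :
    period (kahlerForm (radial e)) p = Real.pi * (ℓ - E 0) := by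
  have h : ∀ z, kahlerForm (radial e) 0 (slice p z) (p, 0) (p, 1) = e p (‖z‖ ^ 2) := fun z => by
    rw [kahlerForm_radial, bform_apply, ← norm_zc_sq, slice_eq_point]
    simp [zc_point_self]
  rw [period, integral_radial (φ := fun y => e p (y ^ 2)) h]
  have hd : ∀ y ∈ Set.Ici (0 : ℝ), HasDerivAt (fun y => E (y ^ 2) / 2) (y * e p (y ^ 2)) y :=
    fun y _ => by
      refine (((hE _ (sq_nonneg y)).comp (h := fun y => y ^ 2) y
        (hasDerivAt_pow 2 y)).div_const 2).congr_deriv ?_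
      push_cast
      ring
  have hl : Filter.Tendsto (fun y : ℝ => E (y ^ 2) / 2) Filter.atTop (𝓝 (ℓ / 2)) :=
    (hlim.comp (Filter.tendsto_pow_atTop two_ne_zero)).div_const 2
  rw [MeasureTheory.integral_Ioi_of_hasDerivAt_of_nonneg' hd
    (fun y hy => mul_nonneg (le_of_lt hy) (hpos _ _ (sq_nonneg y)).le) hl]
  norm_num
  ring

lemma period_of_roundDensity {e : Fin 2 → ℝ → ℝ} (hpos : ∀ r s, 0 ≤ s → 0 < e r s) {p : Fin 2}
    {R : ℝ} (h : e p = roundDensity R) :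
    period (kahlerForm (radial e)) p = 4 * Real.pi * R ^ 2 := by
  have hl : Filter.Tendsto (fun s : ℝ => -(4 * R ^ 2) / (1 + s)) Filter.atTop (𝓝 0) :=
    (Filter.tendsto_atTop_add_const_left _ _ Filter.tendsto_id).const_div_atTop _
  rw [period_radial hpos (E := fun s => -(4 * R ^ 2) / (1 + s)) (fun s hs => ?_) hl]
  · simp; ring
  · have h1 : 1 + s ≠ 0 := by positivity
    rw [h]
    refine ((hasDerivAt_const s (-(4 * R ^ 2))).div ((hasDerivAt_id s).const_add 1) h1).congr_deriv ?_
    simp [roundDensity]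

lemma period_momentum {a b : ℝ} {T : ℝ → ℝ} (hT : IsProfile a b T) (p : Fin 2) {R : ℝ}
    (hR : 0 < R) :
    period (kahlerForm (radial (momentumDensity p T R))) p = 2 * Real.pi * (b - a) := by
  rw [period_radial (momentumDensity_pos hT hR) (E := fun s => 2 * T s) (ℓ := 2 * b) (fun s _ => ?_)
    (hT.tendsto.const_mul 2)]
  · rw [hT.zero]; ring
  · simpa [momentumDensity] using (hT.hasDerivAt s).const_mul 2

/-- The radius and the momentum interval of the second metric, from the areas `P` and `Q`. -/
lemma exists_interval {P Q : ℝ} (hQ : 0 < Q) (h : 2 * Q < P) :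
    ∃ a b : ℝ, 0 < a ∧ a < b ∧ 2 * Real.pi * (b - a) = P ∧
      4 * Real.pi * ((b - a) * a * b / (a + b) ^ 2) = Q := by
  have hP : 0 < P := by linarith
  have hy : 0 < 1 - 2 * Q / P := by rw [sub_pos, div_lt_one hP]; exact h
  have hy1 : 1 - 2 * Q / P < 1 := by
    have : 0 < 2 * Q / P := by positivity
    linarith
  -- The equations determine `b - a = d` and `a + b = d / τ`.
  set d := P / (2 * Real.pi) with hd
  set τ := Real.sqrt (1 - 2 * Q / P) with hτ
  have hd0 : 0 < d := by positivity
  have hτ0 : 0 < τ := Real.sqrt_pos.2 hy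
  have hτ1 : τ < 1 := by
    rw [hτ, Real.sqrt_lt' one_pos]; linarith
  have hτ2 : τ ^ 2 = 1 - 2 * Q / P := Real.sq_sqrt hy.le
  have hlt : d < d / τ := by rw [lt_div_iff₀ hτ0]; nlinarith
  refine ⟨(d / τ - d) / 2, (d / τ + d) / 2, by linarith, by linarith, ?_, ?_⟩
  · rw [hd]; field_simp; ring
  · have e : 4 * Real.pi * (((d / τ + d) / 2 - (d / τ - d) / 2) * ((d / τ - d) / 2) *
        ((d / τ + d) / 2) / ((d / τ - d) / 2 + (d / τ + d) / 2) ^ 2) =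
        Real.pi * d * (1 - τ ^ 2) := by
      field_simp
      ring
    rw [e, hτ2, hd]
    field_simp
    ring

end EinsteinMaxwell

end

theorem theoremC (g₀ : Tensor2) (hg₀ : IsKahler g₀) (p q : Fin 2) (hpq : p ≠ q)
    (harea : 4 * period (kahlerForm g₀) q < period (kahlerForm g₀) p) :
    ∃ (R : Fin 2 → ℝ) (a b : ℝ) (g₂ : Tensor2) (t : M → ℝ),
      (∀ i, 0 < R i) ∧ 0 < a ∧ a < b ∧
      -- the product of round spheres, with the constant potential `1`
      Cohomologous (kahlerForm (roundProduct R)) (kahlerForm g₀) ∧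
      Engenders (roundProduct R) (fun _ => 1) ∧
      LocallySymmetric (conformal (fun _ => 1) (roundProduct R)) ∧
      -- the metric with quartic momentum profile, with the potential `t`
      Cohomologous (kahlerForm g₂) (kahlerForm g₀) ∧
      IsMomentumProduct p q a b (Real.sqrt ((b - a) * a * b / (a + b) ^ 2)) g₂ t ∧
      Engenders g₂ t ∧
      ¬ LocallySymmetric (conformal t g₂) ∧
      -- the two metrics and the two solutions are different
      ¬ SameOrbit (roundProduct R) g₂ ∧
      ¬ Homothetic (conformal (fun _ => 1) (roundProduct R)) (conformal t g₂) := by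
  have hA := period_pos hg₀
  obtain ⟨a, b, ha, hab, hP, hQ⟩ := exists_interval (hA q) (by linarith [hA q] :
    2 * period (kahlerForm g₀) q < period (kahlerForm g₀) p)
  have hb : 0 < b := ha.trans hab
  have hrad : 0 < (b - a) * a * b / (a + b) ^ 2 := by
    have := sub_pos.2 hab
    positivity
  set R₂ := Real.sqrt ((b - a) * a * b / (a + b) ^ 2)
  have hR₂ : 0 < R₂ := Real.sqrt_pos.2 hrad
  have hR₂2 : R₂ ^ 2 = (b - a) * a * b / (a + b) ^ 2 := Real.sq_sqrt hrad.le
  obtain ⟨T, hT⟩ := exists_isProfile ha hab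
  set R : Fin 2 → ℝ := fun i => Real.sqrt (period (kahlerForm g₀) i / (4 * Real.pi))
  have hRpos : ∀ i, 0 < R i := fun i => Real.sqrt_pos.2 (div_pos (hA i) (by positivity))
  have hR2 : ∀ i, R i ^ 2 = period (kahlerForm g₀) i / (4 * Real.pi) := fun i =>
    Real.sq_sqrt (div_pos (hA i) (by positivity)).le
  have h1 := engenders_roundProduct hRpos
  have h2 := engenders_momentum hT hpq hR₂ ha hab hR₂2
  refine ⟨R, a, b, radial (momentumDensity p T R₂), momentum p b T, hRpos, ha, hab,
    cohomologous_kahlerForm h1.kahler hg₀ fun i => ?_, h1, ?_,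
    cohomologous_kahlerForm h2.kahler hg₀ fun i => ?_, isMomentumProduct hT hpq, h2,
    not_locallySymmetric_momentum hT hpq hR₂ ha hab hR₂2,
    not_sameOrbit_momentum hT hpq hR₂ ha hab hRpos, ?_⟩
  · rw [roundProduct_eq, period_of_roundDensity (R := R i)
      (fun r s hs => roundDensity_pos (hRpos r) hs) rfl, hR2]
    field_simp
  · rw [conformal_one]
    exact locallySymmetric_roundProduct hRpos
  · rcases eq_or_eq_of_ne hpq i with rfl | rfl
    · rw [period_momentum hT _ hR₂, hP]
    · rw [period_of_roundDensity (R := R₂) (momentumDensity_pos hT hR₂)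
        (by simp [momentumDensity, hpq.symm]), hR₂2, hQ]
  · rw [conformal_one]
    exact not_homothetic_momentum hT hpq hR₂ ha hab hR₂2 hRpos
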